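/- Let $p\ge 1$, let $M$ be a smooth $n$-manifold, $\Pi$ a smooth 2-vector field, $R$ a smooth $(p+1)$-vector field and $H$ a closed $(p+2)$-form on $M$. The graded manifold $T^*[p]T^*[1]M$ has, over a chart of $M$, coordinates $x^i,a_i,y^i,z_i$ of degrees $0,1,p-1,p$. Consider on it (sums over repeated indices) the degree-1 vector field $$Q=\Pi^{ji}a_j\partial_{x^i}-\tfrac12\partial_i\Pi^{jk}a_ja_k\partial_{a_i}+\Big((-1)^p\Pi^{ji}z_j-\partial_j\Pi^{ik}a_ky^j+\tfrac1{p!}R^{ij_1\dots j_p}a_{j_1}\cdots a_{j_p}\Big)\partial_{y^i}$$ $$\qquad+\Big(\partial_i\Pi^{jk}a_kz_j-\tfrac{(-1)^p}{2}\partial_i\partial_j\Pi^{kl}y^ja_ka_l+\tfrac{(-1)^p}{(p+1)!}f_i^{k_1\dots k_{p+1}}a_{k_1}\cdots a_{k_{p+1}}\Big)\partial_{z_i},$$ $$f_i^{k_1\dots k_{p+1}}=\partial_iR^{k_1\dots k_{p+1}}+\Pi^{k_1l_1}\cdots\Pi^{k_{p+1}l_{p+1}}H_{il_1\dots l_{p+1}},$$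 and the canonical symplectic form of degree $p$ $$\omega=\mathtt dx^i\wedge\mathtt dz_i+(-1)^p\,\mathtt da_i\wedge\mathtt dy^i .$$ Here signs are those of the total degree: $\mathtt d\xi$ has degree $|\xi|+1$, any two generators of degrees $k,l$ commute up to $(-1)^{kl}$, $\mathtt d$ is a left derivation of degree 1, and $L_Q=\iota_Q\mathtt d-\mathtt d\iota_Q$. (In the bigraded sign convention this is $\omega=\mathtt dx^i\wedge\mathtt dz_i-\mathtt dy^i\wedge\mathtt da_i=-\mathtt d(z_i\mathtt dx^i+y^i\mathtt da_i)$.) The triple $(T^*[p]T^*[1]M,\omega,Q)$ is a QP manifold of degree $p$ if $Q$ is a degree-1 vector field with $Q^2=0$, $\omega$ is a symplectic form of degree $p$, and $L_Q\omega=0$; these conditions are understood in every chart of $M$. The triple $(M,\Pi,R)$ is an $R$-Poisson manifold of order $p+1$ if the Schouten–Nijenhuis brackets satisfy $[\Pi,\Pi]=0$ and $[\Pi,R]=0$. Then: 1. If $H=0$, then $L_Q\omega=0$, and $(T^*[p]T^*[1]M,\omega,Q)$ is a QP manifold of degree $p$ if and only if $(M,\Pi,R)$ is an $R$-Poisson manifold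 of order $p+1$. 2. For general $H$, $L_Q\omega=0$ if and only if the twist term of $Q$ vanishes, i.e. $\Pi^{k_1l_1}\cdots\Pi^{k_{p+1}l_{p+1}}H_{il_1\dots l_{p+1}}=0$ for all $i,k_1,\dots,k_{p+1}$. 3. For general $H$, $(T^*[p]T^*[1]M,\omega,Q)$ is a QP manifold of degree $p$ if and only if $(M,\Pi,R)$ is an $R$-Poisson manifold of order $p+1$ and the twist term of $Q$ vanishes. 4. If there is a point $m\in M$ at which $\Pi$ is nondegenerate and $H_m\neq0$, then $L_Q\omega\ne0$. -/

import Mathlib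

open scoped Manifold ContDiff TensorProduct

noncomputable section

/-! ## Smooth functions on an open subset of a normed space -/

section SmoothFunctions

variable {F G : Type*} [NormedAddCommGroup F] [NormedSpace ℝ F]
  [NormedAddCommGroup G] [NormedSpace ℝ G]

/-- The algebra `C^∞(U)` of smooth real functions on the open set `U`. -/
def SmoothFun (U : TopologicalSpace.Opens F) : Subalgebra ℝ (U → ℝ) where
  carrier := {f | ∃ g : F → ℝ, ContDiffOn ℝ ∞ g U ∧ ∀ u : U, f u = g u}
  mul_mem' := by
    rintro _ _ ⟨g, hg, h⟩ ⟨g', hg', h'⟩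
    exact ⟨fun u => g u * g' u, hg.mul hg', fun u => by simp [h, h']⟩
  add_mem' := by
    rintro _ _ ⟨g, hg, h⟩ ⟨g', hg', h'⟩
    exact ⟨fun u => g u + g' u, hg.add hg', fun u => by simp [h, h']⟩
  algebraMap_mem' r := ⟨fun _ => r, contDiffOn_const, fun _ => rfl⟩

namespace SmoothFun

variable {U : TopologicalSpace.Opens F}

/-- The element of `C^∞(U)` given by a function that is smooth on `U`. -/
def of (g : F → ℝ) (hg : ContDiffOn ℝ ∞ g U) : SmoothFun U :=
  ⟨fun u => g u, g, hg, fun _ => rfl⟩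

/-- Extension by zero to the whole space (only its values on `U` are ever used). -/
def ext (f : SmoothFun U) : F → ℝ := Function.extend Subtype.val f.1 0

theorem ext_apply (f : SmoothFun U) (u : U) : SmoothFun.ext f u = f.1 u :=
  Subtype.val_injective.extend_apply f.1 0 u

theorem contDiffOn_ext (f : SmoothFun U) : ContDiffOn ℝ ∞ (SmoothFun.ext f) U := by
  obtain ⟨g, hg, h⟩ := f.2
  exact hg.congr fun u hu => by rw [ext_apply f ⟨u, hu⟩, h]

theorem differentiableAt_ext (f : SmoothFun U) (u : U) : DifferentiableAt ℝ (SmoothFun.ext f) u :=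
  ((contDiffOn_ext f).contDiffAt (U.isOpen.mem_nhds u.2)).differentiableAt (by simp)

/-- Two extensions with the same values on `U` have the same derivative on `U`. -/
theorem fderiv_congr {g g' : F → ℝ} (h : ∀ u : U, g u = g' u) (u : U) :
    fderiv ℝ g u = fderiv ℝ g' u :=
  Filter.EventuallyEq.fderiv_eq
    (Filter.eventually_of_mem (U.isOpen.mem_nhds u.2) fun w hw => h ⟨w, hw⟩)

/-- The directional derivative `∂_v : C^∞(U) → C^∞(U)`. -/
def partialD (v : F) : SmoothFun U →ₗ[ℝ] SmoothFun U where
  toFun f := ⟨fun u => fderiv ℝ (SmoothFun.ext f) u v, fun u => fderiv ℝ (SmoothFun.ext f) u v,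
    ((contDiffOn_ext f).fderiv_of_isOpen U.isOpen (by simp)).clm_apply contDiffOn_const,
    fun _ => rfl⟩
  map_add' f g := by
    ext u
    have h : ∀ w : U, (SmoothFun.ext (f + g)) w = (SmoothFun.ext f + (SmoothFun.ext g)) w := fun w => by
      simp [ext_apply]
    change fderiv ℝ (SmoothFun.ext (f + g)) u v = fderiv ℝ (SmoothFun.ext f) u v + fderiv ℝ (SmoothFun.ext g) u v
    rw [fderiv_congr h u, fderiv_add ((differentiableAt_ext f) u) ((differentiableAt_ext g) u)]
    rfl
  map_smul' r f := by
    ext u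
    have h : ∀ w : U, (SmoothFun.ext (r • f)) w = (r • (SmoothFun.ext f)) w := fun w => by
      simp [ext_apply]
    change fderiv ℝ (SmoothFun.ext (r • f)) u v = r • fderiv ℝ (SmoothFun.ext f) u v
    rw [fderiv_congr h u, fderiv_const_smul ((differentiableAt_ext f) u)]
    rfl

/-- Pull-back of smooth functions along a continuous linear map. -/
def comap (L : F →L[ℝ] G) {V : TopologicalSpace.Opens G} (f : SmoothFun V) :
    SmoothFun (TopologicalSpace.Opens.comap (L : C(F, G)) V) :=
  of (fun w => (SmoothFun.ext f) (L w)) ((contDiffOn_ext f).comp L.contDiff.contDiffOn fun _ hw => hw)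

end SmoothFun

end SmoothFunctions

/-! ## Graded domains and their differential forms

A graded domain has coordinates `ξ^c`, `c : ι`, of degrees `deg c`, and signs follow the parity of
the degree.  As a supermanifold, its body is an open set `W` in the space of the even coordinates,
and its functions are `C^∞(W)` tensored with the exterior algebra on the odd coordinates; the
integer grading is the weight with respect to the Euler vector field `∑ deg(c) ξ^c ∂/∂ξ^c`.

Differential forms are functions on the shifted tangent bundle: they are generated over the
functions by the symbols `dξ^c`, of total degree `deg c + 1`, all signs being those of the total
degree.  Hence `dξ^c` is anticommuting for `c` even and commuting for `c` odd.
-/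

namespace GradedDomain

variable {ι : Type} [Fintype ι] [DecidableEq ι] (deg : ι → ℕ)

/-- The space of the even coordinates. -/
abbrev Body : Type := {c : ι // Even (deg c)} → ℝ

variable {deg} (W : TopologicalSpace.Opens (Body deg))

/-- The algebra of differential forms.  The generator of the exterior algebra with index `c` is
`ξ^c` if `ξ^c` is odd and `dξ^c` if `ξ^c` is even; the polynomial generators are the `dξ^c` with
`ξ^c` odd. -/
abbrev Form : Type :=
  SmoothFun W ⊗[ℝ] (ExteriorAlgebra ℝ (ι → ℝ) ⊗[ℝ] MvPolynomial {c : ι // ¬ Even (deg c)} ℝ)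

/-- The inclusion of the smooth functions of the even coordinates. -/
def ofBody (f : SmoothFun W) : Form W := f ⊗ₜ 1

/-- The anticommuting generator with index `c`. -/
def oddGen (c : ι) : Form W := 1 ⊗ₜ (ExteriorAlgebra.ι ℝ (Pi.single c 1) ⊗ₜ 1)

/-- The left partial derivative with respect to the anticommuting generator with index `c`. -/
def oddGenD (c : ι) : Form W →ₗ[ℝ] Form W :=
  TensorProduct.map LinearMap.id
    (TensorProduct.map (CliffordAlgebra.contractLeft (LinearMap.proj c)) LinearMap.id)

/-- The coordinate function `ξ^c`. -/
def coord (c : ι) : Form W :=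
  if h : Even (deg c) then
    ofBody W (SmoothFun.of (fun w => w ⟨c, h⟩) (contDiff_apply ℝ ℝ _).contDiffOn)
  else oddGen W c

/-- The differential `dξ^c`. -/
def dcoord (c : ι) : Form W :=
  if h : Even (deg c) then oddGen W c else 1 ⊗ₜ (1 ⊗ₜ MvPolynomial.X ⟨c, h⟩)

/-- The left partial derivative `∂/∂ξ^c`. -/
def pd (c : ι) : Form W →ₗ[ℝ] Form W :=
  if h : Even (deg c) then
    TensorProduct.map (SmoothFun.partialD (Pi.single ⟨c, h⟩ 1)) LinearMap.id
  else oddGenD W c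

/-- The left partial derivative `∂/∂(dξ^c)`. -/
def pdd (c : ι) : Form W →ₗ[ℝ] Form W :=
  if h : Even (deg c) then oddGenD W c
  else TensorProduct.map LinearMap.id
    (TensorProduct.map LinearMap.id (MvPolynomial.pderiv ⟨c, h⟩).toLinearMap)

variable {W}

/-- `α` is a differential form of form degree `k`; the forms of form degree `0` are the functions
of the graded domain. -/
def IsForm (k : ℕ) (α : Form W) : Prop := ∑ c, dcoord W c * pdd W c α = (k : ℝ) • α

/-- The exterior differential `d = ∑ dξ^c ∂/∂ξ^c`. -/
def extD (α : Form W) : Form W := ∑ c, dcoord W c * pd W c α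

/-- The action `X f = ∑ X^c ∂f/∂ξ^c` of the vector field with components `X^c`. -/
def applyField (X : ι → Form W) (f : Form W) : Form W := ∑ c, X c * pd W c f

/-- The contraction `ι_X = ∑ X^c ∂/∂(dξ^c)` with a vector field. -/
def contract (X : ι → Form W) (α : Form W) : Form W := ∑ c, X c * pdd W c α

/-- The Lie derivative along a vector field of even degree: `ι_X` is odd, and
`L_X = [ι_X, d] = ι_X d + d ι_X`. -/
def lieEven (X : ι → Form W) (α : Form W) : Form W :=
  contract X (extD α) + extD (contract X α)

/-- The Lie derivative along a vector field of odd degree: `ι_X` is even, and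
`L_X = [ι_X, d] = ι_X d - d ι_X`. -/
def lieOdd (X : ι → Form W) (α : Form W) : Form W :=
  contract X (extD α) - extD (contract X α)

variable (W) in
/-- The Euler vector field `∑ deg(c) ξ^c ∂/∂ξ^c`. -/
def euler (c : ι) : Form W := (deg c : ℝ) • coord W c

/-- `α` has internal degree `k` (the degree for which `ξ^c` and `dξ^c` both have degree
`deg c`). -/
def HasDegree (k : ℕ) (α : Form W) : Prop := lieEven (euler W) α = (k : ℝ) • α

/-- The family `X` consists of functions, that is, it is the family of components of a vector
field. -/
def IsVectorField (X : ι → Form W) : Prop := ∀ c, IsForm 0 (X c)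

/-- `Q` is a homological vector field: a vector field of degree `1` with `Q² = 0`. -/
structure IsHomological (Q : ι → Form W) : Prop where
  isVectorField : IsVectorField Q
  hasDegree : ∀ c, HasDegree (deg c + 1) (Q c)
  sq_eq_zero : ∀ f, IsForm 0 f → applyField Q (applyField Q f) = 0

/-- `Ω` is a symplectic form of degree `k`: a closed `2`-form of internal degree `k` such that
`X ↦ ι_X Ω` is a bijection from vector fields to `1`-forms. -/
structure IsSymplectic (k : ℕ) (Ω : Form W) : Prop where
  isForm : IsForm 2 Ω
  hasDegree : HasDegree k Ω
  closed : extD Ω = 0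
  nondegenerate : ∀ α, IsForm 1 α → ∃! X : ι → Form W, IsVectorField X ∧ contract X Ω = α

/-- A `QP` structure of degree `k`: a homological vector field `Q` and a symplectic form `Ω` of
degree `k` with `L_Q Ω = 0`. -/
structure IsQP (k : ℕ) (Q : ι → Form W) (Ω : Form W) : Prop where
  homological : IsHomological Q
  symplectic : IsSymplectic k Ω
  compatible : lieOdd Q Ω = 0

end GradedDomain

/-! ## Multivector fields and differential forms on a smooth manifold -/

section Manifold

variable (n : ℕ) (M : Type*) [TopologicalSpace M] [ChartedSpace (EuclideanSpace ℝ (Fin n)) M]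

/-- The smooth charts of `M`. -/
abbrev SmoothChart : Type _ := ↥(IsManifold.maximalAtlas (𝓡 n) ∞ M)

variable {n M}

namespace SmoothChart

/-- The image of a chart, an open subset of `ℝⁿ`. -/
def image (e : SmoothChart n M) : TopologicalSpace.Opens (EuclideanSpace ℝ (Fin n)) :=
  ⟨e.1.target, e.1.open_target⟩

/-- The coordinate vector `∂_i` at the point with coordinates `u`. -/
def vec (e : SmoothChart n M) (u : EuclideanSpace ℝ (Fin n)) (i : Fin n) :
    TangentSpace (𝓡 n) (e.1.symm u) :=
  mfderiv (𝓡 n) (𝓡 n) e.1.symm u (EuclideanSpace.single i (1 : ℝ))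

/-- The coordinate covector `dx^i` at the point with coordinates `u`. -/
def covec (e : SmoothChart n M) (u : EuclideanSpace ℝ (Fin n)) (i : Fin n) :
    TangentSpace (𝓡 n) (e.1.symm u) →L[ℝ] ℝ :=
  (EuclideanSpace.proj i : EuclideanSpace ℝ (Fin n) →L[ℝ] ℝ).comp
    (mfderiv (𝓡 n) (𝓡 n) e.1 (e.1.symm u))

end SmoothChart

variable (n M)

/-- A smooth field of `k`-vectors on `M`.  A `k`-vector at `m` is regarded as an alternating
`k`-linear form on the cotangent space at `m`. -/
structure MultivectorField (k : ℕ) where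
  toFun : ∀ m : M, (TangentSpace (𝓡 n) m →L[ℝ] ℝ) [⋀^Fin k]→ₗ[ℝ] ℝ
  smooth : ∀ (e : SmoothChart n M) (I : Fin k → Fin n),
    ContDiffOn ℝ ∞ (fun u => toFun (e.1.symm u) fun r => e.covec u (I r)) e.image

/-- A smooth differential `k`-form on `M`. -/
structure DifferentialForm (k : ℕ) where
  toFun : ∀ m : M, TangentSpace (𝓡 n) m [⋀^Fin k]→ₗ[ℝ] ℝ
  smooth : ∀ (e : SmoothChart n M) (I : Fin k → Fin n),
    ContDiffOn ℝ ∞ (fun u => toFun (e.1.symm u) fun r => e.vec u (I r)) e.image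

variable {n M}

/-- The components `R^{i₁…i_k}` of a multivector field in a chart. -/
def MultivectorField.comp {k : ℕ} (R : MultivectorField n M k) (e : SmoothChart n M)
    (I : Fin k → Fin n) : SmoothFun e.image :=
  SmoothFun.of _ (R.smooth e I)

/-- The components `H_{i₁…i_k}` of a differential form in a chart. -/
def DifferentialForm.comp {k : ℕ} (H : DifferentialForm n M k) (e : SmoothChart n M)
    (I : Fin k → Fin n) : SmoothFun e.image :=
  SmoothFun.of _ (H.smooth e I)

/-- The partial derivative `∂_i` of a function of the coordinates. -/
abbrev coordD {V : TopologicalSpace.Opens (EuclideanSpace ℝ (Fin n))} (i : Fin n) :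
    SmoothFun V →ₗ[ℝ] SmoothFun V :=
  SmoothFun.partialD (EuclideanSpace.single i (1 : ℝ))

/-- `dH = 0`: in every chart, `∑ (-1)^r ∂_{l_r} H_{l_0 … l̂_r … l_k} = 0`. -/
def DifferentialForm.IsClosed {k : ℕ} (H : DifferentialForm n M k) : Prop :=
  ∀ (e : SmoothChart n M) (L : Fin (k + 1) → Fin n),
    ∑ r : Fin (k + 1), (-1 : ℝ) ^ (r : ℕ) • coordD (L r) (H.comp e fun s => L (r.succAbove s)) = 0

/-- The components in a chart of the Schouten–Nijenhuis bracket `[Π, R]` of a `2`-vector field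
and a `(q+1)`-vector field: the antisymmetrization, with weight one, of
`(q+2) Π^{k₀ i} ∂_i R^{k₁ … k_{q+1}} - (q+1)(q+2)/2 · R^{i k₀ … k_{q-1}} ∂_i Π^{k_q k_{q+1}}`. -/
def schouten {q : ℕ} (P : MultivectorField n M 2) (R : MultivectorField n M (q + 1))
    (e : SmoothChart n M) (K : Fin (q + 2) → Fin n) : SmoothFun e.image :=
  ((q + 2).factorial : ℝ)⁻¹ • ∑ σ : Equiv.Perm (Fin (q + 2)), ((Equiv.Perm.sign σ : ℤ) : ℝ) •
    ∑ i : Fin n,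
      ((q + 2 : ℝ) • (P.comp e ![K (σ 0), i] * coordD i (R.comp e fun r => K (σ r.succ)))
        - ((q + 1) * (q + 2) / 2 : ℝ) •
          (R.comp e (Fin.cons i fun r : Fin q => K (σ r.castSucc.castSucc)) *
            coordD i (P.comp e ![K (σ (Fin.last q).castSucc), K (σ (Fin.last (q + 1)))])))

/-- `Π` is a Poisson structure: `[Π, Π] = 0`. -/
def IsPoisson (P : MultivectorField n M 2) : Prop :=
  ∀ (e : SmoothChart n M) (K : Fin 3 → Fin n), schouten (q := 1) P P e K = 0

/-- `(M, Π, R)` is an (untwisted) `R`-Poisson manifold of order `p + 1`: `Π` is a Poisson structure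
and the `(p+1)`-vector field `R` satisfies `[Π, R] = 0`. -/
structure IsRPoisson {p : ℕ} (P : MultivectorField n M 2) (R : MultivectorField n M (p + 1)) :
    Prop where
  isPoisson : IsPoisson P
  bracket : ∀ (e : SmoothChart n M) (K : Fin (p + 2) → Fin n), schouten P R e K = 0

/-- `Π` is nondegenerate at the point `m`. -/
def NondegenerateAt (P : MultivectorField n M 2) (m : M) : Prop :=
  ∀ α : TangentSpace (𝓡 n) m →L[ℝ] ℝ, (∀ β, P.toFun m ![α, β] = 0) → α = 0

/-- The contraction of `H` with `p + 1` copies of `Π` vanishes: with `Π♯ : T^*M → TM` defined by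
`β(Π♯ α) = Π(α, β)`, one has `H(v, Π♯ α₁, …, Π♯ α_{p+1}) = 0` for all vectors `v` and covectors
`α_r`; in components, `Π^{k₁l₁} ⋯ Π^{k_{p+1}l_{p+1}} H_{i l₁ … l_{p+1}} = 0`. -/
def TwistVanishes {p : ℕ} (P : MultivectorField n M 2) (H : DifferentialForm n M (p + 2)) : Prop :=
  ∀ (m : M) (v : TangentSpace (𝓡 n) m) (α : Fin (p + 1) → (TangentSpace (𝓡 n) m →L[ℝ] ℝ))
    (w : Fin (p + 1) → TangentSpace (𝓡 n) m),
    (∀ r β, β (w r) = P.toFun m ![α r, β]) → H.toFun m (Fin.cons v w) = 0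

end Manifold

/-! ## The graded manifold `T^*[p]T^*[1]M`

In a chart of `M` it is the graded domain with coordinates `x^i`, `a_i`, `y^i`, `z_i` of degrees
`0`, `1`, `p - 1`, `p`.
-/

namespace ShiftedCotangent

open GradedDomain

/-- The indices of the coordinates: `(0, i)`, `(1, i)`, `(2, i)`, `(3, i)` stand for `x^i`, `a_i`,
`y^i`, `z_i`. -/
abbrev Idx (n : ℕ) : Type := Fin 4 × Fin n

/-- The degrees of the coordinates. -/
def deg (n p : ℕ) (c : Idx n) : ℕ := ![0, 1, p - 1, p] c.1

/-- The projection of the body onto the space of the coordinates `x^i`. -/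
def baseProj (n p : ℕ) : Body (deg n p) →L[ℝ] EuclideanSpace ℝ (Fin n) :=
  ((EuclideanSpace.equiv (Fin n) ℝ).symm : (Fin n → ℝ) →L[ℝ] EuclideanSpace ℝ (Fin n)).comp
    (ContinuousLinearMap.pi fun i => ContinuousLinearMap.proj ⟨(0, i), by simp [deg]⟩)

/-- The body of `T^*[p]T^*[1]V` for an open subset `V` of `ℝⁿ`. -/
def body {n : ℕ} (p : ℕ) (V : TopologicalSpace.Opens (EuclideanSpace ℝ (Fin n))) :
    TopologicalSpace.Opens (Body (deg n p)) :=
  TopologicalSpace.Opens.comap (baseProj n p : C(_, _)) V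

section Local

variable {n p : ℕ} {V : TopologicalSpace.Opens (EuclideanSpace ℝ (Fin n))}

variable (p) in
/-- A function of the coordinates `x^i`, as a function on `T^*[p]T^*[1]V`. -/
def ofBase (f : SmoothFun V) : Form (body p V) := ofBody (body p V) (SmoothFun.comap (baseProj n p) f)

variable (p V)

/-- The coordinate `a_i`. -/
def a (i : Fin n) : Form (body p V) := coord (body p V) (1, i)

/-- The coordinate `y^i`. -/
def y (i : Fin n) : Form (body p V) := coord (body p V) (2, i)

/-- The coordinate `z_i`. -/
def z (i : Fin n) : Form (body p V) := coord (body p V) (3, i)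

/-- The product `a_{j₁} ⋯ a_{j_q}`. -/
def aProd {q : ℕ} (J : Fin q → Fin n) : Form (body p V) :=
  (List.ofFn fun r => a p V (J r)).prod

/-- The canonical symplectic form `dx^i ∧ dz_i + (-1)^p da_i ∧ dy^i` of degree `p`. -/
def omega : Form (body p V) :=
  ∑ i : Fin n, (dcoord (body p V) (0, i) * dcoord (body p V) (3, i)
    + (-1 : ℝ) ^ p • (dcoord (body p V) (1, i) * dcoord (body p V) (2, i)))

end Local

variable {n p : ℕ} {M : Type*} [TopologicalSpace M]
  [ChartedSpace (EuclideanSpace ℝ (Fin n)) M]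
  (P : MultivectorField n M 2) (R : MultivectorField n M (p + 1)) (H : DifferentialForm n M (p + 2))
  (e : SmoothChart n M)

/-- The functions `f_i^{k₁ … k_{p+1}} = ∂_i R^{k₁ … k_{p+1}} + ∏_r Π^{k_r l_r} H_{i l₁ … l_{p+1}}`
(summed over the `l_r`). -/
def fCoeff (i : Fin n) (K : Fin (p + 1) → Fin n) : SmoothFun e.image :=
  coordD i (R.comp e K) +
    ∑ L : Fin (p + 1) → Fin n, (∏ r, P.comp e ![K r, L r]) * H.comp e (Fin.cons i L)

/-- The component `Q x^i = Π^{ji} a_j`. -/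
def Qx (i : Fin n) : Form (body p e.image) :=
  ∑ j : Fin n, ofBase p (P.comp e ![j, i]) * a p e.image j

/-- The component `Q a_i = -1/2 ∂_i Π^{jk} a_j a_k`. -/
def Qa (i : Fin n) : Form (body p e.image) :=
  -(2⁻¹ : ℝ) • ∑ j : Fin n, ∑ k : Fin n,
    ofBase p (coordD i (P.comp e ![j, k])) * a p e.image j * a p e.image k

/-- The component
`Q y^i = (-1)^p Π^{ji} z_j - ∂_j Π^{ik} a_k y^j + 1/p! R^{i j₁ … j_p} a_{j₁} ⋯ a_{j_p}`. -/
def Qy (i : Fin n) : Form (body p e.image) :=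
  (-1 : ℝ) ^ p • ∑ j : Fin n, ofBase p (P.comp e ![j, i]) * z p e.image j
    - ∑ j : Fin n, ∑ k : Fin n,
        ofBase p (coordD j (P.comp e ![i, k])) * a p e.image k * y p e.image j
    + (p.factorial : ℝ)⁻¹ • ∑ J : Fin p → Fin n,
        ofBase p (R.comp e (Fin.cons i J)) * aProd p e.image J

/-- The component
`Q z_i = ∂_i Π^{jk} a_k z_j - (-1)^p/2 ∂_i ∂_j Π^{kl} y^j a_k a_l
  + (-1)^p/(p+1)! f_i^{k₁ … k_{p+1}} a_{k₁} ⋯ a_{k_{p+1}}`. -/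
def Qz (i : Fin n) : Form (body p e.image) :=
  ∑ j : Fin n, ∑ k : Fin n,
      ofBase p (coordD i (P.comp e ![j, k])) * a p e.image k * z p e.image j
    - ((-1 : ℝ) ^ p / 2) • ∑ j : Fin n, ∑ k : Fin n, ∑ l : Fin n,
        ofBase p (coordD i (coordD j (P.comp e ![k, l]))) * y p e.image j * a p e.image k *
          a p e.image l
    + ((-1 : ℝ) ^ p / (p + 1).factorial) • ∑ K : Fin (p + 1) → Fin n,
        ofBase p (fCoeff P R H e i K) * aProd p e.image K

/-- The vector field `Q` on `T^*[p]T^*[1]M` determined by `Π`, `R` and `H`, in a chart of `M`. -/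
def Q (c : Idx n) : Form (body p e.image) :=
  ![Qx P e c.2, Qa P e c.2, Qy P R e c.2, Qz P R H e c.2] c.1

/-- The compatibility condition `L_Q ω = 0` on `T^*[p]T^*[1]M`. -/
def Compatible : Prop := ∀ e : SmoothChart n M, lieOdd (Q P R H e) (omega p e.image) = 0

/-- `(T^*[p]T^*[1]M, ω, Q)` is a `QP` manifold of degree `p`. -/
def IsQPManifold : Prop := ∀ e : SmoothChart n M, IsQP p (Q P R H e) (omega p e.image)

end ShiftedCotangent

end

set_option linter.unusedSectionVars false

noncomputable section

/-! ### Calculus of directional derivatives on an open set. -/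

namespace SmoothFun

variable {F : Type*} [NormedAddCommGroup F] [NormedSpace ℝ F] {U : TopologicalSpace.Opens F}

/-! In a chart, put `π = ½ Π^{jk} a_j a_k` and `Θ = (∂π/∂a_j) z_j - (-1)^p y^j ∂π/∂x^j +
(-1)^p/(p+1)! R^K a_K`. With `H = 0` the field `Q` is the Hamiltonian field of `Θ`; in general it
differs from that field only in the directions `∂/∂z_i`, by multiples of `T_i = T_i^K a_K`, where
`T` is the twist term (`Q_eq`).

Compatibility. Since `z_i` is conjugate to `x^i`, `ι_Q ω = dΘ - 1/(p+1)! T_i dx^i`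
(`contract_twistedField`). As `dω = 0` and `d² = 0`, `L_Q ω` is a nonzero multiple of `d(T_i dx^i)`.
Its `da_k dx^i` coefficient is `∂T_i/∂a_k` up to sign, and `T_i` is homogeneous of positive degree
in the `a`'s. Hence `L_Q ω = 0` exactly when `T = 0` (`lieOdd_twistedField_eq_zero_iff`).

Square. Once `T = 0`, the field `Q` is odd and Hamiltonian, and `∂_e(QΘ) = ± 2 Q(∂_e Θ)`
(`IsHamiltonian.pd_applyField`). So `Q² = 0` exactly when every partial derivative of `QΘ` vanishes.
Let `D` be the Hamiltonian field of `π` on `T^*[1]M`. Conjugate pairs contribute equally to `QΘ`, so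
`QΘ = 2 DΘ` (`applyField_hamField_theta`). Moreover `DΘ` is built linearly from derivatives of `Dπ`
and from `D(R^K a_K)` (`applyField_bivField_theta`), and these two functions encode `[Π,Π]` and
`[Π,R]` (`aSum_preSchouten`). Differentiating in `z`, then in `a`, separates the two brackets.

Invariance. By multilinearity the components of `T` vanish in all charts exactly when `H(v, Π♯α_1,
…) = 0` for all arguments (`twistCoeff_eq_zero_iff`). Where `Π` is nondegenerate every vector is
some `Π♯α`, which forces `H_m = 0`. -/

theorem partialD_apply (v : F) (f : SmoothFun U) (u : U) :
    (partialD v f).1 u = fderiv ℝ (SmoothFun.ext f) u v := rfl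

theorem partialD_mul (v : F) (f g : SmoothFun U) :
    partialD v (f * g) = partialD v f * g + f * partialD v g := by
  ext u
  have h : ∀ w : U, SmoothFun.ext (f * g) w = (SmoothFun.ext f * SmoothFun.ext g) w := fun w => by
    simp [ext_apply]
  change fderiv ℝ (SmoothFun.ext (f * g)) u v = fderiv ℝ (SmoothFun.ext f) u v * g.1 u
    + f.1 u * fderiv ℝ (SmoothFun.ext g) u v
  rw [fderiv_congr h u, fderiv_mul (differentiableAt_ext f u) (differentiableAt_ext g u)]
  simp [ext_apply]
  ring

theorem partialD_one (v : F) : partialD v (1 : SmoothFun U) = 0 := by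
  have h := partialD_mul v (1 : SmoothFun U) 1
  simpa using h

/-- Symmetry of the second derivative. The extension by zero is smooth only on `U`, so every
derivative is taken at a point of `U`, which has a neighbourhood inside `U`. -/
theorem partialD_comm (v w : F) (f : SmoothFun U) :
    partialD v (partialD w f) = partialD w (partialD v f) := by
  ext u
  have hu : (U : Set F) ∈ nhds (u : F) := U.isOpen.mem_nhds u.2
  have hf : ContDiffAt ℝ ∞ (SmoothFun.ext f) u := (contDiffOn_ext f).contDiffAt hu
  have key : ∀ v w : F, (partialD v (partialD w f)).1 u
      = fderiv ℝ (fderiv ℝ (SmoothFun.ext f)) u v w := by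
    intro v w
    -- On `U` the extension of `∂_w f` agrees with `x ↦ f'(x) w`, so both have the same derivative
    -- there.
    rw [partialD_apply, fderiv_congr (g' := fun x => fderiv ℝ (SmoothFun.ext f) x w)
      (fun x => by rw [ext_apply, partialD_apply]) u]
    have hd : DifferentiableAt ℝ (fderiv ℝ (SmoothFun.ext f)) u :=
      (hf.fderiv_right (m := 1) (by norm_cast)).differentiableAt (by simp)
    rw [fderiv_clm_apply hd (differentiableAt_const w)]
    simp
  rw [key, key]
  exact (hf.isSymmSndFDerivAt (by simp only [minSmoothness_of_isRCLikeNormedField]; norm_cast)).eq v w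

end SmoothFun

/-! ### Contraction and grade involution on the exterior algebra. -/

namespace ExteriorAlgebra

variable {V : Type*} [AddCommGroup V] [Module ℝ V]

/-- Contraction is an antiderivation. Induct on the left factor one vector at a time: each vector
that the contraction passes costs a sign, and `involute` counts these signs. -/
theorem contractLeft_mul (d : Module.Dual ℝ V) (x y : ExteriorAlgebra ℝ V) :
    CliffordAlgebra.contractLeft d (x * y) = CliffordAlgebra.contractLeft d x * y
      + CliffordAlgebra.involute x * CliffordAlgebra.contractLeft d y := by
  induction x using CliffordAlgebra.left_induction with
  | algebraMap r => simp [CliffordAlgebra.contractLeft_algebraMap_mul]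
  | add x y hx hy => simp only [add_mul, map_add, hx, hy]; abel
  | ι_mul x m hx =>
    rw [mul_assoc, CliffordAlgebra.contractLeft_ι_mul, hx, CliffordAlgebra.contractLeft_ι_mul,
      map_mul, CliffordAlgebra.involute_ι]
    simp only [sub_mul, smul_mul_assoc, mul_add, neg_mul, mul_assoc]
    abel

theorem contractLeft_involute (d : Module.Dual ℝ V) (x : ExteriorAlgebra ℝ V) :
    CliffordAlgebra.contractLeft d (CliffordAlgebra.involute x)
      = - CliffordAlgebra.involute (CliffordAlgebra.contractLeft d x) := by
  induction x using CliffordAlgebra.left_induction with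
  | algebraMap r => simp [CliffordAlgebra.contractLeft_algebraMap]
  | add x y hx hy => simp only [map_add, hx, hy]; abel
  | ι_mul x m hx =>
    rw [map_mul, CliffordAlgebra.involute_ι, neg_mul, map_neg, CliffordAlgebra.contractLeft_ι_mul,
      hx, CliffordAlgebra.contractLeft_ι_mul, map_sub, map_smul, map_mul, CliffordAlgebra.involute_ι]
    simp

theorem ι_mul_comm (v : V) (x : ExteriorAlgebra ℝ V) :
    ExteriorAlgebra.ι ℝ v * x = CliffordAlgebra.involute x * ExteriorAlgebra.ι ℝ v := by
  induction x using CliffordAlgebra.left_induction with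
  | algebraMap r => simp [Algebra.commutes]
  | add x y hx hy => simp only [map_add, mul_add, add_mul, hx, hy]
  | ι_mul x m hx =>
    have h : ExteriorAlgebra.ι ℝ v * ExteriorAlgebra.ι ℝ m
        = - (ExteriorAlgebra.ι ℝ m * ExteriorAlgebra.ι ℝ v) :=
      eq_neg_of_add_eq_zero_left (ExteriorAlgebra.ι_add_mul_swap v m)
    have e : CliffordAlgebra.ι (0 : QuadraticForm ℝ V) m = ExteriorAlgebra.ι ℝ m := rfl
    rw [map_mul, CliffordAlgebra.involute_ι, e, ← mul_assoc, h, neg_mul, neg_mul, neg_mul, mul_assoc,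
      hx, mul_assoc]

end ExteriorAlgebra

/-! ### Left derivatives on the algebra of forms, with their signs. -/

namespace GradedDomain

variable {ι : Type} [Fintype ι] [DecidableEq ι] {deg : ι → ℕ}
  {W : TopologicalSpace.Opens (Body deg)}

instance : Ring (Form W) := Algebra.TensorProduct.instRing

instance : AddCommGroup (Form W) := Ring.toAddCommGroup

instance : AddGroup (Form W) := AddCommGroup.toAddGroup

instance : Algebra ℝ (Form W) := Algebra.TensorProduct.leftAlgebra

instance : Module ℝ (Form W) := Algebra.toModule

@[elab_as_elim]
theorem form_induction {motive : Form W → Prop} (α : Form W)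
    (tmul : ∀ f x q, motive (f ⊗ₜ (x ⊗ₜ q)))
    (add : ∀ α β, motive α → motive β → motive (α + β)) : motive α := by
  have zero : motive 0 := by simpa using tmul 0 0 0
  induction α using TensorProduct.induction_on with
  | zero => exact zero
  | add α β hα hβ => exact add α β hα hβ
  | tmul f w =>
    induction w using TensorProduct.induction_on with
    | zero => simpa using zero
    | add a b ha hb => rw [TensorProduct.tmul_add]; exact add _ _ ha hb
    | tmul x q => exact tmul f x q

variable (W) in
/-- The grade involution: the automorphism that changes the sign of the odd generators. -/
def gradeInv : Form W →ₐ[ℝ] Form W :=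
  Algebra.TensorProduct.map (AlgHom.id ℝ _)
    (Algebra.TensorProduct.map CliffordAlgebra.involute (AlgHom.id ℝ _))

theorem gradeInv_tmul (f : SmoothFun W) (x : ExteriorAlgebra ℝ (ι → ℝ))
    (q : MvPolynomial {c : ι // ¬ Even (deg c)} ℝ) :
    gradeInv W (f ⊗ₜ (x ⊗ₜ q)) = f ⊗ₜ (CliffordAlgebra.involute x ⊗ₜ q) := rfl

theorem gradeInv_gradeInv (α : Form W) : gradeInv W (gradeInv W α) = α := by
  induction α using form_induction with
  | tmul f x q => simp [gradeInv_tmul]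
  | add α β hα hβ => simp [hα, hβ]

variable (W) in
/-- The power `k` of the grade involution. -/
def twist (k : ℕ) : Form W →ₐ[ℝ] Form W := if Even k then AlgHom.id ℝ _ else gradeInv W

theorem twist_even {k : ℕ} (h : Even k) (α : Form W) : twist W k α = α := by simp [twist, h]

theorem twist_odd {k : ℕ} (h : ¬ Even k) (α : Form W) : twist W k α = gradeInv W α := by
  simp [twist, h]

/-- `α` is homogeneous of parity `k`. -/
def Par (k : ℕ) (α : Form W) : Prop := gradeInv W α = (-1 : ℝ) ^ k • α

theorem Par.twist_eq {k : ℕ} {α : Form W} (h : Par k α) (j : ℕ) :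
    twist W j α = (-1 : ℝ) ^ (j * k) • α := by
  by_cases hj : Even j
  · rw [twist_even hj, (hj.mul_right k).neg_one_pow, one_smul]
  · rw [twist_odd hj, h, pow_mul, (Nat.not_even_iff_odd.1 hj).neg_one_pow]

theorem Par.mul {k l : ℕ} {α β : Form W} (hα : Par k α) (hβ : Par l β) : Par (k + l) (α * β) := by
  rw [Par, map_mul, hα, hβ, smul_mul_smul_comm, pow_add]

theorem Par.add {k : ℕ} {α β : Form W} (hα : Par k α) (hβ : Par k β) : Par k (α + β) := by
  rw [Par, map_add, hα, hβ, smul_add]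

theorem Par.smul {k : ℕ} {α : Form W} (r : ℝ) (hα : Par k α) : Par k (r • α) := by
  rw [Par, map_smul, hα, smul_comm]

theorem Par.sub {k : ℕ} {α β : Form W} (hα : Par k α) (hβ : Par k β) : Par k (α - β) := by
  rw [Par, map_sub, hα, hβ, smul_sub]

theorem Par.sum {κ : Type*} {s : Finset κ} {k : ℕ} {α : κ → Form W} (h : ∀ i ∈ s, Par k (α i)) :
    Par k (∑ i ∈ s, α i) := by
  rw [Par, map_sum, Finset.smul_sum]
  exact Finset.sum_congr rfl h

theorem Par.congr {k l : ℕ} {α : Form W} (hα : Par k α) (h : Even k ↔ Even l) : Par l α := by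
  rw [Par, hα, neg_one_pow_congr h]

/-! ### Generators and their partial derivatives -/

/-- The parity of the generator `ξ^c` (for `(c, false)`) or `dξ^c` (for `(c, true)`). -/
def parity (deg : ι → ℕ) (g : ι × Bool) : ℕ := deg g.1 + g.2.toNat

variable (W) in
/-- The generator `ξ^c` (for `(c, false)`) or `dξ^c` (for `(c, true)`). -/
def gen (g : ι × Bool) : Form W := if g.2 then dcoord W g.1 else coord W g.1

variable (W) in
/-- The left partial derivative with respect to a generator. -/
def der (g : ι × Bool) : Form W →ₗ[ℝ] Form W := if g.2 then pdd W g.1 else pd W g.1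

theorem gen_odd {g : ι × Bool} (h : ¬ Even (parity deg g)) : gen W g = oddGen W g.1 := by
  obtain ⟨c, _ | _⟩ := g
  · have : ¬ Even (deg c) := by simpa [parity] using h
    simp [gen, coord, this]
  · have : Even (deg c) := by simpa [parity, Nat.even_add_one] using h
    simp [gen, dcoord, this]

theorem der_odd {g : ι × Bool} (h : ¬ Even (parity deg g)) : der W g = oddGenD W g.1 := by
  obtain ⟨c, _ | _⟩ := g
  · have : ¬ Even (deg c) := by simpa [parity] using h
    simp [der, pd, this]
  · have : Even (deg c) := by simpa [parity, Nat.even_add_one] using h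
    simp [der, pdd, this]

theorem der_smooth {c : ι} (h : Even (deg c)) : der W (c, false) =
    TensorProduct.map (SmoothFun.partialD (Pi.single ⟨c, h⟩ 1)) LinearMap.id := by
  simp [der, pd, h]

theorem der_poly {c : ι} (h : ¬ Even (deg c)) : der W (c, true) =
    TensorProduct.map LinearMap.id
      (TensorProduct.map LinearMap.id (MvPolynomial.pderiv ⟨c, h⟩).toLinearMap) := by
  simp [der, pdd, h]

theorem gen_smooth {c : ι} (h : Even (deg c)) : gen W (c, false) =
    ofBody W (SmoothFun.of (fun w => w ⟨c, h⟩) (contDiff_apply ℝ ℝ _).contDiffOn) := by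
  simp [gen, coord, h]

theorem gen_poly {c : ι} (h : ¬ Even (deg c)) :
    gen W (c, true) = 1 ⊗ₜ (1 ⊗ₜ MvPolynomial.X ⟨c, h⟩) := by
  simp [gen, dcoord, h]

/-- One case for each tensor factor of `Form W`: odd generators lie in the exterior algebra, even
coordinates are smooth functions, and differentials of odd coordinates are polynomial variables. -/
theorem generator_cases (deg : ι → ℕ) (g : ι × Bool) : ¬ Even (parity deg g) ∨
    (∃ (c : ι) (_ : Even (deg c)), g = (c, false)) ∨ ∃ (c : ι) (_ : ¬ Even (deg c)), g = (c, true) := by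
  obtain ⟨c, _ | _⟩ := g <;> by_cases h : Even (deg c) <;> simp_all [parity, Nat.even_add_one]

theorem parity_even_smooth {c : ι} (h : Even (deg c)) : Even (parity deg (c, false)) := by
  simpa [parity] using h

theorem parity_even_poly {c : ι} (h : ¬ Even (deg c)) : Even (parity deg (c, true)) := by
  simpa [parity, Nat.even_add_one] using h

/-- On pure tensors a derivative acts on one tensor factor only. On the exterior factor it is an
antiderivation, whence the twist; on the two commutative factors it satisfies the ordinary Leibniz
rule. -/
theorem der_mul (g : ι × Bool) (α β : Form W) :
    der W g (α * β) = der W g α * β + twist W (parity deg g) α * der W g β := by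
  induction α using form_induction with
  | add α α' hα hα' => simp only [add_mul, map_add, hα, hα']; abel
  | tmul f x q =>
    induction β using form_induction with
    | add β β' hβ hβ' => simp only [mul_add, map_add, hβ, hβ']; abel
    | tmul f' x' q' =>
      rcases generator_cases deg g with h | ⟨c, h, rfl⟩ | ⟨c, h, rfl⟩
      · rw [der_odd h, twist_odd h, gradeInv_tmul]
        simp only [oddGenD, Algebra.TensorProduct.tmul_mul_tmul, TensorProduct.map_tmul,
          LinearMap.id_apply, ExteriorAlgebra.contractLeft_mul, TensorProduct.add_tmul,
          TensorProduct.tmul_add]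
      · rw [der_smooth h, twist_even (parity_even_smooth h)]
        simp only [Algebra.TensorProduct.tmul_mul_tmul, TensorProduct.map_tmul,
          LinearMap.id_apply, SmoothFun.partialD_mul, TensorProduct.add_tmul]
      · rw [der_poly h, twist_even (parity_even_poly h)]
        simp only [Algebra.TensorProduct.tmul_mul_tmul, TensorProduct.map_tmul,
          LinearMap.id_apply, Derivation.coeFn_coe,
          Derivation.leibniz, TensorProduct.tmul_add, smul_eq_mul]
        rw [add_comm, mul_comm q']

theorem der_one (g : ι × Bool) : der W g 1 = 0 := by
  have h := der_mul g (1 : Form W) 1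
  rw [map_one (twist W _), mul_one, mul_one, one_mul] at h
  exact left_eq_add.1 h

theorem der_gradeInv (g : ι × Bool) (α : Form W) :
    der W g (gradeInv W α) = (-1 : ℝ) ^ parity deg g • gradeInv W (der W g α) := by
  induction α using form_induction with
  | add α α' hα hα' => simp only [map_add, hα, hα', smul_add]
  | tmul f x q =>
    rcases generator_cases deg g with h | ⟨c, h, rfl⟩ | ⟨c, h, rfl⟩
    · rw [der_odd h, (Nat.not_even_iff_odd.1 h).neg_one_pow, neg_one_smul]
      simp only [gradeInv_tmul, oddGenD, TensorProduct.map_tmul, LinearMap.id_apply,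
        ExteriorAlgebra.contractLeft_involute, TensorProduct.neg_tmul, TensorProduct.tmul_neg]
    · rw [der_smooth h, (parity_even_smooth h).neg_one_pow, one_smul]
      simp only [gradeInv_tmul, TensorProduct.map_tmul, LinearMap.id_apply]
    · rw [der_poly h, (parity_even_poly h).neg_one_pow, one_smul]
      simp only [gradeInv_tmul, TensorProduct.map_tmul, LinearMap.id_apply]

theorem Par.deriv {k : ℕ} {α : Form W} (hα : Par k α) (g : ι × Bool) :
    Par (parity deg g + k) (der W g α) := by
  have h := der_gradeInv g α
  rw [hα, map_smul] at h
  have h2 := congrArg (fun β => (-1 : ℝ) ^ parity deg g • β) h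
  simp only [smul_smul, ← pow_add, ← two_mul] at h2
  rw [Par, h2]
  simp

/-- Derivatives acting on different tensor factors commute. On a common factor, contractions
anticommute, smooth partial derivatives commute by symmetry of second derivatives, and polynomial
ones commute as derivations. -/
theorem der_comm (g h : ι × Bool) (α : Form W) :
    der W g (der W h α) = (-1 : ℝ) ^ (parity deg g * parity deg h) • der W h (der W g α) := by
  induction α using form_induction with
  | add α α' hα hα' => simp only [map_add, hα, hα', smul_add]
  | tmul f x q =>
    have e1 := fun {g : ι × Bool} (hg : Even (parity deg g)) (h : ι × Bool) =>
      (hg.mul_right (parity deg h)).neg_one_pow (α := ℝ)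
    have e2 := fun {g : ι × Bool} (hg : Even (parity deg g)) (h : ι × Bool) =>
      (hg.mul_left (parity deg h)).neg_one_pow (α := ℝ)
    rcases generator_cases deg g with hg | ⟨c, hg, rfl⟩ | ⟨c, hg, rfl⟩ <;>
    rcases generator_cases deg h with hh | ⟨d, hh, rfl⟩ | ⟨d, hh, rfl⟩
    · rw [der_odd hg, der_odd hh, ((Nat.not_even_iff_odd.1 hg).mul
        (Nat.not_even_iff_odd.1 hh)).neg_one_pow, neg_one_smul]
      simp only [oddGenD, TensorProduct.map_tmul, LinearMap.id_apply]
      rw [CliffordAlgebra.contractLeft_comm]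
      simp only [TensorProduct.neg_tmul, TensorProduct.tmul_neg]
    · rw [der_odd hg, der_smooth hh, e2 (parity_even_smooth hh), one_smul]
      simp only [oddGenD, TensorProduct.map_tmul, LinearMap.id_apply]
    · rw [der_odd hg, der_poly hh, e2 (parity_even_poly hh), one_smul]
      simp only [oddGenD, TensorProduct.map_tmul, LinearMap.id_apply]
    · rw [der_odd hh, der_smooth hg, e1 (parity_even_smooth hg), one_smul]
      simp only [oddGenD, TensorProduct.map_tmul, LinearMap.id_apply]
    · rw [der_smooth hg, der_smooth hh, e1 (parity_even_smooth hg), one_smul]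
      simp only [TensorProduct.map_tmul, LinearMap.id_apply]
      rw [SmoothFun.partialD_comm]
    · rw [der_smooth hg, der_poly hh, e1 (parity_even_smooth hg), one_smul]
      simp only [TensorProduct.map_tmul, LinearMap.id_apply]
    · rw [der_odd hh, der_poly hg, e1 (parity_even_poly hg), one_smul]
      simp only [oddGenD, TensorProduct.map_tmul, LinearMap.id_apply]
    · rw [der_poly hg, der_smooth hh, e1 (parity_even_poly hg), one_smul]
      simp only [TensorProduct.map_tmul, LinearMap.id_apply]
    · rw [der_poly hg, der_poly hh, e1 (parity_even_poly hg), one_smul]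
      simp only [TensorProduct.map_tmul, LinearMap.id_apply, Derivation.coeFn_coe]
      congr 2
      let D (e : {c : ι // ¬ Even (deg c)}) : Derivation ℝ (MvPolynomial {c : ι // ¬ Even (deg c)} ℝ)
          (MvPolynomial {c : ι // ¬ Even (deg c)} ℝ) := MvPolynomial.pderiv e
      -- The commutator is again a derivation, so it is determined by its values on the variables,
      -- whose second derivatives vanish.
      have key : ⁅D ⟨c, hg⟩, D ⟨d, hh⟩⁆ = 0 := by
        apply MvPolynomial.derivation_ext
        intro i
        rw [Derivation.commutator_apply]
        simp [D, MvPolynomial.pderiv_X, Pi.single_apply, apply_ite]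
      have := congrArg (fun D => D q) key
      simpa [D, Derivation.commutator_apply, sub_eq_zero] using this

end GradedDomain

/-! ### Supercommutativity of the algebra of forms. -/

namespace ExteriorAlgebra

variable {V : Type*} [AddCommGroup V] [Module ℝ V]

/-- Every element is the sum of an even element, which is central, and an odd element, which
commutes with everything up to the grade involution. -/
theorem exists_even_add_odd (x : ExteriorAlgebra ℝ V) : ∃ x₀ x₁ : ExteriorAlgebra ℝ V,
    x = x₀ + x₁ ∧ CliffordAlgebra.involute x₀ = x₀ ∧ CliffordAlgebra.involute x₁ = -x₁ ∧
    (∀ w, x₀ * w = w * x₀) ∧ ∀ w, x₁ * w = CliffordAlgebra.involute w * x₁ := by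
  induction x using CliffordAlgebra.left_induction with
  | algebraMap r => exact ⟨algebraMap _ _ r, 0, by simp, by simp, by simp,
      fun w => Algebra.commutes r w, by simp⟩
  | add x y hx hy =>
    obtain ⟨x₀, x₁, rfl, h0, h1, h2, h3⟩ := hx
    obtain ⟨y₀, y₁, rfl, k0, k1, k2, k3⟩ := hy
    refine ⟨x₀ + y₀, x₁ + y₁, by abel, by rw [map_add, h0, k0], by rw [map_add, h1, k1]; abel,
      fun w => by rw [add_mul, mul_add, h2, k2], fun w => by rw [add_mul, mul_add, h3, k3]⟩
  | ι_mul x m hx =>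
    obtain ⟨x₀, x₁, rfl, h0, h1, h2, h3⟩ := hx
    have e : CliffordAlgebra.ι (0 : QuadraticForm ℝ V) m = ExteriorAlgebra.ι ℝ m := rfl
    have e' : CliffordAlgebra.involute (ExteriorAlgebra.ι ℝ m) = - ExteriorAlgebra.ι ℝ m :=
      CliffordAlgebra.involute_ι m
    refine ⟨ExteriorAlgebra.ι ℝ m * x₁, ExteriorAlgebra.ι ℝ m * x₀, by rw [e, mul_add, add_comm],
      by rw [map_mul, h1, e', neg_mul_neg], by rw [map_mul, h0, e', neg_mul], fun w => ?_,
      fun w => ?_⟩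
    · rw [mul_assoc, h3, ← mul_assoc, ι_mul_comm, CliffordAlgebra.involute_involute, mul_assoc]
    · rw [mul_assoc, h2, ← mul_assoc, ι_mul_comm, mul_assoc]

end ExteriorAlgebra

namespace GradedDomain

variable {ι : Type} [Fintype ι] [DecidableEq ι] {deg : ι → ℕ}
  {W : TopologicalSpace.Opens (Body deg)}

/-- Only the exterior factor is noncommutative, so the splitting and its commutation rules are
inherited from there. -/
theorem exists_even_add_odd (α : Form W) : ∃ α₀ α₁ : Form W,
    α = α₀ + α₁ ∧ gradeInv W α₀ = α₀ ∧ gradeInv W α₁ = -α₁ ∧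
    (∀ β, α₀ * β = β * α₀) ∧ ∀ β, α₁ * β = gradeInv W β * α₁ := by
  induction α using form_induction with
  | add α β hα hβ =>
    obtain ⟨x₀, x₁, rfl, h0, h1, h2, h3⟩ := hα
    obtain ⟨y₀, y₁, rfl, k0, k1, k2, k3⟩ := hβ
    refine ⟨x₀ + y₀, x₁ + y₁, by abel, by rw [map_add, h0, k0], by rw [map_add, h1, k1]; abel,
      fun w => by rw [add_mul, mul_add, h2, k2], fun w => by rw [add_mul, mul_add, h3, k3]⟩
  | tmul f x q =>
    obtain ⟨x₀, x₁, rfl, h0, h1, h2, h3⟩ := ExteriorAlgebra.exists_even_add_odd x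
    refine ⟨f ⊗ₜ (x₀ ⊗ₜ q), f ⊗ₜ (x₁ ⊗ₜ q), by
      rw [TensorProduct.add_tmul, TensorProduct.tmul_add], by rw [gradeInv_tmul, h0],
      by rw [gradeInv_tmul, h1, TensorProduct.neg_tmul, TensorProduct.tmul_neg],
      fun β => ?_, fun β => ?_⟩
    · induction β using form_induction with
      | add β β' hβ hβ' => rw [mul_add, add_mul, hβ, hβ']
      | tmul g y r =>
        rw [Algebra.TensorProduct.tmul_mul_tmul, Algebra.TensorProduct.tmul_mul_tmul,
          Algebra.TensorProduct.tmul_mul_tmul, Algebra.TensorProduct.tmul_mul_tmul, h2,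
          mul_comm f, mul_comm q]
    · induction β using form_induction with
      | add β β' hβ hβ' => rw [mul_add, map_add, add_mul, hβ, hβ']
      | tmul g y r =>
        rw [gradeInv_tmul, Algebra.TensorProduct.tmul_mul_tmul,
          Algebra.TensorProduct.tmul_mul_tmul, Algebra.TensorProduct.tmul_mul_tmul,
          Algebra.TensorProduct.tmul_mul_tmul, h3, mul_comm f, mul_comm q]

theorem eq_zero_of_eq_neg {α : Form W} (h : α = -α) : α = 0 := by
  have h2 : (2 : ℝ) • α = 0 := by
    rw [two_smul]
    nth_rewrite 2 [h]
    exact add_neg_cancel α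
  rw [← inv_smul_smul₀ (two_ne_zero (α := ℝ)) α, h2, smul_zero]

/-- Split `α` into its even and odd parts. For homogeneous `α` the part of the wrong parity equals
its own negative, hence is zero; the other part obeys the stated rule. -/
theorem Par.mul_comm {k : ℕ} {α : Form W} (hα : Par k α) (β : Form W) :
    α * β = twist W k β * α := by
  obtain ⟨α₀, α₁, rfl, h0, h1, h2, h3⟩ := exists_even_add_odd α
  rw [Par, map_add, h0, h1] at hα
  by_cases hk : Even k
  · rw [hk.neg_one_pow, one_smul] at hα
    have : α₁ = 0 := eq_zero_of_eq_neg (add_left_cancel hα).symm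
    rw [this, add_zero, twist_even hk, h2]
  · rw [(Nat.not_even_iff_odd.1 hk).neg_one_pow, neg_one_smul, neg_add] at hα
    have : α₀ = 0 := eq_zero_of_eq_neg (add_right_cancel hα)
    rw [this, zero_add, twist_odd hk, h3]

theorem Par.mul_comm' {k l : ℕ} {α β : Form W} (hα : Par k α) (hβ : Par l β) :
    α * β = (-1 : ℝ) ^ (k * l) • (β * α) := by
  rw [hα.mul_comm, hβ.twist_eq, smul_mul_assoc]

theorem Par.deriv_mul {k : ℕ} {α : Form W} (hα : Par k α) (g : ι × Bool) (β : Form W) :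
    der W g (α * β) = der W g α * β + (-1 : ℝ) ^ (parity deg g * k) • (α * der W g β) := by
  rw [GradedDomain.der_mul, hα.twist_eq, smul_mul_assoc]

theorem par_ofBody (f : SmoothFun W) : Par 0 (ofBody W f) := by
  rw [Par, pow_zero, one_smul]
  exact (gradeInv_tmul f 1 1).trans (by rw [map_one]; rfl)

theorem par_gen (g : ι × Bool) : Par (parity deg g) (gen W g) := by
  rcases generator_cases deg g with h | ⟨c, h, rfl⟩ | ⟨c, h, rfl⟩
  · rw [Par, gen_odd h, (Nat.not_even_iff_odd.1 h).neg_one_pow, neg_one_smul]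
    refine (gradeInv_tmul _ _ _).trans ?_
    rw [ExteriorAlgebra.ι, CliffordAlgebra.involute_ι, TensorProduct.neg_tmul,
      TensorProduct.tmul_neg]
    rfl
  · rw [gen_smooth h]
    exact (par_ofBody _).congr (by simpa [parity] using h)
  · rw [Par, gen_poly h, (parity_even_poly h).neg_one_pow, one_smul, gradeInv_tmul, map_one]

theorem der_ofBody {c : ι} (h : Even (deg c)) (f : SmoothFun W) : der W (c, false) (ofBody W f)
    = ofBody W (SmoothFun.partialD (Pi.single ⟨c, h⟩ 1) f) := by
  rw [der_smooth h]
  exact TensorProduct.map_tmul _ _ _ _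

theorem der_ofBody_eq_zero {g : ι × Bool} (h : g.2 = true ∨ ¬ Even (deg g.1)) (f : SmoothFun W) :
    der W g (ofBody W f) = 0 := by
  rcases generator_cases deg g with hg | ⟨c, hg, rfl⟩ | ⟨c, hg, rfl⟩
  · rw [der_odd hg]
    refine (TensorProduct.map_tmul _ _ _ _).trans ?_
    rw [Algebra.TensorProduct.one_def, TensorProduct.map_tmul, CliffordAlgebra.contractLeft_one,
      TensorProduct.zero_tmul, TensorProduct.tmul_zero]
  · simp [hg] at h
  · rw [der_poly hg]
    refine (TensorProduct.map_tmul _ _ _ _).trans ?_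
    rw [Algebra.TensorProduct.one_def, TensorProduct.map_tmul]
    simp

theorem der_gen (g h : ι × Bool) : der W g (gen W h) = if g = h then 1 else 0 := by
  rcases generator_cases deg h with hh | ⟨d, hh, rfl⟩ | ⟨d, hh, rfl⟩
  · rw [gen_odd hh, oddGen]
    rcases generator_cases deg g with hg | ⟨c, hg, rfl⟩ | ⟨c, hg, rfl⟩
    · rw [der_odd hg, oddGenD, TensorProduct.map_tmul, TensorProduct.map_tmul, ExteriorAlgebra.ι,
        CliffordAlgebra.contractLeft_ι]
      -- Exactly one of `ξ^c` and `dξ^c` is odd, so an odd generator is determined by its index.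
      have e : g = h ↔ g.1 = h.1 := by
        obtain ⟨c, s⟩ := g
        obtain ⟨d, t⟩ := h
        constructor
        · rintro ⟨⟩; rfl
        · rintro (rfl : c = d)
          cases s <;> cases t <;> simp_all [parity, Nat.even_add_one]
      by_cases hgh : g.1 = h.1
      · rw [if_pos (e.2 hgh), LinearMap.proj_apply, hgh, Pi.single_eq_same, RingHom.map_one]; rfl
      · rw [if_neg (mt e.1 hgh), LinearMap.proj_apply, Pi.single_eq_of_ne hgh, map_zero,
          TensorProduct.zero_tmul, TensorProduct.tmul_zero]
    · rw [der_smooth hg, TensorProduct.map_tmul, SmoothFun.partialD_one, TensorProduct.zero_tmul,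
        if_neg]
      rintro rfl
      exact hh (parity_even_smooth hg)
    · rw [der_poly hg, TensorProduct.map_tmul, TensorProduct.map_tmul, if_neg]
      · simp
      · rintro rfl
        exact hh (parity_even_poly hg)
  · rw [gen_smooth hh]
    by_cases hg : g.2 = true ∨ ¬ Even (deg g.1)
    · rw [der_ofBody_eq_zero hg, if_neg]
      rintro rfl
      simp [hh] at hg
    · obtain ⟨c, _ | _⟩ := g
      · have hc : Even (deg c) := by simpa using hg
        rw [der_ofBody hc]
        have key : SmoothFun.partialD (Pi.single ⟨c, hc⟩ 1) (SmoothFun.of (U := W)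
            (fun w => w ⟨d, hh⟩) (contDiff_apply ℝ ℝ _).contDiffOn) = if c = d then 1 else 0 := by
          ext u
          rw [SmoothFun.partialD_apply, SmoothFun.fderiv_congr
            (g' := ContinuousLinearMap.proj (R := ℝ) (⟨d, hh⟩ : {c : ι // Even (deg c)}))
            (fun w => SmoothFun.ext_apply _ w), ContinuousLinearMap.fderiv]
          by_cases hcd : c = d
          · subst hcd; simp
          · simp [hcd, Ne.symm hcd]
        rw [key]
        by_cases hcd : c = d
        · rw [if_pos hcd, if_pos (by rw [hcd])]; rfl
        · rw [if_neg hcd, if_neg (by simpa using hcd), ofBody, TensorProduct.zero_tmul]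
      · simp at hg
  · rw [gen_poly hh]
    rcases generator_cases deg g with hg | ⟨c, hg, rfl⟩ | ⟨c, hg, rfl⟩
    · rw [der_odd hg, oddGenD, TensorProduct.map_tmul, TensorProduct.map_tmul,
        CliffordAlgebra.contractLeft_one, TensorProduct.zero_tmul, TensorProduct.tmul_zero, if_neg]
      rintro rfl
      exact hg (parity_even_poly hh)
    · rw [der_smooth hg, TensorProduct.map_tmul, SmoothFun.partialD_one, TensorProduct.zero_tmul,
        if_neg]
      simp
    · rw [der_poly hg, TensorProduct.map_tmul, TensorProduct.map_tmul, Derivation.coeFn_coe,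
        MvPolynomial.pderiv_X]
      by_cases hcd : c = d
      · subst hcd
        rw [Pi.single_eq_same, if_pos rfl]; rfl
      · rw [if_neg (by simpa using hcd), Pi.single_eq_of_ne (by simpa using Ne.symm hcd),
          TensorProduct.tmul_zero, TensorProduct.tmul_zero]

/-- The generators and the functions of the even coordinates generate the algebra of forms. -/
theorem generators_induction {motive : Form W → Prop} (α : Form W)
    (ofBody : ∀ f, motive (ofBody W f)) (gen : ∀ g, motive (gen W g))
    (add : ∀ α β, motive α → motive β → motive (α + β))
    (mul : ∀ α β, motive α → motive β → motive (α * β)) : motive α := by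
  have scalar : ∀ r : ℝ, motive (algebraMap ℝ _ r) := fun r => by
    have := ofBody (algebraMap ℝ _ r)
    exact this
  induction α using form_induction with
  | add α β hα hβ => exact add α β hα hβ
  | tmul f x q =>
    -- A pure tensor is the product of the images of its three factors; the exterior and the
    -- polynomial one are generated by vectors and variables.
    have e : f ⊗ₜ (x ⊗ₜ q) = GradedDomain.ofBody W f * ((1 ⊗ₜ (x ⊗ₜ 1)) * (1 ⊗ₜ (1 ⊗ₜ q)) : Form W) := by
      simp [GradedDomain.ofBody, Algebra.TensorProduct.one_def, Algebra.TensorProduct.tmul_mul_tmul]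
    rw [e]
    have single : ∀ c : ι, motive (oddGen W c) := fun c => by
      by_cases h : Even (deg c)
      · rw [← gen_odd (g := (c, true)) (by simpa [parity, Nat.even_add_one] using h)]
        exact gen _
      · rw [← gen_odd (g := (c, false)) (by simpa [parity] using h)]
        exact gen _
    have hx : ∀ x : ExteriorAlgebra ℝ (ι → ℝ), motive
        (((Algebra.TensorProduct.includeRight : _ →ₐ[ℝ] Form W).comp
          Algebra.TensorProduct.includeLeft) x) := fun x => by
      induction x using ExteriorAlgebra.induction with
      | algebraMap r => rw [AlgHom.commutes]; exact scalar r
      | add a b ha hb => rw [map_add]; exact add _ _ ha hb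
      | mul a b ha hb => rw [map_mul]; exact mul _ _ ha hb
      | ι v =>
        rw [← Finset.univ_sum_single v, map_sum, map_sum]
        refine Finset.sum_induction _ motive add ?_ fun c _ => ?_
        · simpa using scalar 0
        · have e : Pi.single c (v c) = v c • (Pi.single c 1 : ι → ℝ) := by
            rw [← Pi.single_smul, smul_eq_mul, mul_one]
          rw [e, map_smul, map_smul, Algebra.smul_def]
          exact mul _ _ (scalar _) (single c)
    have hq : ∀ q : MvPolynomial {c : ι // ¬ Even (deg c)} ℝ, motive
        (((Algebra.TensorProduct.includeRight : _ →ₐ[ℝ] Form W).comp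
          Algebra.TensorProduct.includeRight) q) := fun q => by
      induction q using MvPolynomial.induction_on with
      | C r => rw [← MvPolynomial.algebraMap_eq, AlgHom.commutes]; exact scalar r
      | add a b ha hb => rw [map_add]; exact add _ _ ha hb
      | mul_X a i ha =>
        rw [map_mul]
        refine mul _ _ ha ?_
        have := gen (i.1, true)
        rwa [gen_poly i.2] at this
    exact mul _ _ (ofBody f) (mul _ _ (hx x) (hq q))

end GradedDomain

/-! ### Weights, odd vector fields and nondegeneracy on a graded domain. -/

namespace GradedDomain

variable {ι : Type} [Fintype ι] [DecidableEq ι] {deg : ι → ℕ}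
  {W : TopologicalSpace.Opens (Body deg)}

theorem coord_eq_gen (c : ι) : coord W c = gen W (c, false) := rfl

theorem dcoord_eq_gen (c : ι) : dcoord W c = gen W (c, true) := rfl

theorem pd_eq_der (c : ι) : pd W c = der W (c, false) := rfl

theorem pdd_eq_der (c : ι) : pdd W c = der W (c, true) := rfl

theorem twist_twist (k : ℕ) (α : Form W) : twist W k (twist W k α) = α := by
  by_cases h : Even k
  · rw [twist_even h, twist_even h]
  · rw [twist_odd h, twist_odd h, gradeInv_gradeInv]

theorem par_zero (k : ℕ) : Par k (0 : Form W) := by rw [Par, map_zero, smul_zero]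

theorem par_coord (c : ι) : Par (deg c) (coord W c) := par_gen (c, false)

theorem par_dcoord (c : ι) : Par (deg c + 1) (dcoord W c) := par_gen (c, true)

theorem Par.pd {k : ℕ} {α : Form W} (hα : Par k α) (c : ι) : Par (deg c + k) (pd W c α) :=
  hα.deriv (c, false)

theorem Par.pd_mul {k : ℕ} {α : Form W} (hα : Par k α) (c : ι) (β : Form W) :
    GradedDomain.pd W c (α * β) = GradedDomain.pd W c α * β
      + (-1 : ℝ) ^ (deg c * k) • (α * GradedDomain.pd W c β) :=
  hα.deriv_mul (c, false) β

theorem Par.pdd_mul {k : ℕ} {α : Form W} (hα : Par k α) (c : ι) (β : Form W) :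
    pdd W c (α * β) = pdd W c α * β + (-1 : ℝ) ^ ((deg c + 1) * k) • (α * pdd W c β) :=
  hα.deriv_mul (c, true) β

theorem pd_comm (c d : ι) (α : Form W) :
    pd W c (pd W d α) = (-1 : ℝ) ^ (deg c * deg d) • pd W d (pd W c α) :=
  der_comm (c, false) (d, false) α

theorem pd_coord (c d : ι) : pd W c (coord W d) = if c = d then 1 else 0 :=
  (der_gen (c, false) (d, false)).trans (by simp only [Prod.mk.injEq, and_true])

theorem pd_dcoord (c d : ι) : pd W c (dcoord W d) = 0 :=
  (der_gen (c, false) (d, true)).trans (if_neg (by simp))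

theorem pdd_coord (c d : ι) : pdd W c (coord W d) = 0 :=
  (der_gen (c, true) (d, false)).trans (if_neg (by simp))

theorem pdd_dcoord (c d : ι) : pdd W c (dcoord W d) = if c = d then 1 else 0 :=
  (der_gen (c, true) (d, true)).trans (by simp only [Prod.mk.injEq, and_true])

theorem pdd_ofBody (c : ι) (f : SmoothFun W) : pdd W c (ofBody W f) = 0 :=
  der_ofBody_eq_zero (g := (c, true)) (Or.inl rfl) f

/-! ### Weights -/

variable (W) in
/-- The derivation that multiplies every generator by its weight. -/
def weightOp (w : ι × Bool → ℝ) : Form W →ₗ[ℝ] Form W :=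
  ∑ g, w g • (LinearMap.mulLeft ℝ (gen W g)).comp (der W g)

theorem weightOp_apply (w : ι × Bool → ℝ) (α : Form W) :
    weightOp W w α = ∑ g, w g • (gen W g * der W g α) := by
  simp only [weightOp, LinearMap.sum_apply, LinearMap.smul_apply, LinearMap.comp_apply,
    LinearMap.mulLeft_apply]

/-- The derivative passing `α` twists it, and moving the generator back past the twisted `α` twists
it again. The twist is an involution, so no sign survives and each `ξ ∂/∂ξ` is an ordinary
derivation. -/
theorem weightOp_mul (w : ι × Bool → ℝ) (α β : Form W) :
    weightOp W w (α * β) = weightOp W w α * β + α * weightOp W w β := by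
  simp only [weightOp_apply, Finset.sum_mul, Finset.mul_sum, ← Finset.sum_add_distrib]
  refine Finset.sum_congr rfl fun g _ => ?_
  rw [der_mul, mul_add, ← mul_assoc, ← mul_assoc, (par_gen g).mul_comm (twist W _ α), twist_twist,
    smul_add, smul_mul_assoc, mul_smul_comm, mul_assoc α]

/-- `α` has weight `k` with respect to the weights `w` of the generators. -/
def HasWeight (w : ι × Bool → ℝ) (k : ℝ) (α : Form W) : Prop := weightOp W w α = k • α

namespace HasWeight

variable {w : ι × Bool → ℝ} {k l : ℝ} {α β : Form W}

theorem add (hα : HasWeight w k α) (hβ : HasWeight w k β) : HasWeight w k (α + β) := by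
  rw [HasWeight, map_add, hα, hβ, smul_add]

theorem sub (hα : HasWeight w k α) (hβ : HasWeight w k β) : HasWeight w k (α - β) := by
  rw [HasWeight, map_sub, hα, hβ, smul_sub]

theorem smul (r : ℝ) (hα : HasWeight w k α) : HasWeight w k (r • α) := by
  rw [HasWeight, map_smul, hα, smul_comm]

theorem sum {κ : Type*} {s : Finset κ} {α : κ → Form W} (h : ∀ i ∈ s, HasWeight w k (α i)) :
    HasWeight w k (∑ i ∈ s, α i) := by
  rw [HasWeight, map_sum, Finset.smul_sum]
  exact Finset.sum_congr rfl h

theorem mul (hα : HasWeight w k α) (hβ : HasWeight w l β) : HasWeight w (k + l) (α * β) := by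
  rw [HasWeight, weightOp_mul, hα, hβ, smul_mul_assoc, mul_smul_comm, add_smul]

theorem gen (w : ι × Bool → ℝ) (g : ι × Bool) : HasWeight w (w g) (gen W g) := by
  rw [HasWeight, weightOp_apply, Finset.sum_eq_single g]
  · rw [der_gen, if_pos rfl, mul_one]
  · intro h _ hg
    rw [der_gen, if_neg hg, mul_zero, smul_zero]
  · exact fun h => absurd (Finset.mem_univ g) h

theorem of_der {α : Form W} (w : ι × Bool → ℝ) (h : ∀ g, w g = 0 ∨ der W g α = 0) :
    HasWeight w 0 α := by
  rw [HasWeight, weightOp_apply, zero_smul]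
  refine Finset.sum_eq_zero fun g _ => ?_
  rcases h g with h | h
  · rw [h, zero_smul]
  · rw [h, mul_zero, smul_zero]

theorem one (w : ι × Bool → ℝ) : HasWeight w 0 (1 : Form W) :=
  of_der w fun _ => Or.inr (der_one _)

end HasWeight

/-- In the commutator of `∂_h` with `∑ w_g g ∂_g`, passing the generator `g` and passing `∂_g`
produce the same sign, so the signs cancel. Only the diagonal term `∂_h h = 1` remains. -/
theorem der_weightOp (w : ι × Bool → ℝ) (h : ι × Bool) (α : Form W) :
    der W h (weightOp W w α) = w h • der W h α + weightOp W w (der W h α) := by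
  rw [weightOp_apply, weightOp_apply, map_sum,
    ← Finset.sum_add_sum_compl (s := {h}) (f := fun g => der W h _),
    ← Finset.sum_add_sum_compl (s := {h}) (f := fun g => w g • (gen W g * der W g (der W h α))),
    ← add_assoc]
  have key : ∀ g, der W h (w g • (gen W g * der W g α))
      = w g • (der W h (gen W g) * der W g α) + w g • (gen W g * der W g (der W h α)) := fun g => by
    rw [map_smul, (par_gen g).deriv_mul, der_comm h g, mul_smul_comm, smul_smul, ← pow_add,
      mul_comm (parity deg h), ← two_mul, pow_mul, neg_one_sq, one_pow, one_smul, smul_add]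
  congr 1
  · rw [Finset.sum_singleton, Finset.sum_singleton, key, der_gen, if_pos rfl, one_mul]
  · refine Finset.sum_congr rfl fun g hg => ?_
    rw [key, der_gen, if_neg, zero_mul, smul_zero, zero_add]
    rintro rfl
    simp at hg

theorem weightOp_gradeInv (w : ι × Bool → ℝ) (α : Form W) :
    weightOp W w (gradeInv W α) = gradeInv W (weightOp W w α) := by
  rw [weightOp_apply, weightOp_apply, map_sum]
  refine Finset.sum_congr rfl fun g _ => ?_
  rw [map_smul, map_mul, par_gen g, der_gradeInv, mul_smul_comm, smul_mul_assoc]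

theorem HasWeight.twist {w : ι × Bool → ℝ} {k : ℝ} {α : Form W} (h : HasWeight w k α) (j : ℕ) :
    HasWeight w k (twist W j α) := by
  by_cases hj : Even j
  · rwa [twist_even hj]
  · rw [twist_odd hj, HasWeight, weightOp_gradeInv, h, map_smul]

/-- The weight that counts the differentials. -/
def formWeight (g : ι × Bool) : ℝ := g.2.toNat

/-- The weight given by the internal degree. -/
def degWeight (deg : ι → ℕ) (g : ι × Bool) : ℝ := deg g.1

theorem isForm_iff {k : ℕ} {α : Form W} : IsForm k α ↔ HasWeight formWeight k α := by
  rw [IsForm, HasWeight, weightOp_apply, Fintype.sum_prod_type]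
  simp only [Fintype.sum_bool, formWeight, Bool.toNat_true, Bool.toNat_false, Nat.cast_one,
    Nat.cast_zero, one_smul, zero_smul, add_zero]
  rfl

/-- Functions of the even coordinates have weight `0`, generators weight `0` or `1`, and weights add
under products; so homogeneous forms of natural weight span everything. -/
theorem exists_sum_isForm (α : Form W) :
    α ∈ Submodule.span ℝ {β : Form W | ∃ k : ℕ, HasWeight formWeight k β} := by
  induction α using generators_induction with
  | ofBody f =>
    refine Submodule.subset_span ⟨0, by
      rw [Nat.cast_zero]
      refine HasWeight.of_der _ fun g => ?_
      obtain ⟨c, _ | _⟩ := g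
      · exact Or.inl (by simp [formWeight])
      · exact Or.inr (pdd_ofBody c f)⟩
  | gen g => exact Submodule.subset_span ⟨g.2.toNat, HasWeight.gen formWeight g⟩
  | add α β hα hβ => exact add_mem hα hβ
  | mul α β hα hβ =>
    induction hα using Submodule.span_induction with
    | zero => rw [zero_mul]; exact zero_mem _
    | add x y _ _ hx hy => rw [add_mul]; exact add_mem hx hy
    | smul r x _ hx => rw [smul_mul_assoc]; exact Submodule.smul_mem _ r hx
    | mem x hx =>
      induction hβ using Submodule.span_induction with
      | zero => rw [mul_zero]; exact zero_mem _
      | add y z _ _ hy hz => rw [mul_add]; exact add_mem hy hz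
      | smul r y _ hy => rw [mul_smul_comm]; exact Submodule.smul_mem _ r hy
      | mem y hy =>
        obtain ⟨k, hk⟩ := hx
        obtain ⟨l, hl⟩ := hy
        exact Submodule.subset_span ⟨k + l, by rw [Nat.cast_add]; exact hk.mul hl⟩

/-- Eigenspaces for distinct eigenvalues are independent, and those with natural eigenvalue already
span, so nothing is left for `-1`. -/
theorem eq_zero_of_hasWeight_neg {α : Form W} (h : HasWeight formWeight (-1) α) : α = 0 := by
  have hd := Module.End.eigenspaces_iSupIndep (weightOp W (formWeight (ι := ι))) (-1)
  have htop : ⨆ μ, ⨆ (_ : μ ≠ (-1 : ℝ)), Module.End.eigenspace (weightOp W formWeight) μ = ⊤ := by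
    rw [eq_top_iff]
    intro β _
    refine Submodule.span_le.2 ?_ (exists_sum_isForm β)
    rintro γ ⟨k, hk⟩
    exact Submodule.mem_iSup_of_mem (k : ℝ) (Submodule.mem_iSup_of_mem
      (by have := Nat.cast_nonneg (α := ℝ) k; linarith) (Module.End.mem_eigenspace_iff.2 hk))
  rw [htop, disjoint_top] at hd
  have := Module.End.mem_eigenspace_iff.2 h
  rwa [hd, Submodule.mem_bot] at this

/-- The forms of form degree `0` do not depend on the differentials. -/
theorem isForm_zero_iff {α : Form W} : IsForm 0 α ↔ ∀ c, pdd W c α = 0 := by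
  rw [isForm_iff, Nat.cast_zero]
  constructor
  · intro h c
    -- The derivative `∂/∂(dξ^c)` lowers the form weight by one, from `0` to `-1`.
    have key := der_weightOp formWeight (c, true) α
    rw [h, zero_smul, map_zero] at key
    refine eq_zero_of_hasWeight_neg ?_
    rw [HasWeight, neg_one_smul]
    have e : formWeight (c, true) = 1 := by simp [formWeight]
    rw [e, one_smul] at key
    exact eq_neg_of_add_eq_zero_right key.symm
  · intro h
    refine HasWeight.of_der _ fun g => ?_
    obtain ⟨c, _ | _⟩ := g
    · exact Or.inl (by simp [formWeight])
    · exact Or.inr (h c)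

theorem sum_antisymm {κ : Type*} [Fintype κ] (t : κ → κ → Form W) (h : ∀ c d, t d c = -t c d) :
    ∑ c, ∑ d, t c d = 0 := by
  refine eq_zero_of_eq_neg ?_
  conv_lhs => rw [Finset.sum_comm]
  simp only [← Finset.sum_neg_distrib]
  exact Finset.sum_congr rfl fun d _ => Finset.sum_congr rfl fun c _ => h d c

/-- Cartan's formula for the Euler field: in `ι d + d ι` the terms with two derivatives cancel, and
the diagonal ones leave the derivation that multiplies both `ξ^c` and `dξ^c` by `deg c`. Homogeneity
thus becomes a statement about weights, which multiply well. -/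
theorem hasDegree_iff {k : ℕ} {α : Form W} : HasDegree k α ↔ HasWeight (degWeight deg) k α := by
  rw [HasDegree, HasWeight]
  suffices h : lieEven (euler W) α = weightOp W (degWeight deg) α by rw [h]
  rw [weightOp_apply, Fintype.sum_prod_type]
  simp only [Fintype.sum_bool, degWeight, ← coord_eq_gen, ← dcoord_eq_gen, ← pd_eq_der,
    ← pdd_eq_der]
  simp only [lieEven, contract, extD, euler, map_sum, Finset.mul_sum]
  have e1 : ∀ c b : ι, (deg c : ℝ) • coord W c * pdd W c (dcoord W b * pd W b α)
      = (if c = b then (deg c : ℝ) • (coord W c * pd W c α) else 0)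
        + ((-1 : ℝ) ^ ((deg c + 1) * (deg b + 1)) * deg c) •
          (coord W c * (dcoord W b * pdd W c (pd W b α))) := fun c b => by
    rw [(par_dcoord b).pdd_mul, pdd_dcoord, mul_add, smul_mul_assoc, smul_mul_assoc]
    congr 1
    · split_ifs with h
      · rw [h, one_mul]
      · rw [zero_mul, mul_zero, smul_zero]
    · rw [mul_smul_comm, smul_smul, mul_comm (deg c : ℝ)]
  have e2 : ∀ b c : ι, dcoord W b * pd W b ((deg c : ℝ) • coord W c * pdd W c α)
      = (if b = c then (deg c : ℝ) • (dcoord W c * pdd W c α) else 0)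
        - ((-1 : ℝ) ^ ((deg c + 1) * (deg b + 1)) * deg c) •
          (coord W c * (dcoord W b * pdd W c (pd W b α))) := fun b c => by
    rw [smul_mul_assoc, map_smul, (par_coord c).pd_mul, pd_coord, mul_smul_comm, mul_add, smul_add,
      sub_eq_add_neg]
    congr 1
    · split_ifs with h
      · rw [h, one_mul]
      · rw [zero_mul, mul_zero, smul_zero]
    · have hc : pd W b (pdd W c α) = (-1 : ℝ) ^ (deg b * (deg c + 1)) • pdd W c (pd W b α) :=
        der_comm (b, false) (c, true) α
      rw [hc, mul_smul_comm, mul_smul_comm, mul_smul_comm, ← mul_assoc,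
        (par_dcoord b).mul_comm' (par_coord c), smul_mul_assoc, mul_assoc, smul_smul, smul_smul,
        smul_smul, ← neg_smul]
      congr 1
      have : (-1 : ℝ) ^ (deg b * deg c + deg b * (deg c + 1) + (deg b + 1) * deg c)
          = (-1 : ℝ) ^ ((deg c + 1) * (deg b + 1) + 1) := neg_one_pow_congr (by
        simp only [Nat.even_add, Nat.even_mul, Nat.even_add_one]; tauto)
      rw [pow_succ, pow_add, pow_add] at this
      linear_combination (deg c : ℝ) * this
  simp only [e1, e2, Finset.sum_add_distrib, Finset.sum_sub_distrib, Finset.sum_ite_eq,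
    Finset.mem_univ, if_true]
  rw [Finset.sum_comm (f := fun b c => ((-1 : ℝ) ^ ((deg c + 1) * (deg b + 1)) * deg c) •
          (coord W c * (dcoord W b * pdd W c (pd W b α))))]
  abel

/-! ### Odd vector fields -/

/-- For an odd field the second-order terms `X^c X^d ∂_c ∂_d` are antisymmetric in `c`, `d` once
signs are counted, and cancel. The square is therefore a first-order operator with components
`X(X^d)`. -/
theorem applyField_applyField {X : ι → Form W} (hX : ∀ c, Par (deg c + 1) (X c)) (f : Form W) :
    applyField X (applyField X f) = ∑ d, applyField X (X d) * pd W d f := by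
  have e : ∀ c d : ι, X c * pd W c (X d * pd W d f) = X c * pd W c (X d) * pd W d f
      + (-1 : ℝ) ^ (deg c * (deg d + 1)) • (X c * (X d * pd W c (pd W d f))) := fun c d => by
    rw [(hX d).pd_mul, mul_add, mul_smul_comm, mul_assoc]
  simp only [applyField, map_sum, Finset.mul_sum, Finset.sum_mul, e, Finset.sum_add_distrib]
  rw [Finset.sum_comm, add_eq_left]
  refine sum_antisymm _ fun c d => ?_
  rw [pd_comm d c, mul_smul_comm, mul_smul_comm, ← mul_assoc, (hX d).mul_comm' (hX c),
    smul_mul_assoc, mul_assoc, smul_smul, smul_smul, ← neg_smul]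
  congr 1
  rw [← pow_add, ← pow_add, ← neg_one_mul ((-1 : ℝ) ^ _), ← pow_succ']
  exact neg_one_pow_congr (by
    simp only [Nat.even_add, Nat.even_mul, Nat.even_add_one]; tauto)

/-- The differential is formally an odd vector field with components `dξ^c`, and these do not depend
on the coordinates. -/
theorem extD_extD (α : Form W) : extD (extD α) = 0 := by
  refine (applyField_applyField (X := dcoord W) par_dcoord α).trans ?_
  refine Finset.sum_eq_zero fun d _ => ?_
  rw [applyField, Finset.sum_eq_zero fun c _ => by rw [pd_dcoord, mul_zero], zero_mul]

theorem sum_comp_star {star : ι → ι} (h : ∀ c, star (star c) = c) (f : ι → Form W) :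
    ∑ c, f (star c) = ∑ c, f c :=
  (Equiv.mk star star h h).sum_comp f

/-- A Hamiltonian structure: `c ↦ star c` pairs the coordinates with their conjugates, and the
field of the function `Θ` of parity `m` has the components `η c ∂Θ/∂ξ^(star c)`. -/
structure IsHamiltonian (star : ι → ι) (η : ι → ℝ) (m : ℕ) (Θ : Form W) (X : ι → Form W) :
    Prop where
  star_star : ∀ c, star (star c) = c
  parity_star : ∀ c, η c ≠ 0 → (Even (deg (star c) + m) ↔ Even (deg c + 1))
  sign : ∀ c, η (star c) * (-1 : ℝ) ^ (m * (deg c + 1)) = η c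
  par : Par m Θ
  field : ∀ c, X c = η c • pd W (star c) Θ

namespace IsHamiltonian

variable {star : ι → ι} {η : ι → ℝ} {m : ℕ} {Θ : Form W} {X : ι → Form W}

theorem par_field (h : IsHamiltonian star η m Θ X) (c : ι) : Par (deg c + 1) (X c) := by
  rw [h.field]
  by_cases hc : η c = 0
  · rw [hc, zero_smul]; exact par_zero _
  · exact ((h.par.pd _).smul _).congr (h.parity_star c hc)

/-- Both sides are multiples of the product of `∂_c Θ` and `∂_{star c} Θ`; the condition `sign`
exactly compensates the sign of reordering. Conjugate coordinates thus contribute equally to `XΘ`.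
-/
theorem mul_pd_star (h : IsHamiltonian star η m Θ X) (c : ι) :
    X (star c) * pd W (star c) Θ = X c * pd W c Θ := by
  rw [h.field, h.field, h.star_star, ← h.sign c, smul_mul_assoc, smul_mul_assoc,
    (h.par.pd c).mul_comm' (h.par.pd (star c)), smul_smul]
  by_cases hc : η c = 0
  · have : η (star c) = 0 := by
      have := h.sign (star c)
      rw [h.star_star, hc, zero_mul] at this
      exact this.symm
    simp only [this, zero_mul]
  · congr 2
    have := h.parity_star c hc
    refine neg_one_pow_congr ?_
    simp only [Nat.even_add, Nat.even_mul, Nat.even_add_one] at this ⊢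
    tauto

/-- `XΘ` is quadratic in the derivatives of `Θ`. Differentiating it hits either factor, and
reindexing by `star` turns one family of terms into the other, whence the factor `2`. -/
theorem pd_applyField (h : IsHamiltonian star η m Θ X) (e : ι) :
    pd W e (applyField X Θ) = (2 * (-1 : ℝ) ^ deg e) • applyField X (pd W e Θ) := by
  have h1 : ∀ d, pd W e (X d * pd W d Θ) = η d • (pd W e (pd W (star d) Θ) * pd W d Θ)
      + (-1 : ℝ) ^ deg e • (X d * pd W d (pd W e Θ)) := fun d => by
    rw [(h.par_field d).pd_mul, pd_comm e d, mul_smul_comm, smul_smul, ← pow_add]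
    congr 1
    · rw [h.field, map_smul, smul_mul_assoc]
    · congr 1
      exact neg_one_pow_congr (by
        simp only [Nat.even_add, Nat.even_mul, Nat.even_add_one]; tauto)
  have h2 : ∀ d, η (star d) • (pd W e (pd W (star (star d)) Θ) * pd W (star d) Θ)
      = (-1 : ℝ) ^ deg e • (X d * pd W d (pd W e Θ)) := fun d => by
    rw [h.star_star, ((h.par.pd d).pd e).mul_comm' (h.par.pd (star d)), pd_comm e d, mul_smul_comm,
      h.field, smul_mul_assoc, smul_smul, smul_smul, smul_smul, ← h.sign d]
    by_cases hd : η d = 0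
    · have : η (star d) = 0 := by
        have := h.sign (star d)
        rw [h.star_star, hd, zero_mul] at this
        exact this.symm
      simp only [this, zero_mul, mul_zero]
    · congr 1
      have hs := h.parity_star d hd
      have : (-1 : ℝ) ^ ((deg e + (deg d + m)) * (deg (star d) + m) + deg e * deg d)
          = (-1 : ℝ) ^ (deg e + m * (deg d + 1)) := by
        refine neg_one_pow_congr ?_
        simp only [Nat.even_add, Nat.even_mul, Nat.even_add_one] at hs ⊢
        tauto
      rw [pow_add, pow_add] at this
      linear_combination η (star d) * this
  rw [applyField, map_sum, Finset.sum_congr rfl fun d _ => h1 d, Finset.sum_add_distrib,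
    ← sum_comp_star h.star_star, Finset.sum_congr rfl fun d _ => h2 d, ← Finset.smul_sum, mul_smul, two_smul]
  rfl

/-- The components `X(X^c)` of `X²` are read off from the derivatives of the single function `XΘ`:
this is the passage from `X² = 0` to the master equation. -/
theorem pd_star_applyField (h : IsHamiltonian star η m Θ X) (c : ι) :
    η c • pd W (star c) (applyField X Θ)
      = (2 * (-1 : ℝ) ^ deg (star c)) • applyField X (X c) := by
  rw [h.pd_applyField, h.field c, smul_comm]
  congr 1
  simp only [applyField, map_smul, mul_smul_comm, Finset.smul_sum]

end IsHamiltonian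

/-! ### Nondegenerate forms -/

/-- Here `ι_X Ω = ∑ κ_c X^c dξ^{star c}`. Components of a vector field contain no differentials, so
`∂/∂(dξ^{star c})` recovers them; conversely `α = ∑ dξ^c ∂α/∂(dξ^c)` for a `1`-form. -/
theorem contract_bijective_of_pdd {star : ι → ι} {κ : ι → ℝ} {Ω : Form W}
    (hstar : ∀ c, star (star c) = c) (hκ : ∀ c, κ c ≠ 0)
    (hΩ : ∀ c, pdd W c Ω = κ c • dcoord W (star c)) (α : Form W) (hα : IsForm 1 α) :
    ∃! X : ι → Form W, IsVectorField X ∧ contract X Ω = α := by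
  have hc : ∀ X : ι → Form W, contract X Ω
      = ∑ c, κ (star c) • (dcoord W c * twist W (deg c + 1) (X (star c))) := fun X => by
    rw [contract, ← sum_comp_star hstar]
    refine Finset.sum_congr rfl fun c _ => ?_
    rw [hΩ, hstar, (par_dcoord c).mul_comm, twist_twist,
      mul_smul_comm]
  -- The component is the coefficient of `dξ^{star c}` in `α`, moved to the left of that
  -- differential (the twist) and divided by `κ c`.
  refine ⟨fun c => (κ c)⁻¹ • twist W (deg (star c) + 1) (pdd W (star c) α), ⟨fun c => ?_, ?_⟩, ?_⟩
  · rw [isForm_iff, Nat.cast_zero]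
    refine (HasWeight.twist ?_ _).smul _
    have key := der_weightOp formWeight (star c, true) α
    rw [isForm_iff.1 hα, map_smul, Nat.cast_one, one_smul] at key
    have e : formWeight (star c, true) = 1 := by simp [formWeight]
    rw [e, one_smul, left_eq_add] at key
    rw [HasWeight, zero_smul]
    exact key
  · rw [hc]
    have h1 := hα
    rw [IsForm, Nat.cast_one, one_smul] at h1
    refine (Finset.sum_congr rfl fun c _ => ?_).trans h1
    rw [map_smul, hstar, twist_twist, mul_smul_comm, smul_smul, mul_inv_cancel₀ (hκ _), one_smul]
  · rintro X ⟨hX, hXα⟩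
    funext b
    have hz : ∀ c d, pdd W d (twist W (deg c + 1) (X (star c))) = 0 := fun c d => by
      have : IsForm 0 (twist W (deg c + 1) (X (star c))) := by
        rw [isForm_iff]
        exact (isForm_iff.1 (hX _)).twist _
      exact isForm_zero_iff.1 this d
    have h1 := congrArg (pdd W (star b)) hXα
    rw [hc, map_sum, Finset.sum_eq_single (star b)] at h1
    · rw [map_smul, (par_dcoord _).pdd_mul, pdd_dcoord, if_pos rfl, one_mul, hz, mul_zero, smul_zero,
        add_zero, hstar] at h1
      rw [← h1, map_smul, twist_twist, smul_smul, inv_mul_cancel₀ (hκ _), one_smul]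
    · intro c _ hcb
      rw [map_smul, (par_dcoord _).pdd_mul, pdd_dcoord, if_neg (Ne.symm hcb), zero_mul, hz, mul_zero,
        smul_zero, add_zero, smul_zero]
    · exact fun h => absurd (Finset.mem_univ _) h

end GradedDomain

/-! ### Inclusions of the tensor factors. -/

namespace GradedDomain

variable {ι : Type} [Fintype ι] [DecidableEq ι] {deg : ι → ℕ}
  {W : TopologicalSpace.Opens (Body deg)}

theorem eq_zero_of_smul_eq_zero {r : ℝ} (hr : r ≠ 0) {α : Form W} (h : r • α = 0) : α = 0 := by
  rw [← inv_smul_smul₀ hr α, h, smul_zero]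

variable (W) in
/-- The inclusion of the exterior algebra on the odd generators. -/
def ofExterior : ExteriorAlgebra ℝ (ι → ℝ) →ₐ[ℝ] Form W :=
  (Algebra.TensorProduct.includeRight : _ →ₐ[ℝ] Form W).comp Algebra.TensorProduct.includeLeft

theorem ofBody_injective : Function.Injective (ofBody W) :=
  Algebra.TensorProduct.includeLeft_injective (S := ℝ)
    (FaithfulSMul.algebraMap_injective ℝ
      (ExteriorAlgebra ℝ (ι → ℝ) ⊗[ℝ] MvPolynomial {c : ι // ¬ Even (deg c)} ℝ))

end GradedDomain

/-! ### Functions polynomial in the coordinates `a_i`. -/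

namespace ShiftedCotangent

open GradedDomain

variable {n p : ℕ} {V : TopologicalSpace.Opens (EuclideanSpace ℝ (Fin n))}

theorem baseProj_apply (w : Body (deg n p)) (i : Fin n) :
    baseProj n p w i = w ⟨(0, i), by simp [deg]⟩ := rfl

theorem baseProj_surjective : Function.Surjective (baseProj n p) := fun u =>
  ⟨fun c => if c.1.1 = 0 then u c.1.2 else 0, by ext i; simp [baseProj_apply]⟩

theorem comap_val (f : SmoothFun V) (w : body p V) :
    (SmoothFun.comap (baseProj n p) f).1 w = f.1 ⟨baseProj n p w, w.2⟩ :=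
  SmoothFun.ext_apply f ⟨baseProj n p w, w.2⟩

variable (p V) in
/-- The inclusion of the functions of the coordinates `x^i`, as a homomorphism of algebras. -/
def ofBaseHom : SmoothFun V →ₐ[ℝ] Form (body p V) :=
  (Algebra.TensorProduct.includeLeft : SmoothFun (body p V) →ₐ[ℝ] Form (body p V)).comp
    { toFun := fun f => (SmoothFun.comap (baseProj n p) f : SmoothFun (body p V))
      map_one' := by ext w; exact comap_val _ _
      map_mul' := fun f g => by
        ext w
        exact (comap_val _ _).trans (congrArg₂ (· * ·) (comap_val f w).symm (comap_val g w).symm)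
      map_zero' := by ext w; exact comap_val _ _
      map_add' := fun f g => by
        ext w
        exact (comap_val _ _).trans (congrArg₂ (· + ·) (comap_val f w).symm (comap_val g w).symm)
      commutes' := fun r => by ext w; exact comap_val _ _ }

theorem ofBase_mul (f g : SmoothFun V) : ofBase p (f * g) = ofBase p f * ofBase p g :=
  map_mul (ofBaseHom p V) f g

theorem ofBase_add (f g : SmoothFun V) : ofBase p (f + g) = ofBase p f + ofBase p g :=
  map_add (ofBaseHom p V) f g

theorem ofBase_sub (f g : SmoothFun V) : ofBase p (f - g) = ofBase p f - ofBase p g :=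
  map_sub (ofBaseHom p V) f g

theorem ofBase_neg (f : SmoothFun V) : ofBase p (-f) = - ofBase p f :=
  map_neg (ofBaseHom p V) f

theorem ofBase_smul (r : ℝ) (f : SmoothFun V) : ofBase p (r • f) = r • ofBase p f :=
  map_smul (ofBaseHom p V) r f

theorem ofBase_zero : ofBase p (0 : SmoothFun V) = 0 := map_zero (ofBaseHom p V)

theorem ofBase_sum {κ : Type*} (s : Finset κ) (f : κ → SmoothFun V) :
    ofBase p (∑ k ∈ s, f k) = ∑ k ∈ s, ofBase p (f k) := map_sum (ofBaseHom p V) f s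

theorem ofBase_injective : Function.Injective (ofBase p : SmoothFun V → _) := fun f g h => by
  have h1 := ofBody_injective h
  ext u
  obtain ⟨w, hw⟩ := baseProj_surjective (n := n) (p := p) u
  have hwV : w ∈ body p V := by
    change baseProj n p w ∈ V
    rw [hw]; exact u.2
  have h2 := congrArg (fun F : SmoothFun (body p V) => F.1 ⟨w, hwV⟩) h1
  have e : (⟨baseProj n p w, hwV⟩ : V) = u := Subtype.ext hw
  rw [← e]
  exact (comap_val f ⟨w, hwV⟩).symm.trans (h2.trans (comap_val g ⟨w, hwV⟩))

theorem par_ofBase (f : SmoothFun V) : Par 0 (ofBase p f) := par_ofBody _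

theorem ofBase_mul_comm (f : SmoothFun V) (α : Form (body p V)) :
    ofBase p f * α = α * ofBase p f := by
  rw [(par_ofBase f).mul_comm, twist_even (by simp)]

variable (p) in
/-- A function of the coordinates `x^i`, as a function on the body. -/
def pullback (f : SmoothFun V) : SmoothFun (body p V) := SmoothFun.comap (baseProj n p) f

theorem partialD_pullback (v : Body (deg n p)) (f : SmoothFun V) :
    SmoothFun.partialD v (pullback p f) = pullback p (SmoothFun.partialD (baseProj n p v) f) := by
  ext w
  refine Eq.trans ?_ (comap_val _ w).symm
  rw [SmoothFun.partialD_apply, SmoothFun.partialD_apply,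
    SmoothFun.fderiv_congr (g' := SmoothFun.ext f ∘ baseProj n p) (fun w => by
      rw [SmoothFun.ext_apply]; rfl) w,
    fderiv_comp (w : Body (deg n p)) (SmoothFun.differentiableAt_ext f ⟨baseProj n p w, w.2⟩)
      (baseProj n p).differentiableAt, ContinuousLinearMap.fderiv]
  rfl

theorem pd_ofBase (i : Fin n) (f : SmoothFun V) :
    pd (body p V) (0, i) (ofBase p f) = ofBase p (coordD i f) := by
  have h : Even (deg n p (0, i)) := by simp [deg]
  refine (der_ofBody h (pullback p f)).trans ?_
  rw [partialD_pullback]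
  have e : baseProj n p (Pi.single ⟨(0, i), h⟩ 1) = EuclideanSpace.single i (1 : ℝ) := by
    ext j
    rw [baseProj_apply]
    by_cases hij : j = i
    · subst hij; simp
    · rw [Pi.single_eq_of_ne fun h => hij (congrArg (fun c => c.1.2) h)]
      simp [hij]
  rw [e]
  rfl

theorem pd_ofBase_eq_zero {c : Idx n} (hc : c.1 ≠ 0) (f : SmoothFun V) :
    pd (body p V) c (ofBase p f) = 0 := by
  by_cases h : Even (deg n p c)
  · refine (der_ofBody h (pullback p f)).trans ?_
    rw [partialD_pullback]
    have e : baseProj n p (Pi.single ⟨c, h⟩ 1) = 0 := by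
      ext j
      rw [baseProj_apply, Pi.single_eq_of_ne]
      · rfl
      · rintro h
        have := congrArg (fun c => c.1.1) h
        exact hc this.symm
    have e2 : SmoothFun.partialD (0 : EuclideanSpace ℝ (Fin n)) f = 0 := by
      ext u
      rw [SmoothFun.partialD_apply, map_zero]; rfl
    rw [e, e2]
    exact ofBase_zero
  · exact der_ofBody_eq_zero (g := (c, false)) (Or.inr h) _

theorem pdd_ofBase (c : Idx n) (f : SmoothFun V) : pdd (body p V) c (ofBase p f) = 0 :=
  pdd_ofBody c _

theorem par_a (i : Fin n) : Par 1 (a p V i) := par_coord (1, i)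

theorem par_y (i : Fin n) : Par (p - 1) (y p V i) := par_coord (2, i)

theorem par_z (i : Fin n) : Par p (z p V i) := par_coord (3, i)

theorem aProd_zero (J : Fin 0 → Fin n) : aProd p V J = 1 := by simp [aProd]

theorem aProd_cons {q : ℕ} (j : Fin n) (J : Fin q → Fin n) :
    aProd p V (Fin.cons j J : Fin (q + 1) → Fin n) = a p V j * aProd p V J := by
  simp [aProd, List.ofFn_succ]

theorem aProd_snoc {q : ℕ} (J : Fin q → Fin n) (j : Fin n) :
    aProd p V (Fin.snoc J j : Fin (q + 1) → Fin n) = aProd p V J * a p V j := by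
  rw [aProd, List.ofFn_succ', List.concat_eq_append, List.prod_append]
  simp [aProd]

theorem a_eq_oddGen (i : Fin n) : a p V i = oddGen (body p V) (1, i) :=
  gen_odd (g := ((1, i), false)) (by simp [parity, deg])

/-- As an exterior product the monomial is alternating in its indices, which yields the sign in
`aProd_perm`. -/
theorem aProd_eq {q : ℕ} (J : Fin q → Fin n) : aProd p V J = ofExterior (body p V)
    (ExteriorAlgebra.ιMulti ℝ q fun r => Pi.single ((1, J r) : Idx n) (1 : ℝ)) := by
  rw [ExteriorAlgebra.ιMulti_apply, map_list_prod, List.map_ofFn, aProd]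
  exact congrArg _ (congrArg _ (funext fun r => a_eq_oddGen _))

theorem aProd_perm {q : ℕ} (J : Fin q → Fin n) (σ : Equiv.Perm (Fin q)) :
    aProd p V (J ∘ σ) = ((Equiv.Perm.sign σ : ℤ) : ℝ) • aProd p V J := by
  rw [aProd_eq, aProd_eq]
  have := (ExteriorAlgebra.ιMulti ℝ q).map_perm
    (fun r => (Pi.single ((1, J r) : Idx n) (1 : ℝ) : Idx n → ℝ)) σ
  refine (congrArg (ofExterior (body p V)) this).trans ?_
  rw [Units.smul_def, ← Int.cast_smul_eq_zsmul ℝ, map_smul]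

theorem par_aProd {q : ℕ} (J : Fin q → Fin n) : Par q (aProd p V J) := by
  induction q with
  | zero => rw [aProd_zero, Par, map_one, pow_zero, one_smul]
  | succ q ih =>
    rw [← Fin.cons_self_tail J, aProd_cons]
    exact ((par_a _).mul (ih _)).congr (by rw [add_comm])

/-- The function `∑ f^{k₁…k_q} a_{k₁} ⋯ a_{k_q}`. -/
def aSum {q : ℕ} (f : (Fin q → Fin n) → SmoothFun V) : Form (body p V) :=
  ∑ K, ofBase p (f K) * aProd p V K

theorem sum_cons {q : ℕ} {A : Type*} [AddCommMonoid A] (F : (Fin (q + 1) → Fin n) → A) :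
    ∑ K, F K = ∑ j, ∑ J : Fin q → Fin n, F (Fin.cons j J) := by
  rw [← Fintype.sum_prod_type', ← (Fin.consEquiv fun _ => Fin n).sum_comp]
  rfl

theorem sum_snoc {q : ℕ} {A : Type*} [AddCommMonoid A] (F : (Fin (q + 1) → Fin n) → A) :
    ∑ K, F K = ∑ j, ∑ J : Fin q → Fin n, F (Fin.snoc J j) := by
  rw [← Fintype.sum_prod_type', ← (Fin.snocEquiv fun _ => Fin n).sum_comp]
  rfl

theorem aSum_zero_index (f : (Fin 0 → Fin n) → SmoothFun V) :
    aSum (p := p) f = ofBase p (f ![]) := by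
  rw [aSum, Fintype.sum_unique, aProd_zero, mul_one]
  congr 2

theorem aSum_succ {q : ℕ} (f : (Fin (q + 1) → Fin n) → SmoothFun V) :
    aSum (p := p) f = ∑ j, a p V j * aSum fun J => f (Fin.cons j J) := by
  rw [aSum, sum_cons]
  refine Finset.sum_congr rfl fun j _ => ?_
  rw [aSum, Finset.mul_sum]
  refine Finset.sum_congr rfl fun J _ => ?_
  rw [aProd_cons, ← mul_assoc, ← mul_assoc, ofBase_mul_comm]

theorem aSum_one (f : (Fin 1 → Fin n) → SmoothFun V) :
    aSum (p := p) f = ∑ j, ofBase p (f ![j]) * a p V j := by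
  rw [aSum_succ]
  refine Finset.sum_congr rfl fun j _ => ?_
  rw [aSum_zero_index, ofBase_mul_comm]; rfl

theorem aSum_two (f : (Fin 2 → Fin n) → SmoothFun V) :
    aSum (p := p) f = ∑ j, ∑ k, ofBase p (f ![j, k]) * a p V j * a p V k := by
  rw [aSum_succ]
  refine Finset.sum_congr rfl fun j _ => ?_
  rw [aSum_one, Finset.mul_sum]
  refine Finset.sum_congr rfl fun k _ => ?_
  rw [← mul_assoc, ofBase_mul_comm]; rfl

theorem aSum_add {q : ℕ} (f g : (Fin q → Fin n) → SmoothFun V) :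
    aSum (p := p) (fun K => f K + g K) = aSum f + aSum g := by
  simp only [aSum, ofBase_add, add_mul, Finset.sum_add_distrib]

theorem aSum_sub {q : ℕ} (f g : (Fin q → Fin n) → SmoothFun V) :
    aSum (p := p) (fun K => f K - g K) = aSum f - aSum g := by
  simp only [aSum, ofBase_sub, sub_mul, Finset.sum_sub_distrib]

theorem aSum_neg {q : ℕ} (f : (Fin q → Fin n) → SmoothFun V) :
    aSum (p := p) (fun K => - f K) = - aSum f := by
  simp only [aSum, ofBase_neg, neg_mul, Finset.sum_neg_distrib]

theorem aSum_smul {q : ℕ} (r : ℝ) (f : (Fin q → Fin n) → SmoothFun V) :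
    aSum (p := p) (fun K => r • f K) = r • aSum f := by
  simp only [aSum, ofBase_smul, smul_mul_assoc, Finset.smul_sum]

theorem aSum_sum {q : ℕ} {κ : Type*} (s : Finset κ) (f : κ → (Fin q → Fin n) → SmoothFun V) :
    aSum (p := p) (fun K => ∑ k ∈ s, f k K) = ∑ k ∈ s, aSum (f k) := by
  simp only [aSum, ofBase_sum, Finset.sum_mul]
  exact Finset.sum_comm

theorem aSum_zero {q : ℕ} : aSum (p := p) (fun _ : Fin q → Fin n => (0 : SmoothFun V)) = 0 :=
  Finset.sum_eq_zero fun K _ => by rw [ofBase_zero, zero_mul]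

theorem par_aSum {q : ℕ} (f : (Fin q → Fin n) → SmoothFun V) : Par q (aSum (p := p) f) :=
  Par.sum fun K _ => ((par_ofBase _).mul (par_aProd K)).congr (by rw [zero_add])

theorem pd_a (c : Idx n) (i : Fin n) :
    pd (body p V) c (a p V i) = if c = (1, i) then 1 else 0 := pd_coord _ _

theorem pd_aProd_eq_zero {c : Idx n} (hc : c.1 ≠ 1) {q : ℕ} (J : Fin q → Fin n) :
    pd (body p V) c (aProd p V J) = 0 := by
  induction q with
  | zero => rw [aProd_zero]; exact der_one (c, false)
  | succ q ih =>
    rw [← Fin.cons_self_tail J, aProd_cons, (par_a _).pd_mul, ih, pd_a, if_neg, zero_mul, mul_zero,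
      smul_zero, add_zero]
    rintro rfl
    exact hc rfl

theorem pdd_aProd (c : Idx n) {q : ℕ} (J : Fin q → Fin n) :
    pdd (body p V) c (aProd p V J) = 0 := by
  induction q with
  | zero => rw [aProd_zero]; exact der_one (c, true)
  | succ q ih =>
    rw [← Fin.cons_self_tail J, aProd_cons, (par_a _).pdd_mul, ih, a, pdd_coord, zero_mul, mul_zero,
      smul_zero, add_zero]

theorem pdd_aSum (c : Idx n) {q : ℕ} (f : (Fin q → Fin n) → SmoothFun V) :
    pdd (body p V) c (aSum f) = 0 := by
  rw [aSum, map_sum]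
  refine Finset.sum_eq_zero fun K _ => ?_
  rw [(par_ofBase _).pdd_mul, pdd_ofBase, pdd_aProd, zero_mul, mul_zero, mul_zero, smul_zero, add_zero]

theorem pd_x_aSum (i : Fin n) {q : ℕ} (f : (Fin q → Fin n) → SmoothFun V) :
    pd (body p V) (0, i) (aSum f) = aSum fun K => coordD i (f K) := by
  rw [aSum, map_sum]
  refine Finset.sum_congr rfl fun K _ => ?_
  rw [(par_ofBase _).pd_mul, pd_ofBase, pd_aProd_eq_zero (by simp), mul_zero, mul_zero,
    smul_zero, add_zero]

theorem pd_aSum_eq_zero {c : Idx n} (h0 : c.1 ≠ 0) (h1 : c.1 ≠ 1) {q : ℕ}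
    (f : (Fin q → Fin n) → SmoothFun V) : pd (body p V) c (aSum f) = 0 := by
  rw [aSum, map_sum]
  refine Finset.sum_eq_zero fun K _ => ?_
  rw [(par_ofBase _).pd_mul, pd_ofBase_eq_zero h0, pd_aProd_eq_zero h1, zero_mul, mul_zero, mul_zero,
    smul_zero, add_zero]

/-- A family of functions that is antisymmetric in its indices. -/
def IsAntisymm {q : ℕ} (f : (Fin q → Fin n) → SmoothFun V) : Prop :=
  ∀ K r s, r ≠ s → f (K ∘ Equiv.swap r s) = - f K

theorem IsAntisymm.cons {q : ℕ} {f : (Fin (q + 1) → Fin n) → SmoothFun V} (hf : IsAntisymm f)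
    (j : Fin n) : IsAntisymm fun J => f (Fin.cons j J) := fun J r s hrs => by
  rw [← hf _ r.succ s.succ (by simpa using hrs)]
  refine congrArg f (funext fun t => ?_)
  refine Fin.cases ?_ (fun t => ?_) t
  · rw [Function.comp_apply, Equiv.swap_apply_of_ne_of_ne (Fin.succ_ne_zero r).symm
      (Fin.succ_ne_zero s).symm, Fin.cons_zero, Fin.cons_zero]
  · rw [Function.comp_apply, Fin.cons_succ, Function.comp_apply]
    have : Equiv.swap r.succ s.succ t.succ = (Equiv.swap r s t).succ :=
      ((Fin.succ_injective q).swap_apply r s t)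
    rw [this, Fin.cons_succ]

theorem IsAntisymm.swap {q : ℕ} {f : (Fin (q + 2) → Fin n) → SmoothFun V} (hf : IsAntisymm f)
    (i j : Fin n) (J : Fin q → Fin n) :
    f (Fin.cons i (Fin.cons j J : Fin (q + 1) → Fin n))
      = - f (Fin.cons j (Fin.cons i J : Fin (q + 1) → Fin n)) := by
  rw [← hf _ 0 1 (by simp)]
  congr 1
  funext t
  refine Fin.cases ?_ (fun t => Fin.cases ?_ (fun t => ?_) t) t
  · rw [Function.comp_apply, Equiv.swap_apply_left]; rfl
  · have : (Fin.succ (0 : Fin (q + 1))) = 1 := rfl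
    rw [Function.comp_apply, this, Equiv.swap_apply_right]; rfl
  · rw [Function.comp_apply, Equiv.swap_apply_of_ne_of_ne]
    · rfl
    · exact Fin.succ_ne_zero _
    · exact fun h => Fin.succ_ne_zero t (Fin.succ_injective _ h)

theorem IsAntisymm.coordD {q : ℕ} {f : (Fin q → Fin n) → SmoothFun V} (hf : IsAntisymm f)
    (i : Fin n) : IsAntisymm fun K => coordD i (f K) := fun K r s hrs => by
  simp only [hf K r s hrs, map_neg]

/-- Split off the first factor `a_j`. The derivative hits it, or passes it with a minus sign that
the antisymmetry of `f` absorbs; so each of the `q + 1` positions contributes the same term. -/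
theorem pd_a_aSum {q : ℕ} {f : (Fin (q + 1) → Fin n) → SmoothFun V} (hf : IsAntisymm f)
    (i : Fin n) :
    pd (body p V) (1, i) (aSum f) = (q + 1 : ℝ) • aSum fun J => f (Fin.cons i J) := by
  induction q with
  | zero =>
    rw [aSum_succ, map_sum, Finset.sum_eq_single i]
    · rw [(par_a i).pd_mul, pd_a, if_pos rfl, aSum_zero_index, pd_ofBase_eq_zero (by simp), one_mul,
        mul_zero, smul_zero, add_zero, Nat.cast_zero, zero_add (1 : ℝ), one_smul]
    · intro j _ hj
      rw [(par_a j).pd_mul, pd_a, if_neg (by simpa using Ne.symm hj), aSum_zero_index,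
        pd_ofBase_eq_zero (by simp), mul_zero, smul_zero, add_zero, zero_mul]
    · exact fun h => absurd (Finset.mem_univ _) h
  | succ q ih =>
    rw [aSum_succ, map_sum]
    have e : ∀ j, pd (body p V) (1, i) (a p V j * aSum fun J => f (Fin.cons j J))
        = (if j = i then aSum (fun J => f (Fin.cons i J)) else 0)
          + (q + 1 : ℝ) • (a p V j * aSum fun J =>
              f (Fin.cons i (Fin.cons j J : Fin (q + 1) → Fin n))) := fun j => by
      rw [(par_a j).pd_mul, pd_a, ih (hf.cons j)]
      congr 1
      · by_cases h : j = i
        · subst h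
          rw [if_pos rfl, if_pos rfl, one_mul]
        · rw [if_neg (by simpa using Ne.symm h), if_neg h, zero_mul]
      · have : ∀ J, f (Fin.cons j (Fin.cons i J : Fin (q + 1) → Fin n))
            = - f (Fin.cons i (Fin.cons j J : Fin (q + 1) → Fin n)) := hf.swap j i
        simp only [this, aSum_neg]
        have h1 : deg n p (1, i) * 1 = 1 := rfl
        rw [h1, pow_one, neg_one_smul, mul_smul_comm, mul_neg, smul_neg, neg_neg]
    rw [Finset.sum_congr rfl fun j _ => e j, Finset.sum_add_distrib, Finset.sum_ite_eq',
      if_pos (Finset.mem_univ i), ← Finset.smul_sum, ← aSum_succ fun J => f (Fin.cons i J)]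
    rw [Nat.cast_succ, add_smul (q + 1 : ℝ) 1, one_smul, add_comm]

/-- Differentiating successively in the `a`'s strips off the indices one at a time, up to nonzero
factors. Antisymmetry is essential, since `aSum` sees only the antisymmetric part of the
coefficients. -/
theorem eq_zero_of_aSum_eq_zero {q : ℕ} {f : (Fin q → Fin n) → SmoothFun V} (hf : IsAntisymm f)
    (h : aSum (p := p) f = 0) (K : Fin q → Fin n) : f K = 0 := by
  induction q with
  | zero =>
    rw [aSum_zero_index, ← ofBase_zero] at h
    rw [Subsingleton.elim K ![]]
    exact ofBase_injective h
  | succ q ih =>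
    rw [← Fin.cons_self_tail K]
    refine ih (hf.cons _) ?_ _
    have h1 := pd_a_aSum (p := p) hf (K 0)
    rw [h, map_zero] at h1
    have h2 : (q + 1 : ℝ) ≠ 0 := by positivity
    exact eq_zero_of_smul_eq_zero h2 h1.symm

/-- Euler's identity in the `a`'s: a function of positive degree `q + 1` is recovered from its
`a`-derivatives. In degree `0` this would fail. -/
theorem aSum_eq_zero_of_pd_a {q : ℕ} {f : (Fin (q + 1) → Fin n) → SmoothFun V} (hf : IsAntisymm f)
    (h : ∀ i, pd (body p V) (1, i) (aSum f) = 0) : aSum (p := p) f = 0 := by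
  rw [aSum_succ]
  refine Finset.sum_eq_zero fun i _ => ?_
  have h2 : (q + 1 : ℝ) ≠ 0 := by positivity
  rw [eq_zero_of_smul_eq_zero h2 ((pd_a_aSum hf i).symm.trans (h i)), mul_zero]

/-- The antisymmetrization with weight one. -/
def antisymm {q : ℕ} (f : (Fin q → Fin n) → SmoothFun V) (K : Fin q → Fin n) : SmoothFun V :=
  (q.factorial : ℝ)⁻¹ • ∑ σ : Equiv.Perm (Fin q), ((Equiv.Perm.sign σ : ℤ) : ℝ) • f (K ∘ σ)

theorem isAntisymm_antisymm {q : ℕ} (f : (Fin q → Fin n) → SmoothFun V) :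
    IsAntisymm (antisymm f) := fun K r s hrs => by
  rw [antisymm, antisymm, ← smul_neg]
  congr 1
  rw [← Equiv.sum_comp (Equiv.mulLeft (Equiv.swap r s)), ← Finset.sum_neg_distrib]
  refine Finset.sum_congr rfl fun σ _ => ?_
  rw [Equiv.coe_mulLeft, Equiv.Perm.sign_mul, Equiv.Perm.sign_swap hrs]
  have : (K ∘ Equiv.swap r s) ∘ (Equiv.swap r s * σ : Equiv.Perm (Fin q)) = K ∘ σ := by
    funext t; simp
  rw [this]
  simp

/-- Relabelling the indices by `σ` changes the monomial by the sign of `σ`, which cancels the sign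
in the antisymmetrization; all `q!` summands are therefore equal to `aSum f`. -/
theorem aSum_antisymm {q : ℕ} (f : (Fin q → Fin n) → SmoothFun V) :
    aSum (p := p) (antisymm f) = aSum f := by
  have key : ∀ σ : Equiv.Perm (Fin q),
      aSum (p := p) (fun K => ((Equiv.Perm.sign σ : ℤ) : ℝ) • f (K ∘ σ)) = aSum f := fun σ => by
    rw [aSum_smul, aSum, aSum, ← (Equiv.arrowCongr σ (Equiv.refl (Fin n))).sum_comp,
      Finset.smul_sum]
    refine Finset.sum_congr rfl fun K _ => ?_
    have e : (Equiv.arrowCongr σ (Equiv.refl (Fin n))) K = K ∘ (σ⁻¹ : Equiv.Perm (Fin q)) := rfl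
    have e2 : (K ∘ (σ⁻¹ : Equiv.Perm (Fin q))) ∘ σ = K := by funext t; simp
    rw [e, e2, aProd_perm, Equiv.Perm.sign_inv, mul_smul_comm, smul_smul, ← Int.cast_mul,
      Int.units_coe_mul_self, Int.cast_one, one_smul]
  have e : antisymm f = fun K => (q.factorial : ℝ)⁻¹ • ∑ σ : Equiv.Perm (Fin q),
    ((Equiv.Perm.sign σ : ℤ) : ℝ) • f (K ∘ σ) := rfl
  rw [e, aSum_smul, aSum_sum, Finset.sum_congr rfl fun σ _ => key σ, Finset.sum_const,
    Finset.card_univ, Fintype.card_perm, Fintype.card_fin, ← Nat.cast_smul_eq_nsmul ℝ, smul_smul,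
    inv_mul_cancel₀ (by positivity), one_smul]

end ShiftedCotangent

/-! ### The Hamiltonian function and its vector field. -/

namespace ShiftedCotangent

open GradedDomain

variable {n p : ℕ} {V : TopologicalSpace.Opens (EuclideanSpace ℝ (Fin n))}

theorem neg_one_pow_mul_self (p : ℕ) : (-1 : ℝ) ^ p * (-1 : ℝ) ^ p = 1 := by
  rw [← mul_pow]; norm_num

theorem neg_one_pow_mul_pred {p : ℕ} (hp : 1 ≤ p) : (-1 : ℝ) ^ p * (-1 : ℝ) ^ (p - 1) = -1 := by
  obtain ⟨m, rfl⟩ : ∃ m, p = m + 1 := ⟨p - 1, by omega⟩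
  rw [Nat.add_sub_cancel, pow_succ, mul_comm ((-1 : ℝ) ^ m), mul_assoc, neg_one_pow_mul_self,
    mul_one]

theorem pd_y (c : Idx n) (i : Fin n) :
    pd (body p V) c (y p V i) = if c = (2, i) then 1 else 0 := pd_coord _ _

theorem pd_z (c : Idx n) (i : Fin n) :
    pd (body p V) c (z p V i) = if c = (3, i) then 1 else 0 := pd_coord _ _

theorem pd_pd_eq_zero {c : Idx n} {α : Form (body p V)} (h : pd (body p V) c α = 0) (d : Idx n) :
    pd (body p V) c (pd (body p V) d α) = 0 := by
  rw [pd_comm, h, map_zero, smul_zero]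

variable (p) in
/-- The function `½ Π^{jk} a_j a_k`. -/
def biv (P : (Fin 2 → Fin n) → SmoothFun V) : Form (body p V) := (2⁻¹ : ℝ) • aSum P

theorem par_biv (P : (Fin 2 → Fin n) → SmoothFun V) : Par 2 (biv p P) := (par_aSum P).smul _

theorem pd_biv_eq_zero {c : Idx n} (h0 : c.1 ≠ 0) (h1 : c.1 ≠ 1)
    (P : (Fin 2 → Fin n) → SmoothFun V) : pd (body p V) c (biv p P) = 0 := by
  rw [biv, map_smul, pd_aSum_eq_zero h0 h1, smul_zero]

theorem pd_x_biv (i : Fin n) (P : (Fin 2 → Fin n) → SmoothFun V) :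
    pd (body p V) (0, i) (biv p P) = (2⁻¹ : ℝ) • aSum fun K => coordD i (P K) := by
  rw [biv, map_smul, pd_x_aSum]

theorem pd_a_biv (i : Fin n) {P : (Fin 2 → Fin n) → SmoothFun V} (hP : IsAntisymm P) :
    pd (body p V) (1, i) (biv p P) = aSum fun J => P (Fin.cons i J) := by
  rw [biv, map_smul, pd_a_aSum hP, smul_smul]
  norm_num

/-- The Hamiltonian function `Π^{jk} a_k z_j - (-1)^p/2 ∂_j Π^{kl} y^j a_k a_l
+ (-1)^p/(p+1)! R^{k₁…k_{p+1}} a_{k₁} ⋯ a_{k_{p+1}}`. -/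
def theta (P : (Fin 2 → Fin n) → SmoothFun V) (R : (Fin (p + 1) → Fin n) → SmoothFun V) :
    Form (body p V) :=
  ∑ j, pd (body p V) (1, j) (biv p P) * z p V j
    - (-1 : ℝ) ^ p • ∑ j, y p V j * pd (body p V) (0, j) (biv p P)
    + ((-1 : ℝ) ^ p / (p + 1).factorial) • aSum R

theorem par_theta (hp : 1 ≤ p) (P : (Fin 2 → Fin n) → SmoothFun V)
    (R : (Fin (p + 1) → Fin n) → SmoothFun V) : Par (p + 1) (theta P R) := by
  refine ((Par.sum fun j _ => ?_).sub ((Par.sum fun j _ => ?_).smul _)).add ((par_aSum R).smul _)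
  · refine (((par_biv P).pd _).mul (par_z j)).congr ?_
    have : deg n p (1, j) = 1 := rfl
    rw [this]
    simp only [Nat.even_add, Nat.even_add_one]; simp
  · refine ((par_y j).mul ((par_biv P).pd _)).congr ?_
    have : p - 1 + (deg n p (0, j) + 2) = p + 1 := by
      have : deg n p (0, j) = 0 := rfl
      omega
    rw [this]

theorem pd_theta (c : Idx n) (P : (Fin 2 → Fin n) → SmoothFun V)
    (R : (Fin (p + 1) → Fin n) → SmoothFun V) : pd (body p V) c (theta P R) =
      ∑ j, (pd (body p V) c (pd (body p V) (1, j) (biv p P)) * z p V j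
        + (-1 : ℝ) ^ deg n p c • (pd (body p V) (1, j) (biv p P) * if c = (3, j) then 1 else 0))
      - (-1 : ℝ) ^ p • ∑ j, ((if c = (2, j) then 1 else 0) * pd (body p V) (0, j) (biv p P)
        + (-1 : ℝ) ^ (deg n p c * (p - 1)) •
          (y p V j * pd (body p V) c (pd (body p V) (0, j) (biv p P))))
      + ((-1 : ℝ) ^ p / (p + 1).factorial) • pd (body p V) c (aSum R) := by
  have e1 : ∀ j, pd (body p V) c (pd (body p V) (1, j) (biv p P) * z p V j)
      = pd (body p V) c (pd (body p V) (1, j) (biv p P)) * z p V j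
        + (-1 : ℝ) ^ deg n p c • (pd (body p V) (1, j) (biv p P) * if c = (3, j) then 1 else 0) :=
    fun j => by
      rw [((par_biv P).pd _).pd_mul, pd_z]
      congr 2
      refine neg_one_pow_congr ?_
      have : deg n p (1, j) = 1 := rfl
      rw [this]
      simp [Nat.even_mul, Nat.even_add_one]
  have e2 : ∀ j, pd (body p V) c (y p V j * pd (body p V) (0, j) (biv p P))
      = (if c = (2, j) then 1 else 0) * pd (body p V) (0, j) (biv p P)
        + (-1 : ℝ) ^ (deg n p c * (p - 1)) •
          (y p V j * pd (body p V) c (pd (body p V) (0, j) (biv p P))) := fun j => by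
    rw [(par_y j).pd_mul, pd_y]
  rw [theta, map_add, map_sub, map_smul, map_smul, map_sum, map_sum,
    Finset.sum_congr rfl fun j _ => e1 j, Finset.sum_congr rfl fun j _ => e2 j]

theorem pd_z_theta (i : Fin n) (P : (Fin 2 → Fin n) → SmoothFun V)
    (R : (Fin (p + 1) → Fin n) → SmoothFun V) :
    pd (body p V) (3, i) (theta P R) = (-1 : ℝ) ^ p • pd (body p V) (1, i) (biv p P) := by
  have hb : pd (body p V) (3, i) (biv p P) = 0 := pd_biv_eq_zero (by simp) (by simp) P
  rw [pd_theta, pd_aSum_eq_zero (by simp) (by simp)]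
  simp only [pd_pd_eq_zero hb, zero_mul, mul_zero, smul_zero, add_zero, zero_add, Prod.mk.injEq,
    true_and, mul_ite, mul_one, smul_ite, Finset.sum_ite_eq, Finset.mem_univ, if_true]
  simp only [show ((3 : Fin 4) = 2) = False by simp, false_and, if_false, zero_mul,
    Finset.sum_const_zero, smul_zero, sub_zero]
  rfl

theorem pd_y_theta (i : Fin n) (P : (Fin 2 → Fin n) → SmoothFun V)
    (R : (Fin (p + 1) → Fin n) → SmoothFun V) :
    pd (body p V) (2, i) (theta P R) = -((-1 : ℝ) ^ p • pd (body p V) (0, i) (biv p P)) := by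
  have hb : pd (body p V) (2, i) (biv p P) = 0 := pd_biv_eq_zero (by simp) (by simp) P
  rw [pd_theta, pd_aSum_eq_zero (by simp) (by simp)]
  simp only [pd_pd_eq_zero hb, zero_mul, mul_zero, smul_zero, add_zero, zero_add, Prod.mk.injEq,
    true_and, ite_mul, one_mul, Finset.sum_ite_eq, Finset.mem_univ, if_true]
  simp only [show ((2 : Fin 4) = 3) = False by simp, false_and, if_false, mul_zero, smul_zero,
    Finset.sum_const_zero, zero_sub]

theorem pd_x_theta (i : Fin n) (P : (Fin 2 → Fin n) → SmoothFun V)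
    (R : (Fin (p + 1) → Fin n) → SmoothFun V) : pd (body p V) (0, i) (theta P R) =
      ∑ j, pd (body p V) (0, i) (pd (body p V) (1, j) (biv p P)) * z p V j
      - (-1 : ℝ) ^ p • ∑ j, y p V j * pd (body p V) (0, i) (pd (body p V) (0, j) (biv p P))
      + ((-1 : ℝ) ^ p / (p + 1).factorial) • aSum fun K => coordD i (R K) := by
  rw [pd_theta, pd_x_aSum]
  have h0 : deg n p (0, i) = 0 := rfl
  simp only [Prod.mk.injEq, show ((0 : Fin 4) = 3) = False by simp,
    show ((0 : Fin 4) = 2) = False by simp, false_and, if_false, mul_zero, smul_zero, add_zero,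
    zero_mul, zero_add, h0, pow_zero, one_smul]

theorem pd_a_theta (i : Fin n) (P : (Fin 2 → Fin n) → SmoothFun V)
    {R : (Fin (p + 1) → Fin n) → SmoothFun V} (hR : IsAntisymm R) :
    pd (body p V) (1, i) (theta P R) =
      ∑ j, pd (body p V) (1, i) (pd (body p V) (1, j) (biv p P)) * z p V j
      - ((-1 : ℝ) ^ p * (-1 : ℝ) ^ (p - 1)) •
        ∑ j, y p V j * pd (body p V) (1, i) (pd (body p V) (0, j) (biv p P))
      + ((-1 : ℝ) ^ p / p.factorial) • aSum fun J => R (Fin.cons i J) := by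
  rw [pd_theta, pd_a_aSum hR]
  have h1 : deg n p (1, i) = 1 := rfl
  simp only [Prod.mk.injEq, show ((1 : Fin 4) = 3) = False by simp,
    show ((1 : Fin 4) = 2) = False by simp, false_and, if_false, mul_zero, smul_zero, add_zero,
    zero_mul, zero_add, h1, one_mul]
  rw [← Finset.smul_sum, smul_smul, smul_smul]
  congr 2
  -- The factor `p + 1` from differentiating the `R`-term turns `1/(p+1)!` into `1/p!`.
  rw [Nat.factorial_succ, Nat.cast_mul, Nat.cast_succ]
  have : (p + 1 : ℝ) ≠ 0 := by positivity
  field_simp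

/-- The index of the conjugate coordinate. -/
def conj (c : Idx n) : Idx n := (![3, 2, 1, 0] c.1, c.2)

theorem conj_conj (c : Idx n) : conj (conj c) = c := by
  obtain ⟨k, i⟩ := c
  fin_cases k <;> rfl

variable (p) in
/-- The signs in the Hamiltonian equations. -/
def eta (c : Idx n) : ℝ := ![-(-1) ^ p, (-1) ^ p, (-1) ^ p, 1] c.1

/-- The Hamiltonian vector field of `theta P R`. -/
def hamField (P : (Fin 2 → Fin n) → SmoothFun V) (R : (Fin (p + 1) → Fin n) → SmoothFun V)
    (c : Idx n) : Form (body p V) := eta p c • pd (body p V) (conj c) (theta P R)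

theorem eta_ne_zero (c : Idx n) : eta p c ≠ 0 := by
  obtain ⟨k, i⟩ := c
  fin_cases k <;> simp [eta]

/-- Conjugate degrees are `0 + p` and `1 + (p - 1)`; the bound `1 ≤ p` makes the truncated
subtraction harmless. -/
theorem deg_conj_add (hp : 1 ≤ p) (c : Idx n) : deg n p (conj c) + deg n p c = p := by
  obtain ⟨k, i⟩ := c
  fin_cases k <;> simp [deg, conj] <;> omega

theorem eta_conj (hp : 1 ≤ p) (c : Idx n) :
    eta p (conj c) * (-1 : ℝ) ^ ((p + 1) * (deg n p c + 1)) = eta p c := by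
  obtain ⟨m, rfl⟩ : ∃ m, p = m + 1 := ⟨p - 1, by omega⟩
  obtain ⟨k, i⟩ := c
  rcases Nat.even_or_odd m with hm | hm <;> fin_cases k <;>
  simp [eta, deg, conj, pow_mul, pow_succ, hm.neg_one_pow]

theorem isHamiltonian_hamField (hp : 1 ≤ p) (P : (Fin 2 → Fin n) → SmoothFun V)
    (R : (Fin (p + 1) → Fin n) → SmoothFun V) :
    IsHamiltonian conj (eta p) (p + 1) (theta P R) (hamField P R) where
  star_star := conj_conj
  parity_star c _ := by
    have := deg_conj_add hp c
    rw [show deg n p (conj c) + (p + 1) = 2 * deg n p (conj c) + (deg n p c + 1) by omega,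
      Nat.even_add]
    simp
  sign := eta_conj hp
  par := par_theta hp P R
  field _ := rfl

end ShiftedCotangent

/-! ### Vector fields as derivations. -/

namespace GradedDomain

variable {ι : Type} [Fintype ι] [DecidableEq ι] {deg : ι → ℕ}
  {W : TopologicalSpace.Opens (Body deg)}

theorem applyField_add (X : ι → Form W) (α β : Form W) :
    applyField X (α + β) = applyField X α + applyField X β := by
  simp only [applyField, map_add, mul_add, Finset.sum_add_distrib]

theorem applyField_sub (X : ι → Form W) (α β : Form W) :
    applyField X (α - β) = applyField X α - applyField X β := by
  simp only [applyField, map_sub, mul_sub, Finset.sum_sub_distrib]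

theorem applyField_smul (X : ι → Form W) (r : ℝ) (α : Form W) :
    applyField X (r • α) = r • applyField X α := by
  simp only [applyField, map_smul, mul_smul_comm, Finset.smul_sum]

theorem applyField_sum (X : ι → Form W) {κ : Type*} (s : Finset κ) (α : κ → Form W) :
    applyField X (∑ k ∈ s, α k) = ∑ k ∈ s, applyField X (α k) := by
  simp only [applyField, map_sum, Finset.mul_sum]
  exact Finset.sum_comm

theorem applyField_coord (X : ι → Form W) (c : ι) : applyField X (coord W c) = X c := by
  rw [applyField, Finset.sum_eq_single c]
  · rw [pd_coord, if_pos rfl, mul_one]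
  · intro d _ hd
    rw [pd_coord, if_neg hd, mul_zero]
  · exact fun h => absurd (Finset.mem_univ _) h

/-- Each `X^c ∂_c` has odd total parity, so passing `α` costs `(-1)^k` whatever the degree of `ξ^c`.
-/
theorem applyField_mul {X : ι → Form W} (hX : ∀ c, Par (deg c + 1) (X c)) {k : ℕ} {α : Form W}
    (hα : Par k α) (β : Form W) :
    applyField X (α * β) = applyField X α * β + (-1 : ℝ) ^ k • (α * applyField X β) := by
  simp only [applyField, Finset.sum_mul, Finset.mul_sum, Finset.smul_sum,
    ← Finset.sum_add_distrib]
  refine Finset.sum_congr rfl fun c _ => ?_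
  rw [hα.pd_mul, mul_add, ← mul_assoc, mul_smul_comm, ← mul_assoc, (hX c).mul_comm' hα,
    smul_mul_assoc, smul_smul, ← pow_add, mul_assoc α (X c)]
  congr 2
  exact neg_one_pow_congr (by
    simp only [Nat.even_add, Nat.even_mul, Nat.even_add_one]; tauto)

theorem extD_sub (α β : Form W) : extD (α - β) = extD α - extD β := applyField_sub _ α β

theorem extD_smul (r : ℝ) (α : Form W) : extD (r • α) = r • extD α := applyField_smul _ r α

theorem isForm_zero_coord (c : ι) : IsForm 0 (coord W c) :=
  isForm_zero_iff.2 fun d => pdd_coord d c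

theorem HasWeight.der {w : ι × Bool → ℝ} {k : ℝ} {α : Form W} (h : HasWeight w k α)
    (g : ι × Bool) : HasWeight w (k - w g) (GradedDomain.der W g α) := by
  have key := der_weightOp w g α
  rw [h, map_smul] at key
  rw [HasWeight, sub_smul, key, add_sub_cancel_left]

theorem HasWeight.pd {w : ι × Bool → ℝ} {k : ℝ} {α : Form W} (h : HasWeight w k α)
    (c : ι) : HasWeight w (k - w (c, false)) (GradedDomain.pd W c α) := h.der (c, false)

end GradedDomain

/-! ### The symplectic form, its Lie derivative, and degrees. -/

namespace ShiftedCotangent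

open GradedDomain

variable {n p : ℕ} {V : TopologicalSpace.Opens (EuclideanSpace ℝ (Fin n))}

/-! ### The symplectic form -/

variable (p) in
/-- The signs in the symplectic form. -/
def kappa (c : Idx n) : ℝ := ![1, (-1) ^ p, (-1) ^ p, -(-1) ^ p] c.1

theorem kappa_ne_zero (c : Idx n) : kappa p c ≠ 0 := by
  obtain ⟨k, i⟩ := c
  fin_cases k <;> simp [kappa]

theorem pdd_dcoord_mul_dcoord (c u v : Idx n) :
    pdd (body p V) c (dcoord (body p V) u * dcoord (body p V) v)
      = (if c = u then dcoord (body p V) v else 0) + if c = v then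
        (-1 : ℝ) ^ ((deg n p c + 1) * (deg n p u + 1)) • dcoord (body p V) u else 0 := by
  rw [(par_dcoord u).pdd_mul, pdd_dcoord, pdd_dcoord]
  split_ifs <;> simp only [one_mul, zero_mul, mul_one, mul_zero, smul_zero]

/-- This is the Darboux shape required by `contract_bijective_of_pdd`. The sign at `z_i` comes from
passing the odd `dx^i`; passing the even `da_i` costs nothing. -/
theorem pdd_omega (hp : 1 ≤ p) (c : Idx n) :
    pdd (body p V) c (omega p V) = kappa p c • dcoord (body p V) (conj c) := by
  obtain ⟨m, rfl⟩ : ∃ m, p = m + 1 := ⟨p - 1, by omega⟩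
  obtain ⟨k, i⟩ := c
  rw [omega, map_sum]
  simp only [map_add, map_smul, pdd_dcoord_mul_dcoord, Prod.mk.injEq]
  fin_cases k <;>
  simp [kappa, conj, deg, pow_succ, pow_mul, neg_one_pow_mul_self]

theorem contract_omega (hp : 1 ≤ p) (X : Idx n → Form (body p V)) :
    contract X (omega p V) = ∑ c, kappa p c • (X c * dcoord (body p V) (conj c)) := by
  rw [contract]
  refine Finset.sum_congr rfl fun c _ => ?_
  rw [pdd_omega hp, mul_smul_comm]

theorem pd_dcoord_mul_dcoord (c u v : Idx n) :
    pd (body p V) c (dcoord (body p V) u * dcoord (body p V) v) = 0 := by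
  rw [(par_dcoord u).pd_mul, pd_dcoord, pd_dcoord, zero_mul, mul_zero, smul_zero, add_zero]

theorem extD_omega : extD (omega p V) = 0 := by
  refine Finset.sum_eq_zero fun c _ => ?_
  rw [omega, map_sum, Finset.sum_eq_zero, mul_zero]
  intro i _
  rw [map_add, map_smul, pd_dcoord_mul_dcoord, pd_dcoord_mul_dcoord, smul_zero, add_zero]

theorem hasWeight_omega {w : Idx n × Bool → ℝ} {k : ℝ}
    (h1 : ∀ i, w ((0, i), true) + w ((3, i), true) = k)
    (h2 : ∀ i, w ((1, i), true) + w ((2, i), true) = k) : HasWeight w k (omega p V) := by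
  refine HasWeight.sum fun i _ => HasWeight.add ?_ (HasWeight.smul _ ?_)
  · rw [← h1 i]
    exact (HasWeight.gen w _).mul (HasWeight.gen w _)
  · rw [← h2 i]
    exact (HasWeight.gen w _).mul (HasWeight.gen w _)

theorem isSymplectic_omega (hp : 1 ≤ p) : IsSymplectic p (omega p V) where
  isForm := isForm_iff.2 (hasWeight_omega (fun i => by simp [formWeight]; norm_num)
    (fun i => by simp [formWeight]; norm_num))
  hasDegree := hasDegree_iff.2 (hasWeight_omega (fun i => by simp [degWeight, deg])
    (fun i => by simp [degWeight, deg, Nat.cast_sub hp]))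
  closed := extD_omega
  nondegenerate := contract_bijective_of_pdd conj_conj kappa_ne_zero (pdd_omega hp)

/-! ### The Lie derivative of the symplectic form -/

/-- The Hamiltonian vector field of `theta P R`, twisted by a function in each of the components
`∂/∂z_i`. -/
def twistedField (P : (Fin 2 → Fin n) → SmoothFun V) (R : (Fin (p + 1) → Fin n) → SmoothFun V)
    (T : Fin n → (Fin (p + 1) → Fin n) → SmoothFun V) (c : Idx n) : Form (body p V) :=
  hamField P R c + if c.1 = 3 then ((-1 : ℝ) ^ p / (p + 1).factorial) • aSum (T c.2) else 0

variable (P : (Fin 2 → Fin n) → SmoothFun V) (R : (Fin (p + 1) → Fin n) → SmoothFun V)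
    (T : Fin n → (Fin (p + 1) → Fin n) → SmoothFun V)

/-- The right side is the sign of interchanging `∂Θ/∂ξ^{conj c}` with `dξ^{conj c}`; this is what
makes `ι_X ω` equal to `dΘ`. -/
theorem kappa_mul_eta (hp : 1 ≤ p) (c : Idx n) : kappa p c * eta p c =
    (-1 : ℝ) ^ ((deg n p (conj c) + 1) * (deg n p (conj c) + (p + 1))) := by
  obtain ⟨m, rfl⟩ : ∃ m, p = m + 1 := ⟨p - 1, by omega⟩
  obtain ⟨k, i⟩ := c
  rcases Nat.even_or_odd m with hm | hm <;> fin_cases k <;>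
  simp [eta, kappa, deg, conj, pow_mul, pow_succ, pow_add, hm.neg_one_pow]

theorem contract_hamField (hp : 1 ≤ p) :
    contract (hamField P R) (omega p V) = extD (theta P R) := by
  rw [contract_omega hp, extD, ← sum_comp_star conj_conj]
  refine Finset.sum_congr rfl fun c _ => ?_
  rw [hamField, smul_mul_assoc, smul_smul, kappa_mul_eta hp, conj_conj,
    (par_dcoord c).mul_comm' ((par_theta hp P R).pd c)]

/-- Only the `z_i` components carry a twist, and `z_i` pairs with `dx^i`. The coefficient is `κ =
-(-1)^p` times `(-1)^p/(p+1)!`. -/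
theorem contract_twistedField (hp : 1 ≤ p) : contract (twistedField P R T) (omega p V)
    = extD (theta P R) - ((p + 1).factorial : ℝ)⁻¹ •
      ∑ i, aSum (T i) * dcoord (body p V) (0, i) := by
  rw [← contract_hamField P R hp, contract_omega hp, contract_omega hp, sub_eq_add_neg]
  simp only [twistedField, add_mul, smul_add, Finset.sum_add_distrib]
  congr 1
  rw [Fintype.sum_prod_type, Finset.sum_eq_single 3]
  · rw [Finset.smul_sum, ← Finset.sum_neg_distrib]
    refine Finset.sum_congr rfl fun i _ => ?_
    rw [if_pos rfl, smul_mul_assoc, smul_smul, ← neg_smul]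
    congr 1
    have e2 : kappa p ((3, i) : Idx n) = -(-1) ^ p := rfl
    rw [e2, div_eq_mul_inv]
    linear_combination (-((p + 1).factorial : ℝ)⁻¹) * neg_one_pow_mul_self p
  · intro k _ hk
    refine Finset.sum_eq_zero fun i _ => ?_
    rw [if_neg hk, zero_mul, smul_zero]
  · exact fun h => absurd (Finset.mem_univ _) h

/-- Since `dω = 0`, only `-d ι_X ω` remains, and the exact part `dΘ` drops out by `d² = 0`. -/
theorem lieOdd_twistedField (hp : 1 ≤ p) : lieOdd (twistedField P R T) (omega p V)
    = ((p + 1).factorial : ℝ)⁻¹ • extD (∑ i, aSum (T i) * dcoord (body p V) (0, i)) := by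
  rw [lieOdd, contract_twistedField P R T hp, extD_omega, extD_sub, extD_extD, extD_smul]
  have : contract (twistedField P R T) (0 : Form (body p V)) = 0 :=
    Finset.sum_eq_zero fun c _ => by rw [map_zero, mul_zero]
  rw [this]
  abel

/-- Looking at the terms of `d(T_j dx^j)` that contain `da_k` suffices: no condition on the
`x`-derivatives of `T` is needed, because the `a`-derivatives alone determine a function of positive
degree in `a`. -/
theorem lieOdd_twistedField_eq_zero_iff (hp : 1 ≤ p) (hT : ∀ i, IsAntisymm (T i)) :
    lieOdd (twistedField P R T) (omega p V) = 0 ↔ ∀ i K, T i K = 0 := by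
  rw [lieOdd_twistedField P R T hp]
  constructor
  · intro h i K
    have h0 := eq_zero_of_smul_eq_zero (by positivity) h
    have e : extD (∑ i, aSum (T i) * dcoord (body p V) (0, i)) = ∑ c, dcoord (body p V) c *
        ∑ j, pd (body p V) c (aSum (T j)) * dcoord (body p V) (0, j) := by
      refine Finset.sum_congr rfl fun c _ => ?_
      rw [map_sum]
      refine congrArg _ (Finset.sum_congr rfl fun j _ => ?_)
      rw [(par_aSum (T j)).pd_mul, pd_dcoord, mul_zero, smul_zero, add_zero]
    have hpdd : ∀ b c j, pdd (body p V) b (pd (body p V) c (aSum (T j))) = 0 := fun b c j => by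
      refine (der_comm (b, true) (c, false) _).trans ?_
      rw [← pdd_eq_der, pdd_aSum, map_zero, smul_zero]
    refine eq_zero_of_aSum_eq_zero (p := p) (hT i) (aSum_eq_zero_of_pd_a (hT i) fun k => ?_) K
    -- The coefficient of `da_k`: apply `∂/∂(da_k)`, which kills the `dx^j` and the derivatives of
    -- the `T_j`.
    have h1 : ∑ j, pd (body p V) (1, k) (aSum (T j)) * dcoord (body p V) (0, j) = 0 := by
      have h2 := congrArg (pdd (body p V) (1, k)) h0
      rw [e, map_sum, map_zero, Finset.sum_eq_single (1, k)] at h2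
      · rw [(par_dcoord _).pdd_mul, pdd_dcoord, if_pos rfl, one_mul, map_sum, Finset.sum_eq_zero
          (s := Finset.univ) (f := fun j => pdd (body p V) (1, k)
            (pd (body p V) (1, k) (aSum (T j)) * dcoord (body p V) (0, j))), mul_zero, smul_zero,
          add_zero] at h2
        · exact h2
        · intro j _
          rw [((par_aSum (T j)).pd _).pdd_mul, hpdd, pdd_dcoord, if_neg (by simp), zero_mul,
            mul_zero, smul_zero, add_zero]
      · intro c _ hc
        rw [(par_dcoord _).pdd_mul, pdd_dcoord, if_neg (Ne.symm hc), zero_mul, map_sum,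
          Finset.sum_eq_zero (s := Finset.univ) (f := fun j => pdd (body p V) (1, k)
            (pd (body p V) c (aSum (T j)) * dcoord (body p V) (0, j))), mul_zero, smul_zero,
          add_zero]
        intro j _
        rw [((par_aSum (T j)).pd _).pdd_mul, hpdd, pdd_dcoord, if_neg (by simp), zero_mul,
            mul_zero, smul_zero, add_zero]
      · exact fun h => absurd (Finset.mem_univ _) h
    -- Next the coefficient of `dx^i`, equal to `∂T_i/∂a_k` up to sign.
    have h2 := congrArg (pdd (body p V) (0, i)) h1
    rw [map_sum, map_zero, Finset.sum_eq_single i] at h2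
    · rw [((par_aSum (T i)).pd _).pdd_mul, hpdd, pdd_dcoord, if_pos rfl, zero_mul, zero_add,
        mul_one] at h2
      exact eq_zero_of_smul_eq_zero (pow_ne_zero _ (by norm_num)) h2
    · intro j _ hj
      rw [((par_aSum (T j)).pd _).pdd_mul, hpdd, pdd_dcoord, if_neg (by simpa using Ne.symm hj),
        zero_mul, mul_zero, smul_zero, add_zero]
    · exact fun h => absurd (Finset.mem_univ _) h
  · intro h
    have : ∀ i, aSum (p := p) (T i) = 0 := fun i => by
      rw [show T i = fun _ => 0 from funext (h i), aSum_zero]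
    simp only [this, zero_mul, Finset.sum_const_zero]
    rw [extD, Finset.sum_eq_zero, smul_zero]
    intro c _
    rw [map_zero, mul_zero]

/-! ### Weights -/

section Weights

variable {w : Idx n × Bool → ℝ} {s t u k : ℝ}

theorem hasWeight_ofBase (hx : ∀ i, w ((0, i), false) = 0) (f : SmoothFun V) :
    HasWeight w 0 (ofBase p f) := by
  refine HasWeight.of_der w fun g => ?_
  obtain ⟨⟨k, i⟩, _ | _⟩ := g
  · by_cases hk : k = 0
    · subst hk; exact Or.inl (hx i)
    · exact Or.inr (pd_ofBase_eq_zero hk f)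
  · exact Or.inr (pdd_ofBase _ f)

theorem hasWeight_aSum (hx : ∀ i, w ((0, i), false) = 0) (ha : ∀ i, w ((1, i), false) = s) {q : ℕ}
    (f : (Fin q → Fin n) → SmoothFun V) : HasWeight w (q * s) (aSum (p := p) f) := by
  have key : ∀ {q : ℕ} (K : Fin q → Fin n), HasWeight w (q * s) (aProd p V K) := fun {q} K => by
    induction q with
    | zero =>
      rw [aProd_zero, Nat.cast_zero, zero_mul]
      exact HasWeight.one w
    | succ q ih =>
      rw [← Fin.cons_self_tail K, aProd_cons, Nat.cast_succ, add_mul, one_mul, add_comm]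
      refine HasWeight.mul ?_ (ih _)
      rw [← ha (K 0)]
      exact HasWeight.gen w _
  refine HasWeight.sum fun K _ => ?_
  have := (hasWeight_ofBase (p := p) hx (f K)).mul (key K)
  rwa [zero_add] at this

/-- The three conditions say that the terms `a z`, `y a a` and `a^{p+1}` of `Θ` have the same
weight. They are used for the form weight, all `0`, and for the internal degree, with common value
`p + 1`. -/
theorem hasWeight_theta (hx : ∀ i, w ((0, i), false) = 0) (ha : ∀ i, w ((1, i), false) = s)
    (hy : ∀ i, w ((2, i), false) = t) (hz : ∀ i, w ((3, i), false) = u)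
    (h1 : s + u = k) (h2 : t + 2 * s = k) (h3 : (p + 1) * s = k) :
    HasWeight w k (theta P R) := by
  have hb : HasWeight w (2 * s) (biv p P) := by
    have := (hasWeight_aSum (p := p) hx ha P).smul (2⁻¹ : ℝ)
    rwa [Nat.cast_two] at this
  refine ((HasWeight.sum fun j _ => ?_).sub ((HasWeight.sum fun j _ => ?_).smul _)).add
    (HasWeight.smul _ ?_)
  · have := (hb.pd (1, j)).mul (HasWeight.gen w ((3, j), false))
    rw [ha, hz, show 2 * s - s + u = k by linarith] at this
    exact this
  · have := (HasWeight.gen w ((2, j), false)).mul (hb.pd (0, j))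
    rw [hx, hy, show t + (2 * s - 0) = k by linarith] at this
    exact this
  · have := hasWeight_aSum (p := p) hx ha R
    rwa [Nat.cast_succ, h3] at this

end Weights

theorem isVectorField_hamField : IsVectorField (hamField P R) := fun c => by
  refine isForm_iff.2 ?_
  have h : HasWeight formWeight 0 (theta P R) := hasWeight_theta P R (s := 0) (t := 0) (u := 0)
    (fun i => by simp [formWeight]) (fun i => by simp [formWeight])
    (fun i => by simp [formWeight]) (fun i => by simp [formWeight]) (by simp) (by simp) (by simp)
  have h2 := (h.pd (conj c)).smul (eta p c)
  rw [show formWeight (conj c, false) = 0 by simp [formWeight], sub_zero] at h2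
  rw [Nat.cast_zero]
  exact h2

/-- `Θ` has degree `p + 1`, and the conjugate of `ξ^c` has degree `p - deg c`, so the derivative has
degree `deg c + 1`. -/
theorem hasDegree_hamField (hp : 1 ≤ p) (c : Idx n) :
    HasDegree (deg n p c + 1) (hamField P R c) := by
  refine hasDegree_iff.2 ?_
  have h : HasWeight (degWeight (deg n p)) (p + 1) (theta P R) :=
    hasWeight_theta P R (s := 1) (t := p - 1) (u := p)
    (fun i => by simp [degWeight, deg]) (fun i => by simp [degWeight, deg])
    (fun i => by simp [degWeight, deg, Nat.cast_sub hp]) (fun i => by simp [degWeight, deg])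
    (by ring) (by ring) (by ring)
  have h2 := (h.pd (conj c)).smul (eta p c)
  have e : (p + 1 : ℝ) - degWeight (deg n p) (conj c, false) = ((deg n p c + 1 : ℕ) : ℝ) := by
    have := congrArg (Nat.cast (R := ℝ)) (deg_conj_add hp c)
    push_cast at this ⊢
    simp only [degWeight]
    linarith
  rwa [e] at h2

end ShiftedCotangent

/-! ### From `Q² = 0` to Schouten brackets. -/

namespace ShiftedCotangent

open GradedDomain

variable {n p : ℕ} {V : TopologicalSpace.Opens (EuclideanSpace ℝ (Fin n))}

/-! ### The Schouten bracket with a bivector -/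

/-- The index of the conjugate coordinate in `T^*[1]M`. -/
def baseConj (c : Idx n) : Idx n := (![1, 0, 2, 3] c.1, c.2)

/-- The signs in the Hamiltonian equations in `T^*[1]M`. -/
def baseEta (c : Idx n) : ℝ := ![-1, -1, 0, 0] c.1

variable (p) in
/-- The Hamiltonian vector field of a bivector on `T^*[1]M`. -/
def bivField (P : (Fin 2 → Fin n) → SmoothFun V) (c : Idx n) : Form (body p V) :=
  baseEta c • pd (body p V) (baseConj c) (biv p P)

/-- The field lives on `T^*[1]M` but is extended by zero in the directions `y`, `z`. Those indices
are fixed by `baseConj` with sign `0`, where `parity_star` imposes nothing. -/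
theorem isHamiltonian_bivField (P : (Fin 2 → Fin n) → SmoothFun V) :
    IsHamiltonian baseConj baseEta 2 (biv p P) (bivField p P) where
  star_star := by
    rintro ⟨k, i⟩
    fin_cases k <;> rfl
  parity_star := by
    rintro ⟨k, i⟩ h
    fin_cases k <;> simp [baseEta, deg, baseConj] at h ⊢
    decide
  sign := by
    rintro ⟨k, i⟩
    fin_cases k <;> simp [baseEta, baseConj]
  par := par_biv P
  field _ := rfl

theorem applyField_bivField (P : (Fin 2 → Fin n) → SmoothFun V) (f : Form (body p V)) :
    applyField (bivField p P) f = ∑ i, (bivField p P (0, i) * pd (body p V) (0, i) f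
      + bivField p P (1, i) * pd (body p V) (1, i) f) := by
  rw [applyField, Fintype.sum_prod_type, Fin.sum_univ_four, Finset.sum_add_distrib, add_assoc,
    add_eq_left]
  have h2 : ∀ i, bivField p P (2, i) = 0 := fun i => zero_smul ℝ _
  have h3 : ∀ i, bivField p P (3, i) = 0 := fun i => zero_smul ℝ _
  simp only [h2, h3, zero_mul, Finset.sum_const_zero, add_zero]

variable (P : (Fin 2 → Fin n) → SmoothFun V)

theorem bivField_x (hP : IsAntisymm P) (i : Fin n) :
    bivField p P (0, i) = ∑ k, ofBase p (P ![k, i]) * a p V k := by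
  have h : bivField p P (0, i) = (-1 : ℝ) • pd (body p V) (1, i) (biv p P) := rfl
  rw [h, pd_a_biv i hP, aSum_one, Finset.smul_sum]
  refine Finset.sum_congr rfl fun k _ => ?_
  have h2 : P (Fin.cons i ![k]) = - P ![k, i] := hP.swap i k ![]
  rw [h2, ofBase_neg, neg_one_smul, neg_mul, neg_neg]

theorem bivField_a (i : Fin n) :
    bivField p P (1, i) = -(2⁻¹ : ℝ) • aSum fun K => coordD i (P K) := by
  have h : bivField p P (1, i) = (-1 : ℝ) • pd (body p V) (0, i) (biv p P) := rfl
  rw [h, pd_x_biv, smul_smul, neg_one_mul]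

theorem aSum_succ' {q : ℕ} (f : (Fin (q + 1) → Fin n) → SmoothFun V) :
    aSum (p := p) f = ∑ j, aSum (fun J => f (Fin.snoc J j)) * a p V j := by
  rw [aSum, sum_snoc]
  refine Finset.sum_congr rfl fun j _ => ?_
  rw [aSum, Finset.sum_mul]
  refine Finset.sum_congr rfl fun J _ => ?_
  rw [aProd_snoc, ← mul_assoc]

theorem aSum_mul_left {q : ℕ} (f : Fin n → SmoothFun V) (g : (Fin q → Fin n) → SmoothFun V) :
    aSum (p := p) (fun K : Fin (q + 1) → Fin n => f (K 0) * g fun r => K r.succ)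
      = (∑ k, ofBase p (f k) * a p V k) * aSum g := by
  rw [aSum_succ, Finset.sum_mul]
  refine Finset.sum_congr rfl fun k _ => ?_
  simp only [Fin.cons_zero, Fin.cons_succ, aSum, ofBase_mul, Finset.mul_sum]
  refine Finset.sum_congr rfl fun J _ => ?_
  simp only [← mul_assoc]
  rw [ofBase_mul_comm (f k) (a p V k)]

/-- The factor `f` occupies the last two indices; being quadratic in the `a`'s it is even and moves
to the front without sign. -/
theorem aSum_mul_right {q : ℕ} (g : (Fin q → Fin n) → SmoothFun V)
    (f : (Fin 2 → Fin n) → SmoothFun V) :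
    aSum (p := p) (fun K : Fin (q + 2) → Fin n => (g fun r => K r.castSucc.castSucc) *
      f ![K (Fin.last q).castSucc, K (Fin.last (q + 1))]) = aSum f * aSum g := by
  rw [(par_aSum f).mul_comm, twist_even (by simp), aSum_two, aSum_succ', Finset.sum_comm,
    Finset.mul_sum]
  refine Finset.sum_congr rfl fun k _ => ?_
  rw [aSum_succ', Finset.mul_sum, Finset.sum_mul]
  refine Finset.sum_congr rfl fun j _ => ?_
  simp only [Fin.snoc_castSucc, Fin.snoc_last, aSum, ofBase_mul, Finset.sum_mul]
  refine Finset.sum_congr rfl fun J _ => ?_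
  simp only [← mul_assoc]
  rw [mul_assoc (ofBase p _) (ofBase p _) (aProd p V J), ofBase_mul_comm (f _) (aProd p V J),
    ← mul_assoc]

/-- The Schouten bracket before the antisymmetrization. -/
def preSchouten {q : ℕ} (R : (Fin (q + 1) → Fin n) → SmoothFun V) (K : Fin (q + 2) → Fin n) :
    SmoothFun V :=
  ∑ i : Fin n,
      ((q + 2 : ℝ) • (P ![K 0, i] * coordD i (R fun r => K r.succ))
        - ((q + 1) * (q + 2) / 2 : ℝ) •
          (R (Fin.cons i fun r : Fin q => K r.castSucc.castSucc) *
            coordD i (P ![K (Fin.last q).castSucc, K (Fin.last (q + 1))])))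

/-- The term `Π ∂R` comes from `D(x^i) ∂/∂x^i`, the term `R ∂Π` from `D(a_i) ∂/∂a_i`. In the latter,
`D(a_i)` carries `-1/2` and the derivative of `R` carries `q + 1`, which explains the weights of the
bracket. -/
theorem aSum_preSchouten (hP : IsAntisymm P) {q : ℕ} {R : (Fin (q + 1) → Fin n) → SmoothFun V}
    (hR : IsAntisymm R) :
    aSum (p := p) (preSchouten P R) = (q + 2 : ℝ) • applyField (bivField p P) (aSum R) := by
  have e : preSchouten P R = fun K => ∑ i : Fin n,
      ((q + 2 : ℝ) • (P ![K 0, i] * coordD i (R fun r => K r.succ))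
        - ((q + 1) * (q + 2) / 2 : ℝ) •
          (R (Fin.cons i fun r : Fin q => K r.castSucc.castSucc) *
            coordD i (P ![K (Fin.last q).castSucc, K (Fin.last (q + 1))]))) := rfl
  rw [e, aSum_sum, applyField_bivField, Finset.smul_sum]
  refine Finset.sum_congr rfl fun i _ => ?_
  rw [aSum_sub, aSum_smul, aSum_smul,
    aSum_mul_left (fun k => P ![k, i]) (fun J => coordD i (R J)),
    aSum_mul_right (fun J => R (Fin.cons i J)) (fun K => coordD i (P K)), bivField_x P hP,
    bivField_a, pd_x_aSum, pd_a_aSum hR, smul_add, sub_eq_add_neg, ← neg_smul, smul_mul_smul_comm,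
    smul_smul]
  congr 2
  ring

theorem antisymm_eq_zero_iff (p : ℕ) {q : ℕ} (f : (Fin q → Fin n) → SmoothFun V) :
    (∀ K, antisymm f K = 0) ↔ aSum (p := p) f = 0 := by
  rw [← aSum_antisymm]
  constructor
  · intro h
    rw [show antisymm f = fun _ => 0 from funext h, aSum_zero]
  · exact eq_zero_of_aSum_eq_zero (isAntisymm_antisymm f)

theorem antisymm_preSchouten_eq_zero_iff (p : ℕ) (hP : IsAntisymm P) {q : ℕ}
    {R : (Fin (q + 1) → Fin n) → SmoothFun V} (hR : IsAntisymm R) :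
    (∀ K, antisymm (preSchouten P R) K = 0) ↔ applyField (bivField p P) (aSum R) = 0 := by
  rw [antisymm_eq_zero_iff p, aSum_preSchouten P hP hR]
  constructor
  · exact eq_zero_of_smul_eq_zero (by positivity)
  · intro h
    rw [h, smul_zero]

/-! ### The square of the Hamiltonian vector field -/

variable {R : (Fin (p + 1) → Fin n) → SmoothFun V}

/-- The `x` and `a` components of the field of `Θ` are those of the field of `π`; the `z` and `y`
components contribute the same again by `mul_pd_star`. -/
theorem applyField_hamField_theta (hp : 1 ≤ p) : applyField (hamField P R) (theta P R)
    = (2 : ℝ) • applyField (bivField p P) (theta P R) := by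
  have h := isHamiltonian_hamField hp P R
  have h0 : ∀ i, hamField P R (0, i) = bivField p P (0, i) := fun i => by
    have e1 : hamField P R (0, i) = -(-1 : ℝ) ^ p • pd (body p V) (3, i) (theta P R) := rfl
    have e2 : bivField p P (0, i) = (-1 : ℝ) • pd (body p V) (1, i) (biv p P) := rfl
    rw [e1, e2, pd_z_theta, smul_smul, neg_mul, neg_one_pow_mul_self]
  have h1 : ∀ i, hamField P R (1, i) = bivField p P (1, i) := fun i => by
    have e1 : hamField P R (1, i) = (-1 : ℝ) ^ p • pd (body p V) (2, i) (theta P R) := rfl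
    have e2 : bivField p P (1, i) = (-1 : ℝ) • pd (body p V) (0, i) (biv p P) := rfl
    rw [e1, e2, pd_y_theta, smul_neg, smul_smul, neg_one_pow_mul_self, neg_smul]
  have h2 : ∀ i, hamField P R (2, i) * pd (body p V) (2, i) (theta P R)
      = hamField P R (1, i) * pd (body p V) (1, i) (theta P R) := fun i => h.mul_pd_star (1, i)
  have h3 : ∀ i, hamField P R (3, i) * pd (body p V) (3, i) (theta P R)
      = hamField P R (0, i) * pd (body p V) (0, i) (theta P R) := fun i => h.mul_pd_star (0, i)
  rw [applyField_bivField, applyField, Fintype.sum_prod_type, Fin.sum_univ_four,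
    Finset.sum_add_distrib, two_smul]
  simp only [h2, h3, h0, h1]
  abel

/-- The field `D` of `π` kills `y` and `z`, and `D(∂_e π) = ± ½ ∂_e(Dπ)` by the Hamiltonian identity
for `π`. So `DΘ` has the same shape as `Θ`, with `Dπ` in place of `π`. -/
theorem applyField_bivField_theta (hp : 1 ≤ p) : applyField (bivField p P) (theta P R)
    = -(2⁻¹ : ℝ) • ∑ j, pd (body p V) (1, j) (applyField (bivField p P) (biv p P)) * z p V j
      + (2⁻¹ : ℝ) • ∑ j, y p V j * pd (body p V) (0, j) (applyField (bivField p P) (biv p P))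
      + ((-1 : ℝ) ^ p / (p + 1).factorial) • applyField (bivField p P) (aSum R) := by
  have h := isHamiltonian_bivField (p := p) P
  have e1 : ∀ j, applyField (bivField p P) (pd (body p V) (1, j) (biv p P) * z p V j)
      = -(2⁻¹ : ℝ) • (pd (body p V) (1, j) (applyField (bivField p P) (biv p P)) * z p V j) :=
    fun j => by
      have hz : applyField (bivField p P) (z p V j) = 0 :=
        (applyField_coord _ _).trans (zero_smul ℝ _)
      have d : deg n p (1, j) = 1 := rfl
      rw [applyField_mul h.par_field ((par_biv P).pd _), hz, mul_zero, smul_zero, add_zero,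
        h.pd_applyField, d, smul_mul_assoc, smul_smul]
      norm_num
  have e2 : ∀ j, applyField (bivField p P) (y p V j * pd (body p V) (0, j) (biv p P))
      = ((-1 : ℝ) ^ (p - 1) * 2⁻¹) •
        (y p V j * pd (body p V) (0, j) (applyField (bivField p P) (biv p P))) :=
    fun j => by
      have hy : applyField (bivField p P) (y p V j) = 0 :=
        (applyField_coord _ _).trans (zero_smul ℝ _)
      have d : deg n p (0, j) = 0 := rfl
      rw [applyField_mul h.par_field (par_y j), hy, zero_mul, zero_add,
        h.pd_applyField, d, mul_smul_comm, smul_smul]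
      congr 1
      ring
  rw [theta, applyField_add, applyField_sub, applyField_smul, applyField_smul, applyField_sum,
    applyField_sum, Finset.sum_congr rfl fun j _ => e1 j, Finset.sum_congr rfl fun j _ => e2 j,
    ← Finset.smul_sum, ← Finset.smul_sum, smul_smul, ← mul_assoc,
    neg_one_pow_mul_pred hp, neg_one_mul, neg_smul (2⁻¹ : ℝ)
      (∑ j, y p V j * _), sub_neg_eq_add]

/-- Only the `Dπ` part of `DΘ` involves `y` and `z`, so `∂/∂z` isolates it; what remains is a
function of `x` and `a` alone. -/
theorem applyField_bivField_theta_eq_zero_iff (hp : 1 ≤ p) (hP : IsAntisymm P)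
    (hR : IsAntisymm R) :
    (∀ c, pd (body p V) c (applyField (bivField p P) (theta P R)) = 0) ↔
      applyField (bivField p P) (aSum P) = 0 ∧ applyField (bivField p P) (aSum R) = 0 := by
  -- Rewriting with antisymmetric coefficients makes the vanishing detectable by `∂/∂a`.
  have hex : ∀ {q : ℕ} {S : (Fin (q + 1) → Fin n) → SmoothFun V}, IsAntisymm S →
      applyField (bivField p P) (aSum S)
        = aSum fun K => (q + 2 : ℝ)⁻¹ • antisymm (preSchouten P S) K := fun {q S} hS => by
    have : (q + 2 : ℝ) ≠ 0 := by positivity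
    rw [aSum_smul, aSum_antisymm, aSum_preSchouten P hP hS, inv_smul_smul₀ this]
  have hanti : ∀ {q : ℕ} {S : (Fin (q + 1) → Fin n) → SmoothFun V},
      IsAntisymm fun K => (q + 2 : ℝ)⁻¹ • antisymm (preSchouten P S) K := fun {q S} K r s hrs => by
    simp only [isAntisymm_antisymm _ K r s hrs, smul_neg]
  have hbiv : applyField (bivField p P) (biv p P)
      = (2⁻¹ : ℝ) • applyField (bivField p P) (aSum P) := by rw [biv, applyField_smul]
  rw [applyField_bivField_theta P hp, hbiv]
  constructor
  · intro h
    have h1 : applyField (bivField p P) (aSum P) = 0 := by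
      rw [hex hP]
      refine aSum_eq_zero_of_pd_a hanti fun i => ?_
      -- The derivative in `z_i` leaves a nonzero multiple of `∂(Dπ)/∂a_i`, and `Dπ` is cubic in the
      -- `a`'s.
      have h3 := h (3, i)
      rw [hex hP, hex hR] at h3
      set G := aSum (p := p) fun K => ((1 : ℕ) + 2 : ℝ)⁻¹ • antisymm (preSchouten P P) K with hG
      have hG3 : pd (body p V) (3, i) G = 0 := pd_aSum_eq_zero (by simp) (by simp) _
      have hGp : Par 3 G := par_aSum _
      have t1 : ∀ j, pd (body p V) (3, i) (pd (body p V) (1, j) ((2⁻¹ : ℝ) • G) * z p V j)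
          = if i = j then (-1 : ℝ) ^ (deg n p (3, i) * (deg n p (1, j) + 3)) •
            (2⁻¹ : ℝ) • pd (body p V) (1, j) G else 0 := fun j => by
        rw [map_smul, smul_mul_assoc, map_smul, (hGp.pd _).pd_mul, pd_pd_eq_zero hG3, zero_mul,
          zero_add, pd_z]
        by_cases hij : i = j
        · rw [if_pos (by rw [hij]), if_pos hij, mul_one, smul_comm]
        · rw [if_neg (by simpa using hij), if_neg hij, mul_zero, smul_zero, smul_zero]
      have t2 : ∀ j, pd (body p V) (3, i) (y p V j * pd (body p V) (0, j) ((2⁻¹ : ℝ) • G)) = 0 :=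
        fun j => by
          rw [(par_y j).pd_mul, pd_y, if_neg (by simp), map_smul, map_smul, pd_pd_eq_zero hG3,
            smul_zero, mul_zero, zero_mul, smul_zero, add_zero]
      rw [map_add, map_add, map_smul, map_smul, map_smul, map_sum, map_sum,
        Finset.sum_congr rfl fun j _ => t1 j, Finset.sum_congr rfl fun j _ => t2 j,
        Finset.sum_const_zero, pd_aSum_eq_zero (by simp) (by simp), smul_zero, smul_zero, add_zero,
        add_zero, Finset.sum_ite_eq, if_pos (Finset.mem_univ i)] at h3
      exact eq_zero_of_smul_eq_zero (by norm_num) (eq_zero_of_smul_eq_zero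
        (pow_ne_zero _ (by norm_num)) (eq_zero_of_smul_eq_zero (by norm_num) h3))
    refine ⟨h1, ?_⟩
    rw [hex hR]
    refine aSum_eq_zero_of_pd_a hanti fun i => ?_
    -- With `Dπ = 0` only the `R`-term is left; it has degree `p + 2` in the `a`'s, so its
    -- `a`-derivatives determine it.
    have h3 := h (1, i)
    simp only [h1, smul_zero, map_zero, zero_mul, mul_zero, Finset.sum_const_zero, zero_add,
      map_smul] at h3
    rw [← hex hR]
    exact eq_zero_of_smul_eq_zero (div_ne_zero (pow_ne_zero _ (by norm_num)) (by positivity)) h3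
  · rintro ⟨h1, h2⟩ c
    simp only [h1, h2, smul_zero, map_zero, zero_mul, mul_zero, Finset.sum_const_zero, zero_add]

/-- `Q²` is a first-order operator, so it vanishes once it vanishes on coordinates; there it is
given, up to nonzero factors, by the derivatives of `QΘ = 2 DΘ`. -/
theorem hamField_sq_eq_zero_iff (hp : 1 ≤ p) (hP : IsAntisymm P) (hR : IsAntisymm R) :
    (∀ f, IsForm 0 f → applyField (hamField P R) (applyField (hamField P R) f) = 0) ↔
      (∀ K, antisymm (preSchouten P P) K = 0) ∧ ∀ K, antisymm (preSchouten P R) K = 0 := by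
  have h := isHamiltonian_hamField hp P R
  rw [antisymm_preSchouten_eq_zero_iff P p hP hP, antisymm_preSchouten_eq_zero_iff P p hP hR,
    ← applyField_bivField_theta_eq_zero_iff P hp hP hR]
  constructor
  · intro hQ c
    have h1 := hQ _ (isForm_zero_coord (conj c))
    have h2 := h.pd_star_applyField (conj c)
    rw [applyField_coord] at h1
    rw [h1, smul_zero, conj_conj, applyField_hamField_theta P hp, map_smul] at h2
    exact eq_zero_of_smul_eq_zero two_ne_zero (eq_zero_of_smul_eq_zero (eta_ne_zero _) h2)
  · intro hS f _
    rw [applyField_applyField h.par_field]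
    refine Finset.sum_eq_zero fun c _ => ?_
    have h2 := h.pd_star_applyField c
    rw [applyField_hamField_theta P hp, map_smul, hS, smul_zero, smul_zero] at h2
    rw [eq_zero_of_smul_eq_zero (mul_ne_zero two_ne_zero (pow_ne_zero _ (by norm_num))) h2.symm,
      zero_mul]

end ShiftedCotangent

/-! ### The vector field `Q` of the theorem in Hamiltonian form. -/

namespace ShiftedCotangent

open GradedDomain

variable {n p : ℕ} {M : Type*} [TopologicalSpace M]
  [ChartedSpace (EuclideanSpace ℝ (Fin n)) M]
  (P : MultivectorField n M 2) (R : MultivectorField n M (p + 1)) (H : DifferentialForm n M (p + 2))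
  (e : SmoothChart n M)

theorem isAntisymm_multivector {k : ℕ} (S : MultivectorField n M k) : IsAntisymm (S.comp e) :=
  fun K r s hrs => by
    ext u
    exact (S.toFun (e.1.symm u)).map_swap (fun t => e.covec u (K t)) hrs

theorem isAntisymm_differentialForm {k : ℕ} (S : DifferentialForm n M k) :
    IsAntisymm (S.comp e) := fun K r s hrs => by
  ext u
  exact (S.toFun (e.1.symm u)).map_swap (fun t => e.vec u (K t)) hrs

/-- The components `Π^{k₁l₁} ⋯ Π^{k_{p+1}l_{p+1}} H_{i l₁ … l_{p+1}}` of the twist term. -/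
def twistCoeff (i : Fin n) (K : Fin (p + 1) → Fin n) : SmoothFun e.image :=
  ∑ L : Fin (p + 1) → Fin n, (∏ r, P.comp e ![K r, L r]) * H.comp e (Fin.cons i L)

/-- Swapping two indices of `K` can be undone in the product by the same swap of the summation
indices `L`, and there `H` supplies the sign. -/
theorem isAntisymm_twistCoeff (i : Fin n) : IsAntisymm (twistCoeff P H e i) := fun K r s hrs => by
  rw [twistCoeff, twistCoeff, ← Finset.sum_neg_distrib,
    ← Equiv.sum_comp (Equiv.arrowCongr (Equiv.swap r s) (Equiv.refl (Fin n)))]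
  refine Finset.sum_congr rfl fun L _ => ?_
  have e1 : (Equiv.arrowCongr (Equiv.swap r s) (Equiv.refl (Fin n))) L = L ∘ Equiv.swap r s := by
    funext t
    simp [Equiv.arrowCongr]
  have e2 : H.comp e (Fin.cons i (L ∘ Equiv.swap r s)) = - H.comp e (Fin.cons i L) :=
    ((isAntisymm_differentialForm e H).cons i) L r s hrs
  have e3 : ∏ t, P.comp e ![(K ∘ Equiv.swap r s) t, (L ∘ Equiv.swap r s) t]
      = ∏ t, P.comp e ![K t, L t] :=
    Equiv.prod_comp (Equiv.swap r s) fun t => P.comp e ![K t, L t]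
  rw [e1, e2, e3]
  ring

theorem aSum_fCoeff (i : Fin n) : aSum (p := p) (fCoeff P R H e i)
    = aSum (fun K => coordD i (R.comp e K)) + aSum (twistCoeff P H e i) :=
  aSum_add (fun K => coordD i (R.comp e K)) (twistCoeff P H e i)

theorem comp_cons_swap (i k : Fin n) : P.comp e ![k, i] = - P.comp e ![i, k] :=
  (isAntisymm_multivector e P).swap k i ![]

theorem pd_a_biv_comp (j : Fin n) : pd (body p e.image) (1, j) (biv p (P.comp e))
    = ∑ k, ofBase p (P.comp e ![j, k]) * a p e.image k := by
  rw [pd_a_biv j (isAntisymm_multivector e P), aSum_one]; rfl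

theorem pd_a_pd_x_biv_comp (i j : Fin n) :
    pd (body p e.image) (1, i) (pd (body p e.image) (0, j) (biv p (P.comp e)))
      = ∑ k, ofBase p (coordD j (P.comp e ![i, k])) * a p e.image k := by
  rw [pd_x_biv, map_smul, pd_a_aSum ((isAntisymm_multivector e P).coordD j), smul_smul, aSum_one]
  norm_num

theorem pd_x_pd_a_biv_comp (i j : Fin n) :
    pd (body p e.image) (0, i) (pd (body p e.image) (1, j) (biv p (P.comp e)))
      = ∑ k, ofBase p (coordD i (P.comp e ![j, k])) * a p e.image k := by
  rw [pd_a_biv j (isAntisymm_multivector e P), pd_x_aSum, aSum_one]; rfl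

theorem pd_x_pd_x_biv_comp (i j : Fin n) :
    pd (body p e.image) (0, i) (pd (body p e.image) (0, j) (biv p (P.comp e)))
      = (2⁻¹ : ℝ) • ∑ k, ∑ l, ofBase p (coordD i (coordD j (P.comp e ![k, l])))
        * a p e.image k * a p e.image l := by
  rw [pd_x_biv, map_smul, pd_x_aSum, aSum_two]

theorem pd_a_pd_a_biv_comp (i j : Fin n) :
    pd (body p e.image) (1, i) (pd (body p e.image) (1, j) (biv p (P.comp e)))
      = ofBase p (P.comp e ![j, i]) := by
  have hP := isAntisymm_multivector e P
  rw [pd_a_biv j hP, pd_a_aSum (hP.cons j), aSum_zero_index, Nat.cast_zero, zero_add (1 : ℝ),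
    one_smul]; rfl

theorem Qx_eq (i : Fin n) : Qx P e i
    = (-(-1 : ℝ) ^ p) • pd (body p e.image) (3, i) (theta (P.comp e) (R.comp e)) := by
  rw [pd_z_theta, smul_smul, neg_mul, neg_one_pow_mul_self, pd_a_biv_comp, Qx, Finset.smul_sum]
  refine Finset.sum_congr rfl fun j _ => ?_
  rw [comp_cons_swap, ofBase_neg, neg_one_smul, neg_mul]

theorem Qa_eq (i : Fin n) : Qa P e i
    = (-1 : ℝ) ^ p • pd (body p e.image) (2, i) (theta (P.comp e) (R.comp e)) := by
  rw [pd_y_theta, smul_neg, smul_smul, neg_one_pow_mul_self, one_smul, pd_x_biv, aSum_two, Qa,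
    neg_smul]

theorem Qy_eq (hp : 1 ≤ p) (i : Fin n) : Qy P R e i
    = (-1 : ℝ) ^ p • pd (body p e.image) (1, i) (theta (P.comp e) (R.comp e)) := by
  rw [pd_a_theta i _ (isAntisymm_multivector e R), neg_one_pow_mul_pred hp, Qy, smul_add, smul_sub,
    smul_smul, smul_smul]
  refine congrArg₂ (· + ·) (congrArg₂ (· - ·) ?_ ?_) ?_
  · refine congrArg _ (Finset.sum_congr rfl fun j _ => ?_)
    rw [pd_a_pd_a_biv_comp]
  · rw [mul_neg_one, Finset.smul_sum]
    refine Finset.sum_congr rfl fun j _ => ?_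
    rw [pd_a_pd_x_biv_comp, Finset.mul_sum, Finset.smul_sum]
    refine Finset.sum_congr rfl fun k _ => ?_
    -- Exchanging `a_k` and `y^j` costs `(-1)^{p-1} = -(-1)^p`, which is the factor in front.
    rw [← mul_assoc, ← ofBase_mul_comm, mul_assoc, mul_assoc,
      (par_a (p := p) k).mul_comm' (par_y j), mul_smul_comm, one_mul]
    congr 1
    linear_combination (-1 : ℝ) ^ p * neg_one_pow_mul_pred hp
      - (-1 : ℝ) ^ (p - 1) * neg_one_pow_mul_self p
  · rw [div_eq_mul_inv, ← mul_assoc, neg_one_pow_mul_self, one_mul]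
    rfl

theorem Qz_eq (i : Fin n) : Qz P R H e i
    = pd (body p e.image) (0, i) (theta (P.comp e) (R.comp e))
      + ((-1 : ℝ) ^ p / (p + 1).factorial) • aSum (twistCoeff P H e i) := by
  have h := aSum_fCoeff P R H e i
  rw [aSum] at h
  rw [pd_x_theta, Qz, h, smul_add, ← add_assoc]
  refine congrArg (· + _) (congrArg (· + _) (congrArg₂ (· - ·) ?_ ?_))
  · refine Finset.sum_congr rfl fun j _ => ?_
    rw [pd_x_pd_a_biv_comp, Finset.sum_mul]
  · rw [Finset.smul_sum, Finset.smul_sum]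
    refine Finset.sum_congr rfl fun j _ => ?_
    rw [pd_x_pd_x_biv_comp, mul_smul_comm, smul_smul, ← div_eq_mul_inv, Finset.mul_sum]
    refine congrArg _ (Finset.sum_congr rfl fun k _ => ?_)
    rw [Finset.mul_sum]
    refine Finset.sum_congr rfl fun l _ => ?_
    rw [ofBase_mul_comm, mul_assoc, mul_assoc, mul_assoc]

/-- `H` enters only through `f_i`, hence only through the `z_i` components; all else is the
Hamiltonian field of `Θ`. -/
theorem Q_eq (hp : 1 ≤ p) : Q P R H e = twistedField (P.comp e) (R.comp e) (twistCoeff P H e) := by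
  funext c
  obtain ⟨k, i⟩ := c
  fin_cases k
  · exact (Qx_eq P R e i).trans (add_zero _).symm
  · exact (Qa_eq P R e i).trans (add_zero _).symm
  · exact (Qy_eq P R e hp i).trans (add_zero _).symm
  · exact (Qz_eq P R H e i).trans (congrArg (· + _) (one_smul ℝ _).symm)

end ShiftedCotangent

/-! ### Coordinate frames of a chart. -/

namespace SmoothChart

variable {n : ℕ} {M : Type*} [TopologicalSpace M] [ChartedSpace (EuclideanSpace ℝ (Fin n)) M]
  [IsManifold (𝓡 n) ∞ M] (e : SmoothChart n M)

theorem mdifferentiable : e.1.MDifferentiable (𝓡 n) (𝓡 n) :=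
  ⟨(contMDiffOn_of_mem_maximalAtlas e.2).mdifferentiableOn (by simp),
    (contMDiffOn_symm_of_mem_maximalAtlas e.2).mdifferentiableOn (by simp)⟩

/-- The expansion of a tangent vector in the coordinate vectors. -/
theorem eq_sum_vec {u : EuclideanSpace ℝ (Fin n)} (hu : u ∈ e.image)
    (v : TangentSpace (𝓡 n) (e.1.symm u)) : v = ∑ i, e.covec u i v • e.vec u i := by
  have h := e.mdifferentiable.symm_comp_deriv (e.1.map_target hu)
  rw [e.1.right_inv hu] at h
  have h2 := congrArg (fun L => L v) h
  -- Tangent spaces of the model are copies of `ℝⁿ`, so the image of `v` can be expanded in the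
  -- standard basis and carried back.
  let A : EuclideanSpace ℝ (Fin n) := mfderiv (𝓡 n) (𝓡 n) e.1 (e.1.symm u) v
  let B : EuclideanSpace ℝ (Fin n) →L[ℝ] TangentSpace (𝓡 n) (e.1.symm u) :=
    mfderiv (𝓡 n) (𝓡 n) e.1.symm u
  have hA : A = ∑ i, A i • EuclideanSpace.single i (1 : ℝ) := by
    ext k
    simp [Pi.single_apply]
  have h3 : B A = v := h2
  rw [← h3]
  conv_lhs => rw [hA, map_sum]
  refine Finset.sum_congr rfl fun i _ => ?_
  rw [map_smul, h3]
  rfl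

theorem eq_sum_covec {u : EuclideanSpace ℝ (Fin n)} (hu : u ∈ e.image)
    (β : TangentSpace (𝓡 n) (e.1.symm u) →L[ℝ] ℝ) : β = ∑ i, β (e.vec u i) • e.covec u i := by
  ext v
  conv_lhs => rw [e.eq_sum_vec hu v, map_sum]
  rw [sum_apply]
  refine Finset.sum_congr rfl fun i _ => ?_
  rw [map_smul, smul_apply, smul_eq_mul, smul_eq_mul, mul_comm]

end SmoothChart

/-! ### The twist term -/

section Twist

variable {n p : ℕ} {M : Type*} [TopologicalSpace M]
  [ChartedSpace (EuclideanSpace ℝ (Fin n)) M]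
  (P : MultivectorField n M 2) (R : MultivectorField n M (p + 1)) (H : DifferentialForm n M (p + 2))

/-- The bilinear form on the cotangent space given by a bivector. -/
def MultivectorField.pairing (m : M) : (TangentSpace (𝓡 n) m →L[ℝ] ℝ) →ₗ[ℝ]
    (TangentSpace (𝓡 n) m →L[ℝ] ℝ) →ₗ[ℝ] ℝ :=
  LinearMap.mk₂ ℝ (fun α β => P.toFun m ![α, β])
    (fun α α' β => (P.toFun m).map_vecCons_add ![β] α α')
    (fun r α β => (P.toFun m).map_vecCons_smul ![β] r α)
    (fun α β β' => ((P.toFun m).curryLeft α).map_vecCons_add ![] β β')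
    (fun r α β => ((P.toFun m).curryLeft α).map_vecCons_smul ![] r β)

theorem MultivectorField.pairing_apply {m : M} (α β : TangentSpace (𝓡 n) m →L[ℝ] ℝ) :
    P.pairing m α β = P.toFun m ![α, β] := rfl

variable (e : SmoothChart n M)

/-- The contraction of the bivector with a covector, in the coordinates of a chart. -/
def MultivectorField.sharp (u : EuclideanSpace ℝ (Fin n))
    (α : TangentSpace (𝓡 n) (e.1.symm u) →L[ℝ] ℝ) : TangentSpace (𝓡 n) (e.1.symm u) :=
  ∑ l, P.pairing _ α (e.covec u l) • e.vec u l

variable [IsManifold (𝓡 n) ∞ M] {e} {u : EuclideanSpace ℝ (Fin n)}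

theorem MultivectorField.apply_sharp (hu : u ∈ e.image)
    (α β : TangentSpace (𝓡 n) (e.1.symm u) →L[ℝ] ℝ) :
    β (P.sharp e u α) = P.toFun _ ![α, β] := by
  rw [← P.pairing_apply, sharp, map_sum]
  conv_rhs => rw [e.eq_sum_covec hu β, map_sum]
  refine Finset.sum_congr rfl fun l _ => ?_
  rw [map_smul, map_smul, smul_eq_mul, smul_eq_mul, mul_comm]

/-- Coordinate covectors separate vectors, so the vectors `w r` in `TwistVanishes` are forced to be
`Π♯ α_r`. -/
theorem MultivectorField.eq_sharp (hu : u ∈ e.image)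
    {α : TangentSpace (𝓡 n) (e.1.symm u) →L[ℝ] ℝ} {w : TangentSpace (𝓡 n) (e.1.symm u)}
    (hw : ∀ β : TangentSpace (𝓡 n) (e.1.symm u) →L[ℝ] ℝ, β w = P.toFun _ ![α, β]) :
    w = P.sharp e u α := by
  rw [e.eq_sum_vec hu w, sharp]
  refine Finset.sum_congr rfl fun l _ => ?_
  rw [hw, P.pairing_apply]

theorem MultivectorField.sharp_eq_sum (hu : u ∈ e.image)
    (α : TangentSpace (𝓡 n) (e.1.symm u) →L[ℝ] ℝ) :
    P.sharp e u α = ∑ k, α (e.vec u k) • P.sharp e u (e.covec u k) := by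
  refine (P.eq_sharp hu fun β => ?_).symm
  rw [map_sum, ← P.pairing_apply]
  conv_rhs => rw [e.eq_sum_covec hu α, map_sum]
  rw [LinearMap.sum_apply]
  refine Finset.sum_congr rfl fun k _ => ?_
  rw [map_smul, P.apply_sharp hu, map_smul, LinearMap.smul_apply, P.pairing_apply]

/-- Expand `Π♯ dx^{k_r} = ∑_l Π^{k_r l} ∂_l` in every slot of the multilinear form `H`. -/
theorem ShiftedCotangent.twistCoeff_apply (hu : u ∈ e.image) (i : Fin n) (K : Fin (p + 1) → Fin n) :
    (ShiftedCotangent.twistCoeff P H e i K).1 ⟨u, hu⟩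
      = H.toFun _ (Fin.cons (e.vec u i) fun r => P.sharp e u (e.covec u (K r))) := by
  have h1 : H.toFun _ (Fin.cons (e.vec u i) fun r => P.sharp e u (e.covec u (K r)))
      = ((H.toFun (e.1.symm u)).curryLeft (e.vec u i)).toMultilinearMap
        (fun r => ∑ l, P.pairing _ (e.covec u (K r)) (e.covec u l) • e.vec u l) := rfl
  rw [h1, MultilinearMap.map_sum, ShiftedCotangent.twistCoeff, AddSubmonoidClass.coe_finsetSum,
    Finset.sum_apply]
  refine Finset.sum_congr rfl fun L _ => ?_
  rw [MultilinearMap.map_smul_univ, MulMemClass.coe_mul, Pi.mul_apply, smul_eq_mul,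
    SubmonoidClass.coe_finsetProd, Finset.prod_apply]
  refine congrArg₂ (· * ·) (Finset.prod_congr rfl fun r _ => ?_) ?_
  · refine congrArg (P.toFun (e.1.symm u)) (funext fun t => ?_)
    fin_cases t <;> rfl
  · refine congrArg (H.toFun (e.1.symm u)) (funext fun t => ?_)
    refine Fin.cases ?_ (fun t => ?_) t <;> rfl

/-- The condition is multilinear in `v` and the covectors, so testing on coordinate frames suffices.
This makes it independent of the chart. -/
theorem ShiftedCotangent.twistCoeff_eq_zero_iff (hu : u ∈ e.image) :
    (∀ (i : Fin n) (K : Fin (p + 1) → Fin n),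
      (ShiftedCotangent.twistCoeff P H e i K).1 ⟨u, hu⟩ = 0) ↔
    ∀ (v : TangentSpace (𝓡 n) (e.1.symm u))
      (α : Fin (p + 1) → (TangentSpace (𝓡 n) (e.1.symm u) →L[ℝ] ℝ))
      (w : Fin (p + 1) → TangentSpace (𝓡 n) (e.1.symm u)),
      (∀ r β, β (w r) = P.toFun _ ![α r, β]) → H.toFun _ (Fin.cons v w) = 0 := by
  constructor
  · intro h v α w hw
    have hw' : w = fun r => ∑ k, α r (e.vec u k) • P.sharp e u (e.covec u k) := by
      funext r
      rw [P.eq_sharp hu (hw r), ← P.sharp_eq_sum hu]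
    let φ : TangentSpace (𝓡 n) (e.1.symm u) →ₗ[ℝ] ℝ :=
      { toFun := fun v => (H.toFun (e.1.symm u)).curryLeft v w
        map_add' := fun a b => by rw [map_add]; rfl
        map_smul' := fun r a => by rw [map_smul]; rfl }
    change φ v = 0
    rw [e.eq_sum_vec hu v, map_sum]
    refine Finset.sum_eq_zero fun i _ => ?_
    rw [map_smul]
    change _ • (H.toFun (e.1.symm u)).curryLeft (e.vec u i) w = 0
    rw [hw']
    refine smul_eq_zero_of_right _ ?_
    refine (MultilinearMap.map_sum
      ((H.toFun (e.1.symm u)).curryLeft (e.vec u i)).toMultilinearMap _).trans ?_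
    refine Finset.sum_eq_zero fun K _ => ?_
    rw [MultilinearMap.map_smul_univ]
    refine smul_eq_zero_of_right _ ?_
    exact (ShiftedCotangent.twistCoeff_apply P H hu i K).symm.trans (h i K)
  · intro h i K
    rw [ShiftedCotangent.twistCoeff_apply P H hu]
    exact h _ (fun r => e.covec u (K r)) _ fun r β => P.apply_sharp hu _ _

theorem SmoothChart.exists_symm_eq (m : M) :
    ∃ (e : SmoothChart n M) (u : EuclideanSpace ℝ (Fin n)), u ∈ e.image ∧ e.1.symm u = m :=
  ⟨⟨chartAt _ m, IsManifold.chart_mem_maximalAtlas m⟩, chartAt _ m m,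
    (chartAt _ m).map_source (mem_chart_source _ m),
    (chartAt _ m).left_inv (mem_chart_source _ m)⟩

theorem ShiftedCotangent.forall_twistCoeff_eq_zero_iff :
    (∀ (e : SmoothChart n M) (i : Fin n) (K : Fin (p + 1) → Fin n),
      ShiftedCotangent.twistCoeff P H e i K = 0) ↔ TwistVanishes P H := by
  constructor
  · intro h m
    obtain ⟨e, u, hu, rfl⟩ := SmoothChart.exists_symm_eq (n := n) m
    refine (ShiftedCotangent.twistCoeff_eq_zero_iff P H hu).1 fun i K => ?_
    rw [h]; rfl
  · intro h e i K
    ext u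
    exact (ShiftedCotangent.twistCoeff_eq_zero_iff P H u.2).2 (h _) i K

/-- Nondegeneracy makes `α ↦ Π(α, ·)` injective from `T_m^*M` to its dual, hence onto by dimension.
Evaluation at any vector `w` is then of this form, so every vector is some `Π♯α` and every value of
`H_m` is covered. -/
theorem eq_zero_of_twistVanishes {m : M} (hP : NondegenerateAt P m) (h : TwistVanishes P H) :
    H.toFun m = 0 := by
  have : FiniteDimensional ℝ (TangentSpace (𝓡 n) m →L[ℝ] ℝ) :=
    inferInstanceAs (FiniteDimensional ℝ (EuclideanSpace ℝ (Fin n) →L[ℝ] ℝ))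
  have hinj : Function.Injective (P.pairing m) :=
    (injective_iff_map_eq_zero _).2 fun α hα => hP α fun β => LinearMap.congr_fun hα β
  have hsurj : Function.Surjective (P.pairing m) :=
    (LinearMap.injective_iff_surjective_of_finrank_eq_finrank
      (Subspace.dual_finrank_eq (K := ℝ)).symm).1 hinj
  have hex : ∀ w : TangentSpace (𝓡 n) m, ∃ α : TangentSpace (𝓡 n) m →L[ℝ] ℝ,
      ∀ β : TangentSpace (𝓡 n) m →L[ℝ] ℝ, β w = P.toFun m ![α, β] := fun w => by
    obtain ⟨α, hα⟩ := hsurj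
      { toFun := fun β => β w, map_add' := fun _ _ => rfl, map_smul' := fun _ _ => rfl }
    exact ⟨α, fun β => (LinearMap.congr_fun hα β).symm⟩
  choose α hα using hex
  ext x
  rw [← Fin.cons_self_tail x]
  exact h m (x 0) (fun r => α (Fin.tail x r)) (Fin.tail x) fun r => hα _

theorem ShiftedCotangent.compatible_iff (hp : 1 ≤ p) : Compatible P R H ↔ TwistVanishes P H := by
  rw [← ShiftedCotangent.forall_twistCoeff_eq_zero_iff]
  refine forall_congr' fun e => ?_
  rw [Q_eq P R H e hp]
  exact lieOdd_twistedField_eq_zero_iff _ _ _ hp (isAntisymm_twistCoeff P H e)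

/-- Compatibility alone already kills the twist, after which `Q` is Hamiltonian and `Q² = 0` is
equivalent to the two bracket conditions. The symplectic axioms hold unconditionally, and the degree
axioms hold for the untwisted field. -/
theorem ShiftedCotangent.isQPManifold_iff (hp : 1 ≤ p) :
    IsQPManifold P R H ↔ IsRPoisson P R ∧ TwistVanishes P H := by
  have hc : IsQPManifold P R H → TwistVanishes P H := fun h =>
    (compatible_iff P R H hp).1 fun e => (h e).compatible
  have key : TwistVanishes P H → ∀ e, Q P R H e = hamField (P.comp e) (R.comp e) := fun h e => by
    rw [Q_eq P R H e hp]
    funext c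
    have : aSum (p := p) (twistCoeff P H e c.2) = 0 := by
      rw [show twistCoeff P H e c.2 = fun _ => 0 from
        funext ((forall_twistCoeff_eq_zero_iff P H).2 h e c.2), aSum_zero]
    rw [twistedField, this, smul_zero, ite_self, add_zero]
  have hsq := fun e : SmoothChart n M => hamField_sq_eq_zero_iff (P.comp e) hp
    (isAntisymm_multivector e P) (isAntisymm_multivector e R)
  constructor
  · intro h
    have h1 := fun e => (hsq e).1 fun f hf => by
      rw [← key (hc h) e]
      exact (h e).homological.sq_eq_zero f hf
    exact ⟨⟨fun e => (h1 e).1, fun e => (h1 e).2⟩, hc h⟩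
  · rintro ⟨h, ht⟩ e
    refine ⟨?_, isSymplectic_omega hp, (compatible_iff P R H hp).2 ht e⟩
    rw [key ht e]
    exact ⟨isVectorField_hamField _ _, hasDegree_hamField _ _ hp,
      (hsq e).2 ⟨h.isPoisson e, h.bracket e⟩⟩

end Twist

end

theorem mainTheorem4 (n p : ℕ) (hp : 1 ≤ p) (M : Type*) [TopologicalSpace M]
    [ChartedSpace (EuclideanSpace ℝ (Fin n)) M] [IsManifold (𝓡 n) ∞ M]
    (P : MultivectorField n M 2) (R : MultivectorField n M (p + 1))
    (H : DifferentialForm n M (p + 2)) (hH : H.IsClosed) :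
    ((∀ m, H.toFun m = 0) →
      ShiftedCotangent.Compatible P R H ∧
      (ShiftedCotangent.IsQPManifold P R H ↔ IsRPoisson P R)) ∧
    (ShiftedCotangent.Compatible P R H ↔ TwistVanishes P H) ∧
    (ShiftedCotangent.IsQPManifold P R H ↔ IsRPoisson P R ∧ TwistVanishes P H) ∧
    (∀ m, NondegenerateAt P m → H.toFun m ≠ 0 → ¬ ShiftedCotangent.Compatible P R H) := by
  have hc := ShiftedCotangent.compatible_iff P R H hp
  have hq := ShiftedCotangent.isQPManifold_iff P R H hp
  refine ⟨fun h0 => ?_, hc, hq, fun m hm hHm h => hHm (eq_zero_of_twistVanishes P H hm (hc.1 h))⟩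
  have ht : TwistVanishes P H := fun m v α w _ => by rw [h0 m]; rfl
  exact ⟨hc.2 ht, hq.trans (and_iff_left ht)⟩
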